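/- Let $\mathcal C$ be a finitely complete category and $\mathsf{Cat}\,\mathcal C$ the category of internal categories $A=(A_0,A_1,d_0,d_1,i,m)$ and internal functors in $\mathcal C$ ($d_0$ is the domain, $d_1$ the codomain). Let $\mathrm{iso}(A)$ be the object of invertible arrows of $A$, with inclusion $j\colon \mathrm{iso}(A)\to A_1$, $\delta_0=d_0j$ and $\delta_1=d_1j$. An internal functor $f\colon A\to B$ is *full* (*faithful*) when for every internal category $X$ the functor $\mathsf{Cat}\,\mathcal C(X,f)\colon \mathsf{Cat}\,\mathcal C(X,A)\to\mathsf{Cat}\,\mathcal C(X,B)$ between categories of internal functors and internal natural transformations is full (faithful). For a class $\mathcal E$ of morphisms of $\mathcal C$, $f$ is an *$\mathcal E$-equivalence* when it is full, faithful and the composite $A_0\times_{B_0}\mathrm{iso}(B)\to\mathrm{iso}(B)\xrightarrow{\delta_0}B_0$ (pullback of $f_0$ and $\delta_1$) is in $\mathcal E$; it is an *$\mathcal E$-fibration* when the comparison $(\delta_1,\mathrm{iso}(f))\colon \mathrm{iso}(A)\to A_0\times_{B_0}\mathrm{iso}(B)$ is in $\mathcal E$. $\mathcal C$ has *enough $\mathcal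 E$-projectives* when for every object $X$ there is a morphism $P\to X$ in $\mathcal E$ such that $\mathcal C(P,-)$ sends the morphisms in $\mathcal E$ to surjections. For a Grothendieck topology $\mathcal T$ on $\mathcal C$, a *$\mathcal T$-epimorphism* is a morphism whose image under the Yoneda embedding followed by sheafification is an epimorphism of sheaves; $\mathcal E_{\mathcal T}$ is the class of these. The $\mathcal T$-equivalences and $\mathcal T$-fibrations are the $\mathcal E_{\mathcal T}$-equivalences and $\mathcal E_{\mathcal T}$-fibrations, and the *$\mathcal T$-cofibrations* are the internal functors with the left lifting property with respect to all $\mathcal T$-fibrations that are $\mathcal T$-equivalences. 1. Suppose that $\mathsf{Cat}\,\mathcal C$ is finitely complete and finitely cocomplete, that the $\mathcal T$-equivalences have the two-out-of-three property, and that $\mathcal C$ has enough $\mathcal E_{\mathcal T}$-projectives. Then $\mathsf{Cat}\,\mathcal C$, with the $\mathcal T$-fibrations, the $\mathcal T$-cofibrations and the $\mathcal T$-equivalences as weak equivalences, is a model category. 2. Let $\mathcal T$ be the regular epimorphism topology, generated by the covering families that consist of a single pullback-stable regular epimorphism. Then $\mathcal E_{\mathcal T}$ is the class of pullback-stable regular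 epimorphisms, and the $\mathcal T$-equivalences are the Bunge–Paré weak equivalences, i.e. the $\mathcal E$-equivalences for the class $\mathcal E$ of pullback-stable regular epimorphisms. If $\mathsf{Cat}\,\mathcal C$ is finitely complete and finitely cocomplete and $\mathcal C$ has enough projectives with respect to pullback-stable regular epimorphisms, then the Bunge–Paré weak equivalences, the $\mathcal T$-fibrations and the $\mathcal T$-cofibrations form a model structure on $\mathsf{Cat}\,\mathcal C$. 3. Suppose that $\mathcal C$ is semi-abelian: pointed, Barr exact (regular, and every equivalence relation is a kernel pair), Bourn protomodular, with binary coproducts. For an internal category $A$ let $N_\bullet$ be the Moore complex of its nerve $\mathrm{ner}\,A$: $N_0=(\mathrm{ner}\,A)_0$, $N_n=\bigcap_{i<n}\mathrm{Ker}\,\partial_i\subseteq(\mathrm{ner}\,A)_n$ for $n\ge1$, with boundary operators induced by $\partial_n$. Then all homology objects $H_nA=\mathrm{Coker}(N_{n+1}\to\mathrm{Ker}(N_n\to N_{n-1}))$, $n\ge 0$ (with $N_{-1}=0$), exist, and an internal functor $f$ is a Bunge–Paré weak equivalence if and only if $H_nf$ is an isomorphism for every $n\ge0$. 4. Let $\mathcal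 C=\mathsf{Set}$ with the trivial topology (only maximal sieves cover). Then the functor from $\mathsf{Cat}\,\mathsf{Set}$ to the category of small categories that sends an internal category to its underlying category is an equivalence, the $\mathcal T$-equivalences, $\mathcal T$-fibrations and $\mathcal T$-cofibrations form a model structure on $\mathsf{Cat}\,\mathsf{Set}$, and this is the folk structure: a functor is a weak equivalence if and only if it is an equivalence of categories; it is a cofibration if and only if it is injective on objects; and $p\colon E\to B$ is a fibration if and only if for every object $e$ of $E$ and every isomorphism $\beta\colon b\to p(e)$ of $B$ there is an isomorphism $\epsilon$ of $E$ with codomain $e$ and $p(\epsilon)=\beta$. -/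

import Mathlib

open CategoryTheory Limits Opposite

universe w v u

noncomputable section

/-! ### Internal categories and internal functors -/

/-- An internal category in a finitely complete category `C`: objects `obj`, arrows `arr`,
domain `d₀`, codomain `d₁`, identities `i`, and a composition `m` on the pullback of `d₁` along
`d₀` (so `m (f, g)` is `g ∘ f`). Associativity is stated on generalized elements. -/
structure InternalCat (C : Type u) [Category.{v} C] [HasFiniteLimits C] where
  obj : C
  arr : C
  d₀ : arr ⟶ obj
  d₁ : arr ⟶ obj
  i : obj ⟶ arr
  m : pullback d₁ d₀ ⟶ arr
  i_d₀ : i ≫ d₀ = 𝟙 obj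
  i_d₁ : i ≫ d₁ = 𝟙 obj
  m_d₀ : m ≫ d₀ = pullback.fst d₁ d₀ ≫ d₀
  m_d₁ : m ≫ d₁ = pullback.snd d₁ d₀ ≫ d₁
  id_m : pullback.lift (f := d₁) (g := d₀) (d₀ ≫ i) (𝟙 arr)
    (by rw [Category.assoc, i_d₁, Category.comp_id, Category.id_comp]) ≫ m = 𝟙 arr
  m_id : pullback.lift (f := d₁) (g := d₀) (𝟙 arr) (d₁ ≫ i)
    (by rw [Category.assoc, i_d₀, Category.comp_id, Category.id_comp]) ≫ m = 𝟙 arr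
  m_assoc : ∀ {X : C} (f g h : X ⟶ arr) (hfg : f ≫ d₁ = g ≫ d₀) (hgh : g ≫ d₁ = h ≫ d₀),
    pullback.lift (f := d₁) (g := d₀) (pullback.lift f g hfg ≫ m) h
      (by rw [Category.assoc, m_d₁, pullback.lift_snd_assoc, hgh]) ≫ m =
    pullback.lift (f := d₁) (g := d₀) f (pullback.lift g h hgh ≫ m)
      (by rw [Category.assoc, m_d₀, pullback.lift_fst_assoc, hfg]) ≫ m

namespace InternalCat

variable {C : Type u} [Category.{v} C] [HasFiniteLimits C]

/-- Composition of generalized arrows: `A.comp f g` is "first `f`, then `g`". -/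
def comp (A : InternalCat C) {X : C} (f g : X ⟶ A.arr) (h : f ≫ A.d₁ = g ≫ A.d₀) : X ⟶ A.arr :=
  pullback.lift f g h ≫ A.m

section comp

variable (A : InternalCat C) {X Y : C}

lemma comp_d₀ (f g : X ⟶ A.arr) (h : f ≫ A.d₁ = g ≫ A.d₀) :
    A.comp f g h ≫ A.d₀ = f ≫ A.d₀ := by
  rw [comp, Category.assoc, A.m_d₀, pullback.lift_fst_assoc]

lemma comp_d₁ (f g : X ⟶ A.arr) (h : f ≫ A.d₁ = g ≫ A.d₀) :
    A.comp f g h ≫ A.d₁ = g ≫ A.d₁ := by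
  rw [comp, Category.assoc, A.m_d₁, pullback.lift_snd_assoc]

lemma precomp_comp (k : Y ⟶ X) (f g : X ⟶ A.arr) (h : f ≫ A.d₁ = g ≫ A.d₀) :
    k ≫ A.comp f g h = A.comp (k ≫ f) (k ≫ g)
      (by rw [Category.assoc, Category.assoc, h]) := by
  rw [comp, comp, ← Category.assoc]
  congr 1
  apply pullback.hom_ext
  · rw [Category.assoc, pullback.lift_fst, pullback.lift_fst]
  · rw [Category.assoc, pullback.lift_snd, pullback.lift_snd]

lemma comp_congr {f f' g g' : X ⟶ A.arr} (hf : f = f') (hg : g = g')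
    (h : f ≫ A.d₁ = g ≫ A.d₀) :
    A.comp f g h = A.comp f' g' (by rw [← hf, ← hg, h]) := by
  subst hf hg
  rfl

lemma comp_assoc (f g h : X ⟶ A.arr) (hfg : f ≫ A.d₁ = g ≫ A.d₀) (hgh : g ≫ A.d₁ = h ≫ A.d₀) :
    A.comp (A.comp f g hfg) h (by rw [comp_d₁, hgh]) =
      A.comp f (A.comp g h hgh) (by rw [comp_d₀, hfg]) :=
  A.m_assoc f g h hfg hgh

lemma id_comp' (f : X ⟶ A.arr) :
    A.comp (f ≫ A.d₀ ≫ A.i) f (by simp [A.i_d₁]) = f := by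
  have := congrArg (f ≫ ·) A.id_m
  change f ≫ A.comp _ _ _ = _ at this
  rw [precomp_comp] at this
  simpa using this

lemma comp_id' (f : X ⟶ A.arr) :
    A.comp f (f ≫ A.d₁ ≫ A.i) (by simp [A.i_d₀]) = f := by
  have := congrArg (f ≫ ·) A.m_id
  change f ≫ A.comp _ _ _ = _ at this
  rw [precomp_comp] at this
  simpa using this

end comp

/-- An internal functor. -/
@[ext]
structure Hom (A B : InternalCat C) where
  f₀ : A.obj ⟶ B.obj
  f₁ : A.arr ⟶ B.arr
  f₁_d₀ : f₁ ≫ B.d₀ = A.d₀ ≫ f₀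
  f₁_d₁ : f₁ ≫ B.d₁ = A.d₁ ≫ f₀
  i_f₁ : A.i ≫ f₁ = f₀ ≫ B.i
  m_f₁ : A.m ≫ f₁ =
    B.comp (pullback.fst A.d₁ A.d₀ ≫ f₁) (pullback.snd A.d₁ A.d₀ ≫ f₁)
      (by rw [Category.assoc, Category.assoc, f₁_d₁, f₁_d₀, pullback.condition_assoc])

lemma Hom.comp_f₁ {A B : InternalCat C} (F : Hom A B) {X : C} (f g : X ⟶ A.arr)
    (h : f ≫ A.d₁ = g ≫ A.d₀) :
    A.comp f g h ≫ F.f₁ = B.comp (f ≫ F.f₁) (g ≫ F.f₁)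
      (by rw [Category.assoc, Category.assoc, F.f₁_d₁, F.f₁_d₀, reassoc_of% h]) := by
  rw [comp, Category.assoc, F.m_f₁, precomp_comp]
  exact comp_congr _ (pullback.lift_fst_assoc ..) (pullback.lift_snd_assoc ..) _

/-- The category `Cat C` of internal categories and internal functors in `C`. -/
instance : Category (InternalCat C) where
  Hom := Hom
  id A :=
    { f₀ := 𝟙 _
      f₁ := 𝟙 _
      f₁_d₀ := by simp
      f₁_d₁ := by simp
      i_f₁ := by simp
      m_f₁ := by
        rw [Category.comp_id]
        have : pullback.lift (pullback.fst A.d₁ A.d₀) (pullback.snd A.d₁ A.d₀)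
            pullback.condition = 𝟙 _ := by
          apply pullback.hom_ext <;> simp
        simp only [comp, Category.comp_id, this, Category.id_comp] }
  comp {A B D} F G :=
    { f₀ := F.f₀ ≫ G.f₀
      f₁ := F.f₁ ≫ G.f₁
      f₁_d₀ := by rw [Category.assoc, G.f₁_d₀, reassoc_of% F.f₁_d₀]
      f₁_d₁ := by rw [Category.assoc, G.f₁_d₁, reassoc_of% F.f₁_d₁]
      i_f₁ := by rw [reassoc_of% F.i_f₁, G.i_f₁, Category.assoc]
      m_f₁ := by
        rw [← Category.assoc, F.m_f₁, G.comp_f₁]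
        exact comp_congr _ (Category.assoc ..) (Category.assoc ..) _ }
  id_comp F := Hom.ext (Category.id_comp _) (Category.id_comp _)
  comp_id F := Hom.ext (Category.comp_id _) (Category.comp_id _)
  assoc F G H := Hom.ext (Category.assoc ..) (Category.assoc ..)

@[simp] lemma id_f₀ (A : InternalCat C) : Hom.f₀ (𝟙 A) = 𝟙 A.obj := rfl
@[simp] lemma id_f₁ (A : InternalCat C) : Hom.f₁ (𝟙 A) = 𝟙 A.arr := rfl
@[simp] lemma comp_f₀ {A B D : InternalCat C} (F : A ⟶ B) (G : B ⟶ D) :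
    (F ≫ G).f₀ = F.f₀ ≫ G.f₀ := rfl
@[simp] lemma comp_f₁ {A B D : InternalCat C} (F : A ⟶ B) (G : B ⟶ D) :
    (F ≫ G).f₁ = F.f₁ ≫ G.f₁ := rfl

/-- An internal natural transformation between internal functors. -/
@[ext]
structure NatTrans {A B : InternalCat C} (f g : A ⟶ B) where
  app : A.obj ⟶ B.arr
  app_d₀ : app ≫ B.d₀ = f.f₀
  app_d₁ : app ≫ B.d₁ = g.f₀
  naturality : B.comp f.f₁ (A.d₁ ≫ app) (by rw [f.f₁_d₁, Category.assoc, app_d₀]) =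
    B.comp (A.d₀ ≫ app) g.f₁ (by rw [g.f₁_d₀, Category.assoc, app_d₁])

/-- `f` is full: each functor `Cat C (X, f) : Cat C (X, A) ⥤ Cat C (X, B)`, which sends an internal
natural transformation `ν` to `ν.app ≫ f.f₁`, is full. -/
def IsFull {A B : InternalCat C} (f : A ⟶ B) : Prop :=
  ∀ ⦃X : InternalCat C⦄ (g h : X ⟶ A) (μ : NatTrans (g ≫ f) (h ≫ f)),
    ∃ ν : NatTrans g h, ν.app ≫ f.f₁ = μ.app

/-- `f` is faithful: each functor `Cat C (X, f)` is faithful. -/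
def IsFaithful {A B : InternalCat C} (f : A ⟶ B) : Prop :=
  ∀ ⦃X : InternalCat C⦄ (g h : X ⟶ A) (ν ν' : NatTrans g h),
    ν.app ≫ f.f₁ = ν'.app ≫ f.f₁ → ν = ν'

/-! ### The object of invertible arrows -/

/-- The object of pairs `(a, b)` of arrows `a : x ⟶ y`, `b : y ⟶ x` of `A`. -/
def antiPairs (A : InternalCat C) : C :=
  pullback (prod.lift A.d₀ A.d₁) (prod.lift A.d₁ A.d₀)

/-- The first arrow of an antiparallel pair. -/
def antiFst (A : InternalCat C) : A.antiPairs ⟶ A.arr := pullback.fst _ _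

/-- The second arrow of an antiparallel pair. -/
def antiSnd (A : InternalCat C) : A.antiPairs ⟶ A.arr := pullback.snd _ _

lemma anti₀ (A : InternalCat C) : A.antiFst ≫ A.d₀ = A.antiSnd ≫ A.d₁ := by
  have := congrArg (· ≫ prod.fst) (pullback.condition (f := prod.lift A.d₀ A.d₁)
    (g := prod.lift A.d₁ A.d₀))
  simp only [Category.assoc, prod.lift_fst] at this
  exact this

lemma anti₁ (A : InternalCat C) : A.antiFst ≫ A.d₁ = A.antiSnd ≫ A.d₀ := by
  have := congrArg (· ≫ prod.snd) (pullback.condition (f := prod.lift A.d₀ A.d₁)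
    (g := prod.lift A.d₁ A.d₀))
  simp only [Category.assoc, prod.lift_snd] at this
  exact this

/-- `iso (A)`, the object of invertible arrows of `A` (the object of arrows of the couniversal
groupoid over `A`): the object of antiparallel pairs `(a, b)` with `b ∘ a = 1` and `a ∘ b = 1`. -/
def iso (A : InternalCat C) : C :=
  equalizer
    (prod.lift (A.comp A.antiFst A.antiSnd A.anti₁) (A.comp A.antiSnd A.antiFst A.anti₀.symm))
    (prod.lift (A.antiFst ≫ A.d₀ ≫ A.i) (A.antiFst ≫ A.d₁ ≫ A.i))

/-- The inclusion of `iso (A)` into the object of antiparallel pairs. -/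
def isoToAnti (A : InternalCat C) : A.iso ⟶ A.antiPairs := equalizer.ι _ _

/-- The inclusion `iso (A) ⟶ A₁`. -/
def isoι (A : InternalCat C) : A.iso ⟶ A.arr := A.isoToAnti ≫ A.antiFst

/-- The inverse arrow, as a morphism `iso (A) ⟶ A₁`. -/
def isoInv (A : InternalCat C) : A.iso ⟶ A.arr := A.isoToAnti ≫ A.antiSnd

/-- The domain `iso (A) ⟶ A₀`. -/
def δ₀ (A : InternalCat C) : A.iso ⟶ A.obj := A.isoι ≫ A.d₀

/-- The codomain `iso (A) ⟶ A₀`. -/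
def δ₁ (A : InternalCat C) : A.iso ⟶ A.obj := A.isoι ≫ A.d₁

/-- Generalized arrows `a`, `b` are mutually inverse. -/
structure IsInversePair (A : InternalCat C) {X : C} (a b : X ⟶ A.arr) : Prop where
  w₀ : b ≫ A.d₁ = a ≫ A.d₀
  w₁ : a ≫ A.d₁ = b ≫ A.d₀
  comp_ab : A.comp a b w₁ = a ≫ A.d₀ ≫ A.i
  comp_ba : A.comp b a w₀ = a ≫ A.d₁ ≫ A.i

lemma isInversePair_iso (A : InternalCat C) : A.IsInversePair A.isoι A.isoInv := by
  have h : A.isoToAnti ≫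
      prod.lift (A.comp A.antiFst A.antiSnd A.anti₁) (A.comp A.antiSnd A.antiFst A.anti₀.symm) =
      A.isoToAnti ≫ prod.lift (A.antiFst ≫ A.d₀ ≫ A.i) (A.antiFst ≫ A.d₁ ≫ A.i) :=
    equalizer.condition _ _
  have h₀ := congrArg (· ≫ prod.fst) h
  have h₁ := congrArg (· ≫ prod.snd) h
  simp only [Category.assoc, prod.lift_fst, prod.lift_snd, precomp_comp] at h₀ h₁
  refine ⟨?_, ?_, ?_, ?_⟩
  · simp only [isoι, isoInv, Category.assoc, A.anti₀]
  · simp only [isoι, isoInv, Category.assoc, A.anti₁]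
  · simpa only [isoι, isoInv, Category.assoc] using h₀
  · simpa only [isoι, isoInv, Category.assoc] using h₁

lemma IsInversePair.condition {A : InternalCat C} {X : C} {a b : X ⟶ A.arr}
    (h : A.IsInversePair a b) :
    a ≫ prod.lift A.d₀ A.d₁ = b ≫ prod.lift A.d₁ A.d₀ := by
  rw [prod.comp_lift, prod.comp_lift, h.w₀, h.w₁]

/-- The morphism to the object of antiparallel pairs given by mutually inverse arrows. -/
def IsInversePair.toAnti {A : InternalCat C} {X : C} {a b : X ⟶ A.arr}
    (h : A.IsInversePair a b) : X ⟶ A.antiPairs := pullback.lift a b h.condition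

lemma IsInversePair.toAnti_fst {A : InternalCat C} {X : C} {a b : X ⟶ A.arr}
    (h : A.IsInversePair a b) : h.toAnti ≫ A.antiFst = a :=
  pullback.lift_fst _ _ h.condition

lemma IsInversePair.toAnti_snd {A : InternalCat C} {X : C} {a b : X ⟶ A.arr}
    (h : A.IsInversePair a b) : h.toAnti ≫ A.antiSnd = b :=
  pullback.lift_snd _ _ h.condition

/-- The morphism into `iso (A)` given by an invertible generalized arrow. -/
def isoLift (A : InternalCat C) {X : C} (a b : X ⟶ A.arr) (h : A.IsInversePair a b) : X ⟶ A.iso :=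
  equalizer.lift h.toAnti (by
    simp only [prod.comp_lift, precomp_comp, reassoc_of% h.toAnti_fst, h.toAnti_fst, h.toAnti_snd,
      h.comp_ab, h.comp_ba])

lemma isoLift_isoι (A : InternalCat C) {X : C} (a b : X ⟶ A.arr) (h : A.IsInversePair a b) :
    A.isoLift a b h ≫ A.isoι = a := by
  have e : A.isoLift a b h ≫ A.isoToAnti = h.toAnti := equalizer.lift_ι _ _
  rw [isoι, reassoc_of% e, h.toAnti_fst]

lemma IsInversePair.map {A B : InternalCat C} (F : A ⟶ B) {X : C} {a b : X ⟶ A.arr}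
    (h : A.IsInversePair a b) : B.IsInversePair (a ≫ F.f₁) (b ≫ F.f₁) where
  w₀ := by simp only [Category.assoc, F.f₁_d₀, F.f₁_d₁, reassoc_of% h.w₀]
  w₁ := by simp only [Category.assoc, F.f₁_d₀, F.f₁_d₁, reassoc_of% h.w₁]
  comp_ab := by
    rw [← F.comp_f₁ a b h.w₁, h.comp_ab]
    simp only [Category.assoc, F.i_f₁, reassoc_of% F.f₁_d₀]
  comp_ba := by
    rw [← F.comp_f₁ b a h.w₀, h.comp_ba]
    simp only [Category.assoc, F.i_f₁, reassoc_of% F.f₁_d₁]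

/-- The morphism `iso (f)₁ : iso (A) ⟶ iso (B)` induced by an internal functor `f : A ⟶ B`. -/
def isoMap {A B : InternalCat C} (f : A ⟶ B) : A.iso ⟶ B.iso :=
  B.isoLift _ _ (A.isInversePair_iso.map f)

lemma isoMap_δ₁ {A B : InternalCat C} (f : A ⟶ B) : A.δ₁ ≫ f.f₀ = isoMap f ≫ B.δ₁ := by
  rw [isoMap, δ₁, δ₁, reassoc_of% isoLift_isoι, Category.assoc, Category.assoc, f.f₁_d₁]

/-! ### Equivalences and fibrations relative to a class of morphisms -/

/-- `f` is essentially `E`-surjective: the composite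
`A₀ ×_{B₀} iso (B) ⟶ iso (B) ⟶ B₀` (pullback of `δ₁` along `f₀`, followed by `δ₀`) is in `E`. -/
def IsEssSurj (E : MorphismProperty C) {A B : InternalCat C} (f : A ⟶ B) : Prop :=
  E (pullback.snd f.f₀ B.δ₁ ≫ B.δ₀)

/-- The class of `E`-equivalences. -/
def relEquivalences (E : MorphismProperty C) : MorphismProperty (InternalCat C) :=
  fun _ _ f => IsFull f ∧ IsFaithful f ∧ IsEssSurj E f

/-- The class of `E`-fibrations: the comparison `iso (E) ⟶ E₀ ×_{B₀} iso (B)` is in `E`. -/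
def relFibrations (E : MorphismProperty C) : MorphismProperty (InternalCat C) :=
  fun A B p => E (pullback.lift (f := p.f₀) (g := B.δ₁) A.δ₁ (isoMap p) (isoMap_δ₁ p))

end InternalCat

/-! ### Classes of morphisms determined by a Grothendieck topology -/

section Topology

variable {C : Type u} [Category.{v} C]

/-- The class of `T`-epimorphisms: the morphisms whose image under the Yoneda embedding followed by
sheafification is an epimorphism of sheaves. Sheaves take values in a universe containing `C`. -/
def tEpi (T : GrothendieckTopology C) : MorphismProperty C := fun _ _ p =>
  Epi ((presheafToSheaf T (Type (max u v))).map (uliftYoneda.{u}.map p))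

/-- `P` is projective with respect to a class `E` of morphisms. -/
def IsProjectiveRel (E : MorphismProperty C) (P : C) : Prop :=
  ∀ ⦃X Y : C⦄ (p : X ⟶ Y), E p → ∀ f : P ⟶ Y, ∃ g : P ⟶ X, g ≫ p = f

/-- `C` has enough `E`-projectives. -/
def HasEnoughProjectivesRel (E : MorphismProperty C) : Prop :=
  ∀ X : C, ∃ (P : C) (p : P ⟶ X), IsProjectiveRel E P ∧ E p

/-- The class of pullback-stable regular epimorphisms. -/
def stableRegularEpi (C : Type u) [Category.{v} C] : MorphismProperty C :=
  (MorphismProperty.regularEpi C).universally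

/-- The regular epimorphism topology: the topology generated by the covering families that consist
of a single pullback-stable regular epimorphism. -/
def regularEpiTopology (C : Type u) [Category.{v} C] : GrothendieckTopology C :=
  sInf {J | ∀ ⦃X Y : C⦄ (p : X ⟶ Y), stableRegularEpi C p →
    Sieve.generate (Presieve.singleton p) ∈ J Y}

variable [HasFiniteLimits C]

/-- The class `we (T)` of `T`-equivalences. -/
def tEquivalences (T : GrothendieckTopology C) : MorphismProperty (InternalCat C) :=
  InternalCat.relEquivalences (tEpi T)

/-- The class `fib (T)` of `T`-fibrations. -/
def tFibrations (T : GrothendieckTopology C) : MorphismProperty (InternalCat C) :=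
  InternalCat.relFibrations (tEpi T)

/-- The class `cof (T)` of `T`-cofibrations. -/
def tCofibrations (T : GrothendieckTopology C) : MorphismProperty (InternalCat C) :=
  (tFibrations T ⊓ tEquivalences T).llp

/-- The weak equivalences of internal categories in the sense of Bunge and Paré: full, faithful and
essentially surjective with respect to (pullback-stable) regular epimorphisms. -/
def bungePareEquivalences (C : Type u) [Category.{v} C] [HasFiniteLimits C] :
    MorphismProperty (InternalCat C) :=
  InternalCat.relEquivalences (stableRegularEpi C)

end Topology

/-- The three classes of morphisms are those of a model category structure on `D`. -/
def IsModelStructure {D : Type u} [Category.{v} D]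
    (fib cof we : MorphismProperty D) : Prop :=
  ∃ M : HomotopicalAlgebra.ModelCategory D,
    @HomotopicalAlgebra.fibrations D _ M.categoryWithFibrations = fib ∧
    @HomotopicalAlgebra.cofibrations D _ M.categoryWithCofibrations = cof ∧
    @HomotopicalAlgebra.weakEquivalences D _ M.categoryWithWeakEquivalences = we

/-! ### Generalized points of an internal category and the nerve -/

namespace InternalCat

variable {C : Type u} [Category.{v} C] [HasFiniteLimits C]

/-- The `X`-points of `A`: the category with objects the morphisms `X ⟶ A₀` and with arrows the
morphisms `X ⟶ A₁`. -/
structure Points (A : InternalCat C) (X : C) where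
  pt : X ⟶ A.obj

instance (A : InternalCat C) (X : C) : Category.{v} (A.Points X) where
  Hom x y := { a : X ⟶ A.arr // a ≫ A.d₀ = x.pt ∧ a ≫ A.d₁ = y.pt }
  id x := ⟨x.pt ≫ A.i, by simp [A.i_d₀], by simp [A.i_d₁]⟩
  comp a b := ⟨A.comp a.1 b.1 (a.2.2.trans b.2.1.symm),
    (A.comp_d₀ ..).trans a.2.1, (A.comp_d₁ ..).trans b.2.2⟩
  id_comp {x y} a := Subtype.ext ((A.comp_congr
    (by simp only [← a.2.1, Category.assoc]) rfl _).trans (A.id_comp' a.1))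
  comp_id {x y} a := Subtype.ext ((A.comp_congr rfl
    (by simp only [← a.2.2, Category.assoc]) _).trans (A.comp_id' a.1))
  assoc a b c := Subtype.ext (A.comp_assoc ..)

lemma Points.id_val {A : InternalCat C} {X : C} (x : A.Points X) :
    Subtype.val (𝟙 x : x ⟶ x) = x.pt ≫ A.i := rfl

lemma Points.comp_val {A : InternalCat C} {X : C} {x y z : A.Points X} (a : x ⟶ y) (b : y ⟶ z) :
    Subtype.val (a ≫ b) = A.comp a.1 b.1 (a.2.2.trans b.2.1.symm) := rfl

/-- Restriction of points along a morphism and application of an internal functor. -/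
def Points.map {A B : InternalCat C} {X Y : C} (F : A ⟶ B) (k : Y ⟶ X) :
    A.Points X ⥤ B.Points Y where
  obj x := ⟨k ≫ x.pt ≫ F.f₀⟩
  map a := ⟨k ≫ a.1 ≫ F.f₁,
    by rw [Category.assoc, Category.assoc, F.f₁_d₀, reassoc_of% a.2.1],
    by rw [Category.assoc, Category.assoc, F.f₁_d₁, reassoc_of% a.2.2]⟩
  map_id x := Subtype.ext (by
    simp only [Points.id_val, Category.assoc, F.i_f₁])
  map_comp a b := Subtype.ext (by
    simp only [Points.comp_val, F.comp_f₁, precomp_comp])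

lemma Points.ext' {A : InternalCat C} {X : C} {x y : A.Points X} (h : x.pt = y.pt) : x = y := by
  cases x
  cases y
  congr

lemma Points.eqToHom_val {A : InternalCat C} {X : C} {x x' y y' : A.Points X} (h : x = x')
    (a : x' ⟶ y') (h' : y' = y) : Subtype.val (eqToHom h ≫ a ≫ eqToHom h' : x ⟶ y) = a.1 := by
  subst h h'
  simp

lemma Points.functor_ext {A : InternalCat C} {X : C} {E : Type*} [Category* E]
    {F G : E ⥤ A.Points X} (h₀ : ∀ d : E, (F.obj d).pt = (G.obj d).pt)
    (h₁ : ∀ (d e : E) (f : d ⟶ e), (F.map f).1 = (G.map f).1) : F = G :=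
  CategoryTheory.Functor.ext (fun d => Points.ext' (h₀ d))
    (fun d e f => Subtype.ext ((h₁ d e f).trans (Points.eqToHom_val _ _ _).symm))

lemma Points.map_id_id (A : InternalCat C) (X : C) :
    Points.map (𝟙 A) (𝟙 X) = 𝟭 (A.Points X) :=
  Points.functor_ext (fun _ => (Category.id_comp _).trans (Category.comp_id _))
    (fun _ _ _ => (Category.id_comp _).trans (Category.comp_id _))

lemma Points.map_congr {A B : InternalCat C} {X Y : C} {F F' : A ⟶ B} {k k' : Y ⟶ X}
    (hF : F = F') (hk : k = k') : Points.map F k = Points.map F' k' := by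
  rw [hF, hk]

lemma Points.map_comp_map {A B D : InternalCat C} {X Y Z : C} (F : A ⟶ B) (G : B ⟶ D)
    (k : Y ⟶ X) (l : Z ⟶ Y) :
    Points.map F k ⋙ Points.map G l = Points.map (F ≫ G) (l ≫ k) :=
  Points.functor_ext (fun _ => by simp [Points.map]) (fun _ _ _ => by simp [Points.map])

/-- The categories of points of internal categories, as a functor to presheaves of categories. -/
def points : InternalCat C ⥤ Cᵒᵖ ⥤ Cat.{v, v} where
  obj A :=
    { obj := fun X => Cat.of (A.Points X.unop)
      map := fun k => (Points.map (𝟙 A) k.unop).toCatHom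
      map_id := fun X => Cat.Hom.ext (Points.map_id_id A X.unop)
      map_comp := fun k l => Cat.Hom.ext (by
        exact Eq.trans (Points.map_congr (Category.comp_id _).symm rfl)
          (Points.map_comp_map _ _ _ _).symm) }
  map F :=
    { app := fun X => (Points.map F (𝟙 X.unop)).toCatHom
      naturality := fun X Y k => Cat.Hom.ext (by
        refine (Points.map_comp_map _ _ _ _).trans
          (Eq.trans ?_ (Points.map_comp_map _ _ _ _).symm)
        exact Points.map_congr ((Category.id_comp F).trans (Category.comp_id F).symm)
          ((Category.id_comp _).trans (Category.comp_id _).symm)) }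
  map_id A := CategoryTheory.NatTrans.ext (funext fun X => Cat.Hom.ext (Points.map_id_id A X.unop))
  map_comp F G := CategoryTheory.NatTrans.ext (funext fun X => Cat.Hom.ext (by
    exact Eq.trans (Points.map_congr rfl (Category.comp_id _).symm)
      (Points.map_comp_map F G (𝟙 X.unop) (𝟙 X.unop)).symm))

/-- The presheaves `X ↦ Cat ([n], A (X))` on `C`, for the categories `A (X)` of `X`-points. -/
def nervePresheaf : InternalCat C ⥤ SimplexCategoryᵒᵖ ⥤ Cᵒᵖ ⥤ Type v :=
  points ⋙ (Functor.whiskeringRight _ _ _).obj nerveFunctor ⋙ flipFunctor _ _ _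

section Representability

variable (A : InternalCat C) (n : ℕ)

/-- The object of strings of `n` composable arrows of `A`: it classifies families
`x₀, …, xₙ` of objects and `a₁, …, aₙ` of arrows with `aᵢ : xᵢ₋₁ ⟶ xᵢ`. -/
def strings : C :=
  equalizer (X := (∏ᶜ fun _ : Fin (n + 1) => A.obj) ⨯ (∏ᶜ fun _ : Fin n => A.arr))
    (Y := ∏ᶜ fun _ : Fin n => A.obj ⨯ A.obj)
    (Pi.lift fun j => prod.snd ≫ Pi.π _ j ≫ prod.lift A.d₀ A.d₁)
    (Pi.lift fun j => prod.fst ≫ prod.lift (Pi.π _ j.castSucc) (Pi.π _ j.succ))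

/-- The inclusion of the object of strings into a product. -/
def stringsι : A.strings n ⟶
    (∏ᶜ fun _ : Fin (n + 1) => A.obj) ⨯ (∏ᶜ fun _ : Fin n => A.arr) := equalizer.ι _ _

/-- The `i`-th object of a string. -/
def stringsObj (i : Fin (n + 1)) : A.strings n ⟶ A.obj :=
  A.stringsι n ≫ prod.fst ≫ Pi.π _ i

/-- The `j`-th arrow of a string. -/
def stringsArr (j : Fin n) : A.strings n ⟶ A.arr :=
  A.stringsι n ≫ prod.snd ≫ Pi.π _ j

lemma strings_condition (j : Fin n) :
    A.stringsArr n j ≫ prod.lift A.d₀ A.d₁ =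
      prod.lift (A.stringsObj n j.castSucc) (A.stringsObj n j.succ) := by
  have h : A.stringsι n ≫ (Pi.lift fun j => prod.snd ≫ Pi.π _ j ≫ prod.lift A.d₀ A.d₁) =
      A.stringsι n ≫
        (Pi.lift fun j => prod.fst ≫ prod.lift (Pi.π _ j.castSucc) (Pi.π _ j.succ)) :=
    equalizer.condition _ _
  have := congrArg (· ≫ Pi.π _ j) h
  simpa only [Category.assoc, Pi.lift_π, stringsArr, stringsObj, prod.comp_lift] using this

lemma stringsArr_d₀ (j : Fin n) :
    A.stringsArr n j ≫ A.d₀ = A.stringsObj n j.castSucc := by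
  have := congrArg (· ≫ prod.fst) (A.strings_condition n j)
  simpa only [Category.assoc, prod.lift_fst] using this

lemma stringsArr_d₁ (j : Fin n) :
    A.stringsArr n j ≫ A.d₁ = A.stringsObj n j.succ := by
  have := congrArg (· ≫ prod.snd) (A.strings_condition n j)
  simpa only [Category.assoc, prod.lift_snd] using this

variable {n} in
lemma strings_hom_ext {X : C} {k l : X ⟶ A.strings n}
    (h₀ : ∀ i, k ≫ A.stringsObj n i = l ≫ A.stringsObj n i)
    (h₁ : ∀ j, k ≫ A.stringsArr n j = l ≫ A.stringsArr n j) : k = l := by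
  have h : k ≫ A.stringsι n = l ≫ A.stringsι n := by
    refine prod.hom_ext (Pi.hom_ext _ _ fun i => ?_) (Pi.hom_ext _ _ fun j => ?_)
    · simpa only [stringsObj, Category.assoc] using h₀ i
    · simpa only [stringsArr, Category.assoc] using h₁ j
  exact equalizer.hom_ext h

variable {n} in
lemma exists_strings_lift {X : C} (x : Fin (n + 1) → (X ⟶ A.obj)) (a : Fin n → (X ⟶ A.arr))
    (h₀ : ∀ j, a j ≫ A.d₀ = x j.castSucc) (h₁ : ∀ j, a j ≫ A.d₁ = x j.succ) :
    ∃ k : X ⟶ A.strings n, (∀ i, k ≫ A.stringsObj n i = x i) ∧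
      ∀ j, k ≫ A.stringsArr n j = a j := by
  have w : prod.lift (Pi.lift x) (Pi.lift a) ≫
      (Pi.lift fun j => prod.snd ≫ Pi.π (fun _ : Fin n => A.arr) j ≫ prod.lift A.d₀ A.d₁) =
      prod.lift (Pi.lift x) (Pi.lift a) ≫ (Pi.lift fun j => prod.fst ≫
        prod.lift (Pi.π (fun _ : Fin (n + 1) => A.obj) j.castSucc) (Pi.π _ j.succ)) := by
    refine Pi.hom_ext _ _ fun j => ?_
    simp only [Category.assoc, Pi.lift_π, prod.lift_snd_assoc, Pi.lift_π_assoc,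
      prod.lift_fst_assoc, prod.comp_lift, h₀, h₁]
  refine ⟨equalizer.lift _ w, fun i => ?_, fun j => ?_⟩
  · exact (equalizer.lift_ι_assoc _ w _).trans (by simp only [prod.lift_fst_assoc, Pi.lift_π])
  · exact (equalizer.lift_ι_assoc _ w _).trans (by simp only [prod.lift_snd_assoc, Pi.lift_π])

/-- The objects of the universal string. -/
def universalObj (i : Fin (n + 1)) : A.Points (A.strings n) := ⟨A.stringsObj n i⟩

/-- The arrows of the universal string. -/
def universalArr (j : Fin n) : A.universalObj n j.castSucc ⟶ A.universalObj n j.succ :=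
  Subtype.mk (A.stringsArr n j) ⟨A.stringsArr_d₀ n j, A.stringsArr_d₁ n j⟩

/-- The universal string of `n` composable arrows. -/
def universalString : ComposableArrows (A.Points (A.strings n)) n :=
  ComposableArrows.mkOfObjOfMapSucc (A.universalObj n) (A.universalArr n)

/-- Restriction of the universal string. -/
def stringOf {X : C} (k : X ⟶ A.strings n) : ComposableArrows (A.Points X) n :=
  A.universalString n ⋙ Points.map (𝟙 A) k

lemma stringOf_obj {X : C} (k : X ⟶ A.strings n) (i : Fin (n + 1)) :
    ((A.stringOf n k).obj i).pt = k ≫ A.stringsObj n i :=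
  congrArg (k ≫ ·) (Category.comp_id _)

lemma stringOf_map {X : C} (k : X ⟶ A.strings n) (j : ℕ) (hj : j < n) :
    ((A.stringOf n k).map' j (j + 1)).1 = k ≫ A.stringsArr n ⟨j, hj⟩ := by
  refine congrArg (k ≫ ·) ((Category.comp_id _).trans ?_)
  exact congrArg Subtype.val (ComposableArrows.mkOfObjOfMapSucc_map_succ
    (A.universalObj n) (A.universalArr n) j hj)

lemma stringOf_bijective (X : C) :
    Function.Bijective (A.stringOf n : (X ⟶ A.strings n) → _) := by
  constructor
  · intro k l h
    refine A.strings_hom_ext (fun i => ?_) (fun j => ?_)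
    · rw [← stringOf_obj, ← stringOf_obj, h]
    · rw [← A.stringOf_map n k j.1 j.2, ← A.stringOf_map n l j.1 j.2, h]
  · intro F
    obtain ⟨k, hk₀, hk₁⟩ := A.exists_strings_lift (fun i => (F.obj i).pt)
      (fun j => (F.map' j.1 (j.1 + 1)).1) (fun j => (F.map' j.1 (j.1 + 1)).2.1)
      (fun j => (F.map' j.1 (j.1 + 1)).2.2)
    refine ⟨k, ComposableArrows.ext (fun i => Points.ext' ?_) (fun j hj => Subtype.ext ?_)⟩
    · rw [stringOf_obj, hk₀]
    · rw [Points.eqToHom_val, A.stringOf_map n k j hj, hk₁]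

lemma nervePresheaf_mem_essImage (n : SimplexCategoryᵒᵖ) :
    yoneda.essImage ((nervePresheaf.obj A).obj n) :=
  ⟨A.strings n.unop.len, ⟨NatIso.ofComponents
    (fun X => (Equiv.ofBijective _ (A.stringOf_bijective n.unop.len X.unop)).toIso)
    (fun {X Y} k => by
      ext l
      refine Eq.trans ?_ (congrArg (A.universalString n.unop.len ⋙ ·)
        (Points.map_comp_map (𝟙 A) (𝟙 A) l k.unop).symm)
      exact congrArg (A.universalString n.unop.len ⋙ ·)
        (Points.map_congr (Category.comp_id _).symm rfl))⟩⟩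

end Representability

/-- The nerve functor `ner : Cat C ⥤ SimplicialObject C`: the simplicial object of strings of
composable arrows, where `ner A` in degree `n` represents `X ↦ Cat ([n], A (X))`. -/
def ner : InternalCat C ⥤ SimplicialObject C :=
  Functor.curry.obj (Functor.essImage.liftFunctor (Functor.uncurry.obj nervePresheaf) yoneda
    (fun x => nervePresheaf_mem_essImage x.1 x.2))

end InternalCat

/-! ### Semi-abelian categories, the Moore complex and homology -/

/-- Semi-abelian categories: pointed, Barr exact, (Bourn) protomodular, with binary coproducts. -/
structure IsSemiAbelian (C : Type u) [Category.{v} C] : Prop where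
  hasZeroObject : HasZeroObject C
  hasBinaryCoproducts : HasBinaryCoproducts C
  regular : Regular C
  exact : ∀ ⦃R X : C⦄ (p₁ p₂ : R ⟶ X), IsEquivalenceRelation p₁ p₂ →
    ∃ (Y : C) (f : X ⟶ Y), IsKernelPair f p₁ p₂
  protomodular : ∀ ⦃X₁ X₂ X₃ Y₁ Y₂ Y₃ : C⦄ (a : X₁ ⟶ X₂) (b : X₂ ⟶ X₃) (c : Y₁ ⟶ Y₂) (d : Y₂ ⟶ Y₃)
    (p₁ : X₁ ⟶ Y₁) (p₂ : X₂ ⟶ Y₂) (p₃ : X₃ ⟶ Y₃), IsSplitEpi p₂ → b ≫ p₃ = p₂ ≫ d →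
    IsPullback a p₁ p₂ c → IsPullback (a ≫ b) p₁ p₃ (c ≫ d) → IsPullback b p₂ p₃ d

section Moore

variable {C : Type u} [Category.{v} C] [HasFiniteLimits C] [HasZeroMorphisms C]

/-- The objects `N₀ S = S₀`, `Nₙ₊₁ S = ⋂ i ≤ n, Ker ∂ᵢ` of the Moore complex. -/
def mooreObj (S : SimplicialObject C) : ℕ → C
  | 0 => S.obj (op (SimplexCategory.mk 0))
  | n + 1 => kernel (Pi.lift fun i : Fin (n + 1) => S.δ i.castSucc)

/-- The inclusion `Nₙ S ⟶ Sₙ`. -/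
def mooreι (S : SimplicialObject C) : ∀ n : ℕ, mooreObj S n ⟶ S.obj (op (SimplexCategory.mk n))
  | 0 => 𝟙 _
  | n + 1 => kernel.ι (Pi.lift fun i : Fin (n + 1) => S.δ i.castSucc)

instance (S : SimplicialObject C) : ∀ n : ℕ, Mono (mooreι S n)
  | 0 => inferInstanceAs (Mono (𝟙 _))
  | n + 1 => inferInstanceAs (Mono (kernel.ι (Pi.lift fun i : Fin (n + 1) => S.δ i.castSucc)))

lemma mooreι_δ (S : SimplicialObject C) (n : ℕ) (i : Fin (n + 1)) :
    mooreι S (n + 1) ≫ S.δ i.castSucc = 0 := by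
  have h : mooreι S (n + 1) ≫ (Pi.lift fun i : Fin (n + 1) => S.δ i.castSucc) = 0 :=
    kernel.condition _
  have := congrArg (· ≫ Pi.π _ i) h
  simpa only [Category.assoc, Pi.lift_π, zero_comp] using this

lemma exists_mooreLift (S : SimplicialObject C) {X : C} {n : ℕ}
    (x : X ⟶ S.obj (op (SimplexCategory.mk (n + 1))))
    (hx : ∀ i : Fin (n + 1), x ≫ S.δ i.castSucc = 0) :
    ∃ y : X ⟶ mooreObj S (n + 1), y ≫ mooreι S (n + 1) = x :=
  ⟨kernel.lift _ x (Pi.hom_ext _ _ fun i => by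
    simpa only [Category.assoc, Pi.lift_π, zero_comp] using hx i), kernel.lift_ι _ _ _⟩

lemma exists_mooreD (S : SimplicialObject C) (n : ℕ) :
    ∃ d : mooreObj S (n + 1) ⟶ mooreObj S n,
      d ≫ mooreι S n = mooreι S (n + 1) ≫ S.δ (Fin.last (n + 1)) := by
  obtain _ | m := n
  · exact ⟨_, Category.comp_id _⟩
  refine exists_mooreLift S _ fun i => ?_
  rw [Category.assoc]
  have := S.δ_comp_δ (i := i.castSucc) (j := Fin.last (m + 1)) (Fin.le_last _)
  rw [Fin.succ_last] at this
  rw [this, ← Category.assoc, mooreι_δ, zero_comp]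

/-- The boundary operator `Nₙ₊₁ S ⟶ Nₙ S`, induced by the last face operator `∂ₙ₊₁`. -/
def mooreD (S : SimplicialObject C) (n : ℕ) : mooreObj S (n + 1) ⟶ mooreObj S n :=
  (exists_mooreD S n).choose

lemma mooreD_ι (S : SimplicialObject C) (n : ℕ) :
    mooreD S n ≫ mooreι S n = mooreι S (n + 1) ≫ S.δ (Fin.last (n + 1)) :=
  (exists_mooreD S n).choose_spec

lemma mooreD_mooreD (S : SimplicialObject C) (n : ℕ) : mooreD S (n + 1) ≫ mooreD S n = 0 := by
  rw [← cancel_mono (mooreι S n), Category.assoc, mooreD_ι, reassoc_of% mooreD_ι S (n + 1)]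
  have := S.δ_comp_δ (i := Fin.last (n + 1)) (j := Fin.last (n + 1)) le_rfl
  rw [Fin.succ_last] at this
  rw [this, ← Category.assoc, mooreι_δ, zero_comp, zero_comp]

lemma exists_mooreMap {S S' : SimplicialObject C} (φ : S ⟶ S') (n : ℕ) :
    ∃ y : mooreObj S n ⟶ mooreObj S' n, y ≫ mooreι S' n = mooreι S n ≫ φ.app (op (SimplexCategory.mk n)) := by
  obtain _ | m := n
  · exact ⟨_, Category.comp_id _⟩
  refine exists_mooreLift S' _ fun i => ?_
  rw [Category.assoc, SimplicialObject.δ,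
    ← φ.naturality, ← SimplicialObject.δ_def, ← Category.assoc, mooreι_δ, zero_comp]

/-- The morphism `Nₙ S ⟶ Nₙ S'` induced by a simplicial morphism. -/
def mooreMap {S S' : SimplicialObject C} (φ : S ⟶ S') (n : ℕ) : mooreObj S n ⟶ mooreObj S' n :=
  (exists_mooreMap φ n).choose

lemma mooreMap_ι {S S' : SimplicialObject C} (φ : S ⟶ S') (n : ℕ) :
    mooreMap φ n ≫ mooreι S' n = mooreι S n ≫ φ.app (op (SimplexCategory.mk n)) :=
  (exists_mooreMap φ n).choose_spec

/-- The Moore complex functor `N`. -/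
def mooreComplex : SimplicialObject C ⥤ ChainComplex C ℕ where
  obj S := ChainComplex.of (mooreObj S) (mooreD S) (mooreD_mooreD S)
  map {S S'} φ := ChainComplex.ofHom (mooreMap φ) (fun n => by
    refine Eq.trans (congrArg (mooreMap φ (n + 1) ≫ ·) (ChainComplex.of_d (mooreObj S') _ n))
      (Eq.trans ?_ (congrArg (· ≫ mooreMap φ n) (ChainComplex.of_d (mooreObj S) _ n)).symm)
    rw [← cancel_mono (mooreι S' n), Category.assoc,
      Category.assoc, mooreD_ι, mooreMap_ι, reassoc_of% mooreMap_ι φ (n + 1),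
      reassoc_of% mooreD_ι S n, SimplicialObject.δ, SimplicialObject.δ, φ.naturality])
  map_id S := HomologicalComplex.hom_ext _ _ fun n => by
    refine (cancel_mono (mooreι S n)).1 ((mooreMap_ι (𝟙 S) n).trans ?_)
    exact (Category.comp_id _).trans (Category.id_comp _).symm
  map_comp {S S' S''} φ ψ := HomologicalComplex.hom_ext _ _ fun n => by
    refine (cancel_mono (mooreι S'' n)).1 ((mooreMap_ι (φ ≫ ψ) n).trans ?_)
    refine Eq.trans ?_ (Category.assoc (mooreMap φ n) (mooreMap ψ n) _).symm
    rw [mooreMap_ι, reassoc_of% mooreMap_ι φ n]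
    rfl

/-- The `n`-th homology short complex `Nₙ₊₁ ⟶ Nₙ ⟶ Nₙ₋₁` of the nerve of an internal category
(with `N₋₁ = 0`). Its left homology is `Hₙ A = Coker (Nₙ₊₁ ⟶ Ker (Nₙ ⟶ Nₙ₋₁))`. -/
def homologyShortComplex (n : ℕ) : InternalCat C ⥤ ShortComplex C :=
  InternalCat.ner ⋙ mooreComplex ⋙ HomologicalComplex.shortComplexFunctor C _ n

end Moore

/-- The underlying small category of an internal category in the category of sets: its category of
points over the one-point set. -/
def underlyingCat : InternalCat (Type w) ⥤ Cat.{w, w} :=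
  InternalCat.points ⋙ (evaluation _ _).obj (op PUnit)

end

/-! Everything is done on generalized elements: the morphisms from `Z` to the objects and arrows of
`A` form an ordinary category, and constructions natural in `Z` are internal ones. In these terms
full and faithful means `IsFF`, the unique lifting of arrows with given endpoints (`isFF_iff`).

Model structure. Apart from enough projectives and two-out-of-three, the only property of `E = tEpi
T` that matters is that a morphism seen as surjective by all `E`-projectives lies in `E`. Fibrations
and essential surjectivity can then be tested on elements with projective domain, as for ordinary
categories, and the trivial fibrations are the fully faithful functors with object part in `E`.
Lifting against them is a problem about objects, which is solvable when the object part of `j` is a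
summand with projective complement. Such `j` give the first factorization; combined with the
category of pairs `(a, b ≅ f a)` they give the second. If such a `j` is also an equivalence, its
codomain retracts onto its domain by a deformation that a fibration can lift
(`hasLiftingProperty_of_equivalence`); a retract argument covers all trivial cofibrations.

Regular epimorphisms. A morphism is a `T`-epimorphism exactly when the sieve it generates covers,
and the pullback-stable regular epimorphisms are exactly the single generators of canonical covering
sieves. Two-out-of-three holds because the equivalences are the functors that induce equivalences of
categories of `P`-points for all projective `P`. The trivial topology on sets is treated the same
way, and there the one-point set suffices.

Semi-abelian case. Protomodularity reduces comparisons over a split epimorphism to kernels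
(`isIso_of_kernel`). It makes every internal category a groupoid, so the image of `(d₀, d₁)` is an
equivalence relation and, by exactness, has a quotient, which is `H₀`. The Moore complex of a nerve
vanishes from degree two on, and `H₁` is the object of arrows from zero to zero. An isomorphism on
`H₀` gives essential surjectivity and decides which objects are joined by an arrow; an isomorphism
on `H₁` then compares all the fibres of `(d₀, d₁)` that contain an arrow (`existsUnique_of_kernel`).
-/

noncomputable section

namespace InternalCat

variable {C : Type u} [Category.{v} C] [HasFiniteLimits C]

attribute [local simp] pullback.lift_fst pullback.lift_snd pullback.lift_fst_assoc
  pullback.lift_snd_assoc prod.lift_fst prod.lift_snd prod.lift_fst_assoc prod.lift_snd_assoc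
  prod.map_fst prod.map_snd prod.map_fst_assoc prod.map_snd_assoc

/-! ### Constructions on generalized elements -/

/-- An internal category from a composition defined on generalized elements. -/
def ofElements {obj arr : C} (d₀ d₁ : arr ⟶ obj) (i : obj ⟶ arr) (i_d₀ : i ≫ d₀ = 𝟙 obj)
    (i_d₁ : i ≫ d₁ = 𝟙 obj)
    (mul : ∀ {X : C} (f g : X ⟶ arr), f ≫ d₁ = g ≫ d₀ → (X ⟶ arr))
    (precomp_mul : ∀ {X Y : C} (k : Y ⟶ X) (f g : X ⟶ arr) (h : f ≫ d₁ = g ≫ d₀),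
      k ≫ mul f g h = mul (k ≫ f) (k ≫ g) (by rw [Category.assoc, Category.assoc, h]))
    (mul_d₀ : ∀ {X : C} (f g : X ⟶ arr) (h : f ≫ d₁ = g ≫ d₀), mul f g h ≫ d₀ = f ≫ d₀)
    (mul_d₁ : ∀ {X : C} (f g : X ⟶ arr) (h : f ≫ d₁ = g ≫ d₀), mul f g h ≫ d₁ = g ≫ d₁)
    (id_mul : ∀ {X : C} (f : X ⟶ arr), mul (f ≫ d₀ ≫ i) f (by simp [i_d₁]) = f)
    (mul_id : ∀ {X : C} (f : X ⟶ arr), mul f (f ≫ d₁ ≫ i) (by simp [i_d₀]) = f)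
    (mul_assoc : ∀ {X : C} (f g h : X ⟶ arr) (hfg : f ≫ d₁ = g ≫ d₀) (hgh : g ≫ d₁ = h ≫ d₀),
      mul (mul f g hfg) h (by rw [mul_d₁, hgh]) = mul f (mul g h hgh) (by rw [mul_d₀, hfg])) :
    InternalCat C where
  obj := obj
  arr := arr
  d₀ := d₀
  d₁ := d₁
  i := i
  m := mul (pullback.fst d₁ d₀) (pullback.snd d₁ d₀) pullback.condition
  i_d₀ := i_d₀
  i_d₁ := i_d₁
  m_d₀ := mul_d₀ ..
  m_d₁ := mul_d₁ ..
  id_m := by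
    rw [precomp_mul]
    simpa using id_mul (𝟙 arr)
  m_id := by
    rw [precomp_mul]
    simpa using mul_id (𝟙 arr)
  m_assoc f g h hfg hgh := by
    simpa only [precomp_mul, pullback.lift_fst, pullback.lift_snd] using mul_assoc f g h hfg hgh

section

variable {obj arr : C} (d₀ d₁ : arr ⟶ obj) (i : obj ⟶ arr) (i_d₀ i_d₁)
  (mul : ∀ {X : C} (f g : X ⟶ arr), f ≫ d₁ = g ≫ d₀ → (X ⟶ arr))
  (precomp_mul mul_d₀ mul_d₁ id_mul mul_id mul_assoc)

lemma ofElements_comp {X : C} (f g : X ⟶ arr) (h : f ≫ d₁ = g ≫ d₀) :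
    (ofElements d₀ d₁ i i_d₀ i_d₁ mul precomp_mul mul_d₀ mul_d₁ id_mul mul_id mul_assoc).comp f g h
      = mul f g h := by
  refine (precomp_mul (pullback.lift f g h) _ _ pullback.condition).trans ?_
  simp only [pullback.lift_fst, pullback.lift_snd]

end

/-- An internal functor from the preservation of composition of generalized elements. -/
def Hom.ofElements {A B : InternalCat C} (f₀ : A.obj ⟶ B.obj) (f₁ : A.arr ⟶ B.arr)
    (f₁_d₀ : f₁ ≫ B.d₀ = A.d₀ ≫ f₀) (f₁_d₁ : f₁ ≫ B.d₁ = A.d₁ ≫ f₀)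
    (i_f₁ : A.i ≫ f₁ = f₀ ≫ B.i)
    (comp_f₁ : ∀ {X : C} (s t : X ⟶ A.arr) (h : s ≫ A.d₁ = t ≫ A.d₀),
      A.comp s t h ≫ f₁ = B.comp (s ≫ f₁) (t ≫ f₁)
        (by rw [Category.assoc, Category.assoc, f₁_d₁, f₁_d₀, reassoc_of% h])) : A ⟶ B where
  f₀ := f₀
  f₁ := f₁
  f₁_d₀ := f₁_d₀
  f₁_d₁ := f₁_d₁
  i_f₁ := i_f₁
  m_f₁ := by
    rw [← comp_f₁ _ _ pullback.condition, comp]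
    congr 1
    refine (Category.id_comp A.m).symm.trans (congrArg (· ≫ A.m) ?_)
    apply pullback.hom_ext <;> simp

lemma hom_ext {A B : InternalCat C} {f g : A ⟶ B} (h₀ : f.f₀ = g.f₀) (h₁ : f.f₁ = g.f₁) : f = g :=
  Hom.ext h₀ h₁

/-! ### Mutually inverse generalized arrows -/

section inverses

variable {A B : InternalCat C} {X Y : C}

lemma IsInversePair.symm {a b : X ⟶ A.arr} (h : A.IsInversePair a b) : A.IsInversePair b a where
  w₀ := h.w₁
  w₁ := h.w₀
  comp_ab := by rw [h.comp_ba, reassoc_of% h.w₁]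
  comp_ba := by rw [h.comp_ab, reassoc_of% h.w₀]

lemma IsInversePair.precomp {a b : X ⟶ A.arr} (h : A.IsInversePair a b) (k : Y ⟶ X) :
    A.IsInversePair (k ≫ a) (k ≫ b) where
  w₀ := by simp only [Category.assoc, h.w₀]
  w₁ := by simp only [Category.assoc, h.w₁]
  comp_ab := by rw [← precomp_comp _ _ _ _ h.w₁, h.comp_ab, Category.assoc]
  comp_ba := by rw [← precomp_comp _ _ _ _ h.w₀, h.comp_ba, Category.assoc]

lemma isInversePair_id (x : X ⟶ A.obj) : A.IsInversePair (x ≫ A.i) (x ≫ A.i) := by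
  have h : A.comp (x ≫ A.i) (x ≫ A.i) (by simp [A.i_d₀, A.i_d₁]) = x ≫ A.i := by
    have := A.id_comp' (x ≫ A.i)
    simpa only [Category.assoc, reassoc_of% A.i_d₀] using this
  refine ⟨by simp [A.i_d₀, A.i_d₁], by simp [A.i_d₀, A.i_d₁], ?_, ?_⟩ <;>
    simp [h, reassoc_of% A.i_d₀, reassoc_of% A.i_d₁]

lemma comp_cancel_left {a b t : X ⟶ A.arr} (h : A.IsInversePair a b) (ht : a ≫ A.d₁ = t ≫ A.d₀) :
    A.comp b (A.comp a t ht) (by rw [comp_d₀, h.w₀]) = t := by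
  rw [← comp_assoc _ _ _ _ h.w₀ ht]
  simp only [h.comp_ba, reassoc_of% ht, id_comp']

lemma comp_cancel_right {a b t : X ⟶ A.arr} (h : A.IsInversePair a b) (ht : t ≫ A.d₁ = a ≫ A.d₀) :
    A.comp (A.comp t a ht) b (by rw [comp_d₁, h.w₁]) = t := by
  rw [comp_assoc _ _ _ _ ht h.w₁]
  simp only [h.comp_ab, ← reassoc_of% ht, comp_id']

lemma IsInversePair.unique {a b b' : X ⟶ A.arr} (h : A.IsInversePair a b)
    (h' : A.IsInversePair a b') : b = b' := by
  have := comp_cancel_right (t := b') h h'.w₀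
  simp only [h'.comp_ba, reassoc_of% h.w₁, id_comp'] at this
  exact this

lemma IsInversePair.comp {a b a' b' : X ⟶ A.arr} (h : A.IsInversePair a b)
    (h' : A.IsInversePair a' b') (w : a ≫ A.d₁ = a' ≫ A.d₀) :
    A.IsInversePair (A.comp a a' w) (A.comp b' b (by rw [h'.w₀, ← w, h.w₁])) where
  w₀ := by rw [comp_d₁, comp_d₀, h.w₀]
  w₁ := by rw [comp_d₁, comp_d₀, h'.w₁]
  comp_ab := by
    rw [comp_assoc _ _ _ _ w (by rw [comp_d₀, h'.w₁])]
    simp only [comp_cancel_left h'.symm, h.comp_ab, ← reassoc_of% A.comp_d₀ a a' w]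
  comp_ba := by
    have w' : b' ≫ A.d₁ = b ≫ A.d₀ := by rw [h'.w₀, ← w, h.w₁]
    rw [comp_assoc _ _ _ _ w' (by rw [comp_d₀, h.w₀])]
    simp only [comp_cancel_left h, h'.comp_ba, ← reassoc_of% A.comp_d₁ a a' w]

/-- Inverses are unique, so an invertible arrow determines the pair. -/
instance : Mono A.isoι where
  right_cancellation {Z} k l h := by
    have hk := (A.isInversePair_iso.precomp k)
    have hl := (A.isInversePair_iso.precomp l)
    rw [← h] at hl
    have e := hk.unique hl
    have : Mono A.isoToAnti := inferInstanceAs (Mono (equalizer.ι _ _))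
    rw [← cancel_mono A.isoToAnti]
    refine pullback.hom_ext ?_ ?_
    · exact (Category.assoc ..).trans (h.trans (Category.assoc ..).symm)
    · exact (Category.assoc ..).trans (e.trans (Category.assoc ..).symm)

lemma isoMap_isoι (f : A ⟶ B) : isoMap f ≫ B.isoι = A.isoι ≫ f.f₁ := isoLift_isoι ..

end inverses

/-! ### Fully faithful internal functors -/

/-- `f` is fully faithful on generalized elements. -/
def IsFF {A B : InternalCat C} (f : A ⟶ B) : Prop :=
  ∀ ⦃Z : C⦄ (x y : Z ⟶ A.obj) (t : Z ⟶ B.arr), t ≫ B.d₀ = x ≫ f.f₀ → t ≫ B.d₁ = y ≫ f.f₀ →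
    ∃! s : Z ⟶ A.arr, s ≫ A.d₀ = x ∧ s ≫ A.d₁ = y ∧ s ≫ f.f₁ = t

/-- The discrete internal category on an object. -/
def disc (Z : C) : InternalCat C :=
  ofElements (𝟙 Z) (𝟙 Z) (𝟙 Z) (by simp) (by simp) (fun f _ _ => f) (fun _ _ _ _ => rfl)
    (fun _ _ _ => rfl) (fun f g h => h) (fun f => by simp) (fun _ => rfl) (fun _ _ _ _ _ => rfl)

lemma disc_d₁ (Z : C) : (disc Z).d₁ = (disc Z).d₀ := rfl

lemma disc_comp {Z X : C} (f g : X ⟶ (disc Z).arr) (h : f ≫ (disc Z).d₁ = g ≫ (disc Z).d₀) :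
    (disc Z).comp f g h = f :=
  pullback.lift_fst ..

lemma disc_arr_ext {Z X : C} {f g : X ⟶ (disc Z).arr} (h : f ≫ (disc Z).d₁ = g ≫ (disc Z).d₀) :
    f = g :=
  (Category.comp_id f).symm.trans (h.trans (Category.comp_id g))

/-- The internal functor on a discrete internal category. -/
def discHom {Z : C} {A : InternalCat C} (x : (disc Z).obj ⟶ A.obj) : disc Z ⟶ A :=
  Hom.ofElements (A := disc Z) x ((disc Z).d₀ ≫ x ≫ A.i)
    (by rw [Category.assoc, Category.assoc, A.i_d₀, Category.comp_id])
    (by rw [Category.assoc, Category.assoc, A.i_d₁, Category.comp_id, disc_d₁])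
    (by rw [reassoc_of% (disc Z).i_d₀]) (fun {X} s t h => by
      obtain rfl := disc_arr_ext h
      rw [disc_comp]
      have := A.id_comp' (s ≫ (disc Z).d₀ ≫ x ≫ A.i)
      simpa only [Category.assoc, reassoc_of% A.i_d₀] using this.symm)

lemma disc_hom_f₁ {Z : C} {A : InternalCat C} (k : disc Z ⟶ A) :
    k.f₁ = (disc Z).d₀ ≫ k.f₀ ≫ A.i := by
  rw [← k.i_f₁]
  exact (Category.id_comp _).symm.trans (Category.id_comp _).symm

/-- Internal natural transformations between functors on a discrete internal category. -/
def discNatTrans {Z : C} {A : InternalCat C} {f g : disc Z ⟶ A} (t : (disc Z).obj ⟶ A.arr)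
    (h₀ : t ≫ A.d₀ = f.f₀) (h₁ : t ≫ A.d₁ = g.f₀) : NatTrans f g where
  app := t
  app_d₀ := h₀
  app_d₁ := h₁
  naturality := by
    have e₀ : f.f₁ = ((disc Z).d₀ ≫ t) ≫ A.d₀ ≫ A.i := by
      rw [disc_hom_f₁, ← h₀, Category.assoc, Category.assoc]
    have e₁ : g.f₁ = ((disc Z).d₀ ≫ t) ≫ A.d₁ ≫ A.i := by
      rw [disc_hom_f₁, ← h₁, Category.assoc, Category.assoc]
    rw [A.comp_congr e₀ (by rw [disc_d₁]), A.comp_congr rfl e₁, id_comp', comp_id']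

/-- A generalized arrow with domain `Z` is a natural transformation between functors on `disc Z`;
testing there gives `IsFF`. Conversely, components lift uniquely. -/
lemma isFF_iff {A B : InternalCat C} (f : A ⟶ B) : IsFF f ↔ IsFull f ∧ IsFaithful f := by
  constructor
  · intro hf
    refine ⟨fun X g h μ => ?_, fun X g h ν ν' e => ?_⟩
    · obtain ⟨s, ⟨hs₀, hs₁, hs⟩, -⟩ := hf g.f₀ h.f₀ μ.app μ.app_d₀ μ.app_d₁
      refine ⟨⟨s, hs₀, hs₁, ?_⟩, hs⟩
      -- Both sides of the naturality square have the same endpoints and the same image under `f`,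
      -- so uniqueness of lifts identifies them.
      refine (hf (X.d₀ ≫ g.f₀) (X.d₁ ≫ h.f₀) (B.comp (X.d₀ ≫ μ.app) (h.f₁ ≫ f.f₁) ?_)
        ?_ ?_).unique ⟨?_, ?_, ?_⟩ ⟨?_, ?_, ?_⟩
      · rw [Category.assoc, μ.app_d₁, ← comp_f₁, Hom.f₁_d₀]
      · rw [comp_d₀, Category.assoc, μ.app_d₀, comp_f₀, Category.assoc]
      · rw [comp_d₁, ← comp_f₁, Hom.f₁_d₁, comp_f₀, Category.assoc]
      · rw [comp_d₀, g.f₁_d₀]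
      · rw [comp_d₁, Category.assoc, hs₁]
      · rw [f.comp_f₁]
        have := μ.naturality
        simp only [comp_f₁] at this
        rw [← this]
        exact comp_congr _ rfl (by rw [Category.assoc, hs]) _
      · rw [comp_d₀, Category.assoc, hs₀]
      · rw [comp_d₁, h.f₁_d₁]
      · rw [f.comp_f₁]
        exact comp_congr _ (by rw [Category.assoc, hs]) rfl _
    · refine NatTrans.ext ?_
      refine (hf g.f₀ h.f₀ (ν.app ≫ f.f₁) ?_ ?_).unique ⟨ν.app_d₀, ν.app_d₁, rfl⟩
        ⟨ν'.app_d₀, ν'.app_d₁, e.symm⟩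
      · rw [Category.assoc, f.f₁_d₀, reassoc_of% ν.app_d₀]
      · rw [Category.assoc, f.f₁_d₁, reassoc_of% ν.app_d₁]
  · rintro ⟨h₁, h₂⟩ Z x y t ht₀ ht₁
    obtain ⟨ν, hν⟩ := h₁ (discHom x) (discHom y) (discNatTrans t ht₀ ht₁)
    refine ⟨ν.app, ⟨ν.app_d₀, ν.app_d₁, hν⟩, fun s ⟨hs₀, hs₁, hs⟩ => ?_⟩
    exact congrArg NatTrans.app (h₂ _ _ (discNatTrans (f := discHom x) (g := discHom y) s hs₀ hs₁) ν
      (hs.trans hν.symm))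

lemma IsFF.eq {A B : InternalCat C} {f : A ⟶ B} (hf : IsFF f) {Z : C} {s s' : Z ⟶ A.arr}
    (h₀ : s ≫ A.d₀ = s' ≫ A.d₀) (h₁ : s ≫ A.d₁ = s' ≫ A.d₁) (h : s ≫ f.f₁ = s' ≫ f.f₁) :
    s = s' :=
  (hf (s ≫ A.d₀) (s ≫ A.d₁) (s ≫ f.f₁) (by simp [f.f₁_d₀]) (by simp [f.f₁_d₁])).unique
    ⟨rfl, rfl, rfl⟩ ⟨h₀.symm, h₁.symm, h.symm⟩

/-- A lift of `g t` along `f ≫ g` lifts `t` itself, because `g` is faithful. In particular a section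
of a fully faithful functor is fully faithful, which serves the path factorization. -/
lemma IsFF.of_comp {A B D : InternalCat C} {f : A ⟶ B} {g : B ⟶ D} (hg : IsFF g)
    (h : IsFF (f ≫ g)) : IsFF f := by
  intro Z x y t h₀ h₁
  obtain ⟨s, ⟨hs₀, hs₁, hs⟩, -⟩ := h x y (t ≫ g.f₁) (by simp [g.f₁_d₀, reassoc_of% h₀])
    (by simp [g.f₁_d₁, reassoc_of% h₁])
  refine ⟨s, ⟨hs₀, hs₁, hg.eq ?_ ?_ (by simpa using hs)⟩, fun s' ⟨e₀, e₁, e⟩ => ?_⟩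
  · simp [f.f₁_d₀, reassoc_of% hs₀, h₀]
  · simp [f.f₁_d₁, reassoc_of% hs₁, h₁]
  · exact h.eq (e₀.trans hs₀.symm) (e₁.trans hs₁.symm) (by rw [hs, comp_f₁, reassoc_of% e])

lemma isFF_id (A : InternalCat C) : IsFF (𝟙 A) := fun Z x y t h₀ h₁ =>
  ⟨t, ⟨by simpa using h₀, by simpa using h₁, by simp⟩, fun s h => by simpa using h.2.2⟩

lemma IsFF.comp_eq {A B : InternalCat C} {f : A ⟶ B} (hf : IsFF f) {Z : C} {r s t : Z ⟶ A.arr}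
    (w : r ≫ A.d₁ = s ≫ A.d₀) (h₀ : t ≫ A.d₀ = r ≫ A.d₀) (h₁ : t ≫ A.d₁ = s ≫ A.d₁)
    (h : B.comp (r ≫ f.f₁) (s ≫ f.f₁) (by simp [f.f₁_d₀, f.f₁_d₁, reassoc_of% w]) = t ≫ f.f₁) :
    A.comp r s w = t :=
  hf.eq (by rw [comp_d₀, h₀]) (by rw [comp_d₁, h₁]) (by rw [f.comp_f₁, h])

/-- Fully faithful internal functors reflect inverses. -/
lemma IsFF.exists_inverse {A B : InternalCat C} {f : A ⟶ B} (hf : IsFF f) {Z : C}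
    {x y : Z ⟶ A.obj} {a b : Z ⟶ B.arr} (h : B.IsInversePair a b) (h₀ : a ≫ B.d₀ = x ≫ f.f₀)
    (h₁ : a ≫ B.d₁ = y ≫ f.f₀) :
    ∃ s t : Z ⟶ A.arr, A.IsInversePair s t ∧ s ≫ A.d₀ = x ∧ s ≫ A.d₁ = y ∧ s ≫ f.f₁ = a := by
  obtain ⟨s, ⟨hs₀, hs₁, hs⟩, -⟩ := hf x y a h₀ h₁
  obtain ⟨t, ⟨ht₀, ht₁, ht⟩, -⟩ := hf y x b (by rw [← h.w₁, h₁]) (by rw [h.w₀, h₀])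
  refine ⟨s, t, ⟨by rw [ht₁, hs₀], by rw [hs₁, ht₀], ?_, ?_⟩, hs₀, hs₁, hs⟩
  · refine hf.comp_eq _ (by simp [A.i_d₀]) (by simp [A.i_d₁, hs₀, ht₁]) ?_
    simp only [hs, ht, h.comp_ab, Category.assoc, f.i_f₁, reassoc_of% hs₀, reassoc_of% h₀]
  · refine hf.comp_eq _ (by simp [A.i_d₀, hs₁, ht₀]) (by simp [A.i_d₁]) ?_
    simp only [hs, ht, h.comp_ba, Category.assoc, f.i_f₁, reassoc_of% hs₁, reassoc_of% h₁]

/-- Lifting internal functors along a fully faithful one. -/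
lemma IsFF.exists_lift {A B D : InternalCat C} {p : A ⟶ B} (hp : IsFF p) (v : D ⟶ B)
    (h : D.obj ⟶ A.obj) (e : h ≫ p.f₀ = v.f₀) : ∃ k : D ⟶ A, k.f₀ = h ∧ k ≫ p = v := by
  obtain ⟨s, ⟨hs₀, hs₁, hs⟩, -⟩ := hp (D.d₀ ≫ h) (D.d₁ ≫ h) v.f₁
    (by rw [v.f₁_d₀, Category.assoc, e]) (by rw [v.f₁_d₁, Category.assoc, e])
  refine ⟨Hom.ofElements h s hs₀ hs₁ ?_ ?_, rfl, hom_ext e hs⟩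
  · refine hp.eq ?_ ?_ ?_
    · simp [hs₀, reassoc_of% D.i_d₀, A.i_d₀]
    · simp [hs₁, reassoc_of% D.i_d₁, A.i_d₁]
    · simp [hs, v.i_f₁, p.i_f₁, reassoc_of% e]
  · intro X r t w
    refine (hp.comp_eq _ ?_ ?_ ?_).symm
    · simp only [Category.assoc, hs₀, reassoc_of% D.comp_d₀ r t w]
    · simp only [Category.assoc, hs₁, reassoc_of% D.comp_d₁ r t w]
    · simp only [Category.assoc, hs, v.comp_f₁]

lemma IsFF.hom_ext {A B D : InternalCat C} {p : A ⟶ B} (hp : IsFF p) {k l : D ⟶ A}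
    (h₀ : k.f₀ = l.f₀) (h : k ≫ p = l ≫ p) : k = l :=
  InternalCat.hom_ext h₀ (hp.eq (by rw [k.f₁_d₀, l.f₁_d₀, h₀]) (by rw [k.f₁_d₁, l.f₁_d₁, h₀])
    (congrArg Hom.f₁ h))

/-! ### The full image of a morphism -/

section pull

variable (B : InternalCat C) {X : C} (φ : X ⟶ B.obj)

/-- The object of triples `(x, y, t)` with `t` an arrow from `φ x` to `φ y`. -/
abbrev pullArr : C := pullback (prod.map φ φ) (prod.lift B.d₀ B.d₁)

/-- The source of an element of `pullArr`. -/
def pullSrc : B.pullArr φ ⟶ X := pullback.fst _ _ ≫ prod.fst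

/-- The target of an element of `pullArr`. -/
def pullTgt : B.pullArr φ ⟶ X := pullback.fst _ _ ≫ prod.snd

/-- The arrow underlying an element of `pullArr`. -/
def pullVal : B.pullArr φ ⟶ B.arr := pullback.snd _ _

lemma pullVal_d₀ : B.pullVal φ ≫ B.d₀ = B.pullSrc φ ≫ φ := by
  have := congrArg (· ≫ prod.fst)
    (pullback.condition (f := prod.map φ φ) (g := prod.lift B.d₀ B.d₁))
  simpa [pullVal, pullSrc] using this.symm

lemma pullVal_d₁ : B.pullVal φ ≫ B.d₁ = B.pullTgt φ ≫ φ := by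
  have := congrArg (· ≫ prod.snd)
    (pullback.condition (f := prod.map φ φ) (g := prod.lift B.d₀ B.d₁))
  simpa [pullVal, pullTgt] using this.symm

variable {B φ} {Z : C}

/-- The element of `pullArr` given by a triple. -/
def pullLift (x y : Z ⟶ X) (t : Z ⟶ B.arr) (h₀ : t ≫ B.d₀ = x ≫ φ) (h₁ : t ≫ B.d₁ = y ≫ φ) :
    Z ⟶ B.pullArr φ :=
  pullback.lift (prod.lift x y) t (by rw [prod.lift_map, prod.comp_lift, h₀, h₁])

section

variable (x y : Z ⟶ X) (t : Z ⟶ B.arr) (h₀ : t ≫ B.d₀ = x ≫ φ) (h₁ : t ≫ B.d₁ = y ≫ φ)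

@[simp] lemma pullLift_src : pullLift x y t h₀ h₁ ≫ B.pullSrc φ = x := by
  simp [pullLift, pullSrc]

@[simp] lemma pullLift_tgt : pullLift x y t h₀ h₁ ≫ B.pullTgt φ = y := by
  simp [pullLift, pullTgt]

@[simp] lemma pullLift_val : pullLift x y t h₀ h₁ ≫ B.pullVal φ = t := by
  simp [pullLift, pullVal]

end

lemma pullArr_ext {s t : Z ⟶ B.pullArr φ} (h₀ : s ≫ B.pullSrc φ = t ≫ B.pullSrc φ)
    (h₁ : s ≫ B.pullTgt φ = t ≫ B.pullTgt φ) (h : s ≫ B.pullVal φ = t ≫ B.pullVal φ) : s = t := by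
  refine pullback.hom_ext (prod.hom_ext ?_ ?_) h
  · simpa [pullSrc] using h₀
  · simpa [pullTgt] using h₁

variable (B φ)

/-- The full image of `φ : X ⟶ B₀`: the internal category with object of objects `X` and with the
arrows of `B`. -/
def pull : InternalCat C :=
  ofElements (B.pullSrc φ) (B.pullTgt φ)
    (pullLift (𝟙 X) (𝟙 X) (φ ≫ B.i) (by simp [B.i_d₀]) (by simp [B.i_d₁]))
    (by simp) (by simp)
    (fun f g h => pullLift (f ≫ B.pullSrc φ) (g ≫ B.pullTgt φ)
      (B.comp (f ≫ B.pullVal φ) (g ≫ B.pullVal φ)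
        (by simp [pullVal_d₀, pullVal_d₁, reassoc_of% h]))
      (by simp [comp_d₀, pullVal_d₀]) (by simp [comp_d₁, pullVal_d₁]))
    (fun k f g h => by apply pullArr_ext <;> simp [precomp_comp])
    (fun f g h => by simp) (fun f g h => by simp)
    (fun f => by
      apply pullArr_ext
      · simp
      · simp
      · have := B.id_comp' (f ≫ B.pullVal φ)
        simpa [reassoc_of% B.pullVal_d₀ φ] using this)
    (fun f => by
      apply pullArr_ext
      · simp
      · simp
      · have := B.comp_id' (f ≫ B.pullVal φ)
        simpa [reassoc_of% B.pullVal_d₁ φ] using this)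
    (fun f g h hfg hgh => by
      apply pullArr_ext
      · simp
      · simp
      · simpa using B.comp_assoc (f ≫ B.pullVal φ) (g ≫ B.pullVal φ) (h ≫ B.pullVal φ) _ _)

lemma pull_comp_val (s t : Z ⟶ B.pullArr φ) (h : s ≫ B.pullTgt φ = t ≫ B.pullSrc φ) :
    (B.pull φ).comp s t h ≫ B.pullVal φ = B.comp (s ≫ B.pullVal φ) (t ≫ B.pullVal φ)
      (by simp [pullVal_d₀, pullVal_d₁, reassoc_of% h]) :=
  (congrArg (· ≫ B.pullVal φ) (ofElements_comp ..)).trans (pullLift_val ..)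

/-- The projection from the full image. -/
def pullπ : B.pull φ ⟶ B :=
  Hom.ofElements (A := B.pull φ) φ (B.pullVal φ) (B.pullVal_d₀ φ) (B.pullVal_d₁ φ)
    (pullLift_val (𝟙 X) (𝟙 X) (φ ≫ B.i) (by simp [B.i_d₀]) (by simp [B.i_d₁]))
    (fun s t h => B.pull_comp_val φ s t h)

lemma isFF_pullπ : IsFF (B.pullπ φ) := by
  intro Z x y t h₀ h₁
  exact ⟨pullLift (φ := φ) x y t h₀ h₁, ⟨pullLift_src x y t h₀ h₁, pullLift_tgt x y t h₀ h₁,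
    pullLift_val x y t h₀ h₁⟩, fun _ h => pullArr_ext (h.1.trans (pullLift_src x y t h₀ h₁).symm)
      (h.2.1.trans (pullLift_tgt x y t h₀ h₁).symm) (h.2.2.trans (pullLift_val x y t h₀ h₁).symm)⟩

end pull

/-! ### Conjugation of internal functors by invertible transformations -/

section conj

variable {A B D E : InternalCat C}

/-- The internal functor with arrow part `t ↦ θ ; g t ; θ⁻¹`, for a family `θ` of invertible arrows
with codomain `g₀`. -/
def conj (g : A ⟶ B) {θ θ' : A.obj ⟶ B.arr} (h : B.IsInversePair θ θ') (w : θ ≫ B.d₁ = g.f₀) :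
    A ⟶ B :=
  Hom.ofElements (θ ≫ B.d₀)
    (B.comp (A.d₀ ≫ θ) (B.comp g.f₁ (A.d₁ ≫ θ')
      (by rw [g.f₁_d₁, Category.assoc, ← h.w₁, w]))
      (by rw [comp_d₀, g.f₁_d₀, Category.assoc, w]))
    (by rw [comp_d₀, Category.assoc])
    (by rw [comp_d₁, comp_d₁, Category.assoc, h.w₀])
    (by
      have e : B.comp (g.f₀ ≫ B.i) θ' (by rw [Category.assoc, B.i_d₁, Category.comp_id, ← w, h.w₁])
          = θ' := by
        have := B.id_comp' θ'
        simpa only [← w, ← h.w₁, Category.assoc, ← reassoc_of% h.w₁] using this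
      simp only [precomp_comp, reassoc_of% A.i_d₀, reassoc_of% A.i_d₁, g.i_f₁, e, h.comp_ab,
        Category.assoc])
    (by
      intro X s t hst
      have h₁ : B.IsInversePair (s ≫ A.d₁ ≫ θ) (s ≫ A.d₁ ≫ θ') := by
        simpa only [Category.assoc] using h.precomp (s ≫ A.d₁)
      have a₁ : (s ≫ g.f₁) ≫ B.d₁ = (s ≫ A.d₁ ≫ θ') ≫ B.d₀ := by
        simp only [Category.assoc, g.f₁_d₁, ← w, h.w₁]
      have a₂ : (s ≫ A.d₁ ≫ θ) ≫ B.d₁ = (t ≫ g.f₁) ≫ B.d₀ := by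
        simp only [Category.assoc, g.f₁_d₀, w, reassoc_of% hst]
      have a₃ : (t ≫ g.f₁) ≫ B.d₁ = (t ≫ A.d₁ ≫ θ') ≫ B.d₀ := by
        simp only [Category.assoc, g.f₁_d₁, ← w, h.w₁]
      have a₄ : (s ≫ A.d₀ ≫ θ) ≫ B.d₁ = (s ≫ g.f₁) ≫ B.d₀ := by
        simp only [Category.assoc, g.f₁_d₀, w]
      have a₅ : (s ≫ A.d₁ ≫ θ') ≫ B.d₁ = (s ≫ A.d₁ ≫ θ) ≫ B.d₀ := by
        simp only [Category.assoc, h.w₀]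
      have a₆ : (s ≫ g.f₁) ≫ B.d₁ = (t ≫ g.f₁) ≫ B.d₀ := by
        simp only [Category.assoc, g.f₁_d₁, g.f₁_d₀, reassoc_of% hst]
      simp only [precomp_comp, reassoc_of% A.comp_d₀ s t hst, reassoc_of% A.comp_d₁ s t hst,
        g.comp_f₁, ← reassoc_of% hst]
      rw [B.comp_assoc (s ≫ A.d₀ ≫ θ) _ _ (by rw [comp_d₀, a₄])
        (by rw [comp_d₁, comp_d₀, a₅])]
      refine B.comp_congr rfl ?_ _
      rw [B.comp_assoc (s ≫ g.f₁) _ _ a₁ (by rw [comp_d₀, a₅])]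
      rw [B.comp_assoc _ _ _ a₆ a₃]
      refine B.comp_congr rfl ?_ _
      -- At the middle object, `θ⁻¹ ; θ` cancels.
      exact (comp_cancel_left h₁ (by rw [comp_d₀, a₂])).symm)

variable (g : A ⟶ B) {θ θ' : A.obj ⟶ B.arr} (h : B.IsInversePair θ θ') (w : θ ≫ B.d₁ = g.f₀)

@[simp] lemma conj_f₀ : (conj g h w).f₀ = θ ≫ B.d₀ := rfl

lemma conj_f₁ : (conj g h w).f₁ = B.comp (A.d₀ ≫ θ) (B.comp g.f₁ (A.d₁ ≫ θ')
      (by rw [g.f₁_d₁, Category.assoc, ← h.w₁, w]))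
      (by rw [comp_d₀, g.f₁_d₀, Category.assoc, w]) := rfl

lemma conj_comp (k : B ⟶ D) : conj g h w ≫ k = conj (g ≫ k) (h.map k)
    (by rw [Category.assoc, k.f₁_d₁, reassoc_of% w, comp_f₀]) := by
  refine hom_ext ?_ ?_
  · simp [k.f₁_d₀]
  · simp only [comp_f₁, conj_f₁, Hom.comp_f₁, Category.assoc]

lemma comp_conj (k : D ⟶ A) : k ≫ conj g h w = conj (k ≫ g) (h.precomp k.f₀)
    (by rw [Category.assoc, w, comp_f₀]) := by
  refine hom_ext ?_ ?_
  · simp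
  · simp only [comp_f₁, conj_f₁, precomp_comp, ← Category.assoc, k.f₁_d₀, k.f₁_d₁]

/-- The inverse is determined by `θ`, so it needs no separate comparison. This replaces rewriting
under the proofs on which `conj` depends. -/
lemma conj_congr {g g' : A ⟶ B} {θ θ' η η' : A.obj ⟶ B.arr} (h : B.IsInversePair θ θ')
    (w : θ ≫ B.d₁ = g.f₀) (eg : g = g') (e : θ = η) (h' : B.IsInversePair η η') :
    conj g h w = conj g' h' (by rw [← e, w, eg]) := by
  subst eg e
  obtain rfl := h.unique h'
  rfl

lemma conj_id (e : θ = g.f₀ ≫ B.i) : conj g h w = g := by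
  have h' : B.IsInversePair (g.f₀ ≫ B.i) (g.f₀ ≫ B.i) := isInversePair_id _
  rw [conj_congr h w rfl e h']
  refine hom_ext ?_ ?_
  · simp [B.i_d₀]
  · rw [conj_f₁]
    have e₁ : A.d₁ ≫ g.f₀ ≫ B.i = g.f₁ ≫ B.d₁ ≫ B.i := by
      rw [← reassoc_of% g.f₁_d₁]
    have e₀ : A.d₀ ≫ g.f₀ ≫ B.i = g.f₁ ≫ B.d₀ ≫ B.i := by
      rw [← reassoc_of% g.f₁_d₀]
    simp only [e₀, e₁, comp_id', id_comp']

lemma conj_conj_inv (w' : θ' ≫ B.d₁ = (conj g h w).f₀) : conj (conj g h w) h.symm w' = g := by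
  refine hom_ext ?_ ?_
  · rw [conj_f₀, ← h.w₁, w]
  · rw [conj_f₁]
    have h₀ := h.precomp A.d₀
    have h₁ := h.precomp A.d₁
    have a₁ : (A.d₀ ≫ θ) ≫ B.d₁ = g.f₁ ≫ B.d₀ := by
      rw [Category.assoc, w, g.f₁_d₀]
    have a₂ : g.f₁ ≫ B.d₁ = (A.d₁ ≫ θ') ≫ B.d₀ := by
      rw [Category.assoc, ← h.w₁, w, g.f₁_d₁]
    simp only [conj_f₁]
    rw [← B.comp_assoc _ _ _ (by rw [h₀.w₀, comp_d₀]) (by rw [comp_d₁, comp_d₁, h₁.w₀])]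
    simp only [comp_cancel_left h₀]
    exact comp_cancel_right h₁.symm a₂

end conj

end InternalCat

namespace InternalCat

variable {C : Type u} [Category.{v} C] [HasFiniteLimits C]

attribute [local simp] pullback.lift_fst pullback.lift_snd pullback.lift_fst_assoc
  pullback.lift_snd_assoc

/-! ### Equivalences and fibrations relative to a class detected by projectives -/

/-- A class of morphisms that consists of the morphisms which the class's projectives see as
surjections. -/
def IsDetectedByProjectives (E : MorphismProperty C) : Prop :=
  ∀ ⦃X Y : C⦄ (f : X ⟶ Y),
    (∀ P : C, IsProjectiveRel E P → ∀ y : P ⟶ Y, ∃ x : P ⟶ X, x ≫ f = y) → E f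

lemma relEquivalences_iff {E : MorphismProperty C} {A B : InternalCat C} {f : A ⟶ B} :
    relEquivalences E f ↔ IsFF f ∧ IsEssSurj E f := by
  rw [isFF_iff, and_assoc]
  rfl

section detected

variable {E : MorphismProperty C} (hE : IsDetectedByProjectives E) {A B : InternalCat C}
  {f : A ⟶ B}
include hE

/-- A `P`-element of the pullback is an object of `A` together with an invertible arrow ending at
its image. Membership in `E` amounts to surjectivity on elements with projective domain: one
direction is projectivity, the other is `hE`. -/
lemma isEssSurj_iff : IsEssSurj E f ↔ ∀ P : C, IsProjectiveRel E P → ∀ b : P ⟶ B.obj,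
    ∃ (a : P ⟶ A.obj) (s t : P ⟶ B.arr), B.IsInversePair s t ∧ s ≫ B.d₀ = b ∧
      s ≫ B.d₁ = a ≫ f.f₀ := by
  constructor
  · intro h P hP b
    obtain ⟨k, hk⟩ := hP _ h b
    refine ⟨k ≫ pullback.fst _ _, (k ≫ pullback.snd _ _) ≫ B.isoι, _,
      B.isInversePair_iso.precomp _, ?_, ?_⟩
    · simpa [δ₀] using hk
    · rw [Category.assoc, Category.assoc, Category.assoc, pullback.condition]
      rfl
  · refine fun h => hE _ fun P hP b => ?_
    obtain ⟨a, s, t, hst, h₀, h₁⟩ := h P hP b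
    refine ⟨pullback.lift a (B.isoLift s t hst) ?_, ?_⟩
    · rw [δ₁, reassoc_of% isoLift_isoι, h₁]
    · simp [δ₀, reassoc_of% isoLift_isoι, h₀]

lemma relFibrations_iff : relFibrations E f ↔ ∀ P : C, IsProjectiveRel E P →
    ∀ (e : P ⟶ A.obj) (s t : P ⟶ B.arr), B.IsInversePair s t → s ≫ B.d₁ = e ≫ f.f₀ →
      ∃ s' t' : P ⟶ A.arr, A.IsInversePair s' t' ∧ s' ≫ A.d₁ = e ∧ s' ≫ f.f₁ = s := by
  constructor
  · intro h P hP e s t hst hs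
    obtain ⟨k, hk⟩ := hP _ h (pullback.lift e (B.isoLift s t hst)
      (by rw [δ₁, reassoc_of% isoLift_isoι, hs]))
    have h₀ := congrArg (· ≫ pullback.fst _ _) hk
    have h₁ := congrArg (· ≫ pullback.snd _ _ ≫ B.isoι) hk
    simp only [Category.assoc, pullback.lift_fst, pullback.lift_snd_assoc, isoMap_isoι,
      isoLift_isoι] at h₀ h₁
    exact ⟨k ≫ A.isoι, _, A.isInversePair_iso.precomp k, by simpa [δ₁] using h₀,
      by simpa using h₁⟩
  · refine fun h => hE _ fun P hP b => ?_
    obtain ⟨s, t, hst, h₀, h₁⟩ := h P hP (b ≫ pullback.fst _ _) _ _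
      (B.isInversePair_iso.precomp (b ≫ pullback.snd _ _)) (by
        rw [Category.assoc, Category.assoc, Category.assoc, pullback.condition]
        rfl)
    refine ⟨A.isoLift s t hst, pullback.hom_ext ?_ ?_⟩
    · rw [Category.assoc, pullback.lift_fst, δ₁, reassoc_of% isoLift_isoι, h₀]
    · rw [← cancel_mono B.isoι]
      simp [isoMap_isoι, reassoc_of% isoLift_isoι, h₁]

/-- A fibration lifts the isomorphism `b ≅ f a` given by essential surjectivity, and the domain of
the lift is a preimage of `b`. Conversely it suffices to lift the domain of an invertible arrow,
since full faithfulness then lifts the arrow. -/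
lemma relFibrations_inf_relEquivalences_iff :
    (relFibrations E ⊓ relEquivalences E) f ↔ IsFF f ∧ E f.f₀ := by
  refine (and_congr (relFibrations_iff hE)
    ((relEquivalences_iff).trans (and_congr Iff.rfl (isEssSurj_iff hE)))).trans ?_
  constructor
  · rintro ⟨h₁, h₂, h₃⟩
    refine ⟨h₂, hE _ fun P hP b => ?_⟩
    obtain ⟨a, s, t, hst, h₀, h₁'⟩ := h₃ P hP b
    obtain ⟨s', t', hst', e₀, e₁⟩ := h₁ P hP a s t hst h₁'
    exact ⟨s' ≫ A.d₀, by rw [Category.assoc, ← f.f₁_d₀, reassoc_of% e₁, h₀]⟩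
  · rintro ⟨h₁, h₂⟩
    refine ⟨fun P hP e s t hst hs => ?_, h₁, fun P hP b => ?_⟩
    · obtain ⟨x, hx⟩ := hP _ h₂ (s ≫ B.d₀)
      obtain ⟨s', t', hst', -, h, h'⟩ := h₁.exists_inverse hst hx.symm hs
      exact ⟨s', t', hst', h, h'⟩
    · obtain ⟨x, hx⟩ := hP _ h₂ b
      exact ⟨x, _, _, isInversePair_id b, by simp [B.i_d₀], by simp [B.i_d₁, hx]⟩

end detected

/-! ### Stability under retracts -/

section retracts

variable {A B A' B' : InternalCat C} {f : A ⟶ B} {g : A' ⟶ B'}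

lemma exists_of_retractArrow (h : RetractArrow f g) :
    ∃ (i₀ : A ⟶ A') (r₀ : A' ⟶ A) (i₁ : B ⟶ B') (r₁ : B' ⟶ B), i₀ ≫ r₀ = 𝟙 A ∧ i₁ ≫ r₁ = 𝟙 B ∧
      i₀ ≫ g = f ≫ i₁ ∧ r₀ ≫ f = g ≫ r₁ :=
  ⟨h.i.left, h.r.left, h.i.right, h.r.right, h.left.retract, h.right.retract, h.i.w, h.r.w⟩

/-- The lift is found along `g` and retracted; two lifts along `f` agree because they agree after
inclusion into `A'`. -/
lemma IsFF.of_retract (hg : IsFF g) (h : RetractArrow f g) : IsFF f := by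
  obtain ⟨i₀, r₀, i₁, r₁, el, er, wi, wr⟩ := exists_of_retractArrow h
  have el₁ := congrArg Hom.f₁ el
  have el₀ := congrArg Hom.f₀ el
  have er₁ := congrArg Hom.f₁ er
  have wi₁ := congrArg Hom.f₁ wi
  have wi₀ := congrArg Hom.f₀ wi
  have wr₁ := congrArg Hom.f₁ wr
  simp only [comp_f₁, comp_f₀, id_f₁, id_f₀] at el₁ el₀ er₁ wi₁ wi₀ wr₁
  intro Z x y t h₀ h₁
  obtain ⟨s, ⟨hs₀, hs₁, hs⟩, -⟩ := hg (x ≫ i₀.f₀) (y ≫ i₀.f₀) (t ≫ i₁.f₁)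
    (by rw [Category.assoc, Category.assoc, i₁.f₁_d₀, reassoc_of% h₀, wi₀])
    (by rw [Category.assoc, Category.assoc, i₁.f₁_d₁, reassoc_of% h₁, wi₀])
  refine ⟨s ≫ r₀.f₁, ⟨?_, ?_, ?_⟩, ?_⟩
  · rw [Category.assoc, r₀.f₁_d₀, reassoc_of% hs₀, el₀, Category.comp_id]
  · rw [Category.assoc, r₀.f₁_d₁, reassoc_of% hs₁, el₀, Category.comp_id]
  · rw [Category.assoc, wr₁, reassoc_of% hs, er₁, Category.comp_id]
  · rintro s' ⟨hs₀', hs₁', hs'⟩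
    have : s' ≫ i₀.f₁ = s := by
      refine hg.eq ?_ ?_ ?_
      · rw [Category.assoc, i₀.f₁_d₀, reassoc_of% hs₀', hs₀]
      · rw [Category.assoc, i₀.f₁_d₁, reassoc_of% hs₁', hs₁]
      · rw [Category.assoc, wi₁, reassoc_of% hs', hs]
    rw [← this, Category.assoc, el₁, Category.comp_id]

variable {E : MorphismProperty C} (hE : IsDetectedByProjectives E)
include hE

lemma isStableUnderRetracts_relEquivalences : (relEquivalences E).IsStableUnderRetracts where
  of_retract {_ _ _ _ f g} h hg := by
    rw [relEquivalences_iff] at hg ⊢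
    refine ⟨hg.1.of_retract h, ?_⟩
    obtain ⟨i₀, r₀, i₁, r₁, el, er, wi, wr⟩ := exists_of_retractArrow h
    have er₀ := congrArg Hom.f₀ er
    have wr₀ := congrArg Hom.f₀ wr
    simp only [comp_f₀, id_f₀] at er₀ wr₀
    have hg₂ := hg.2
    rw [isEssSurj_iff hE] at hg₂ ⊢
    intro P hP b
    obtain ⟨a, s, t, hst, h₀, h₁⟩ := hg₂ P hP (b ≫ i₁.f₀)
    refine ⟨a ≫ r₀.f₀, _, _, hst.map r₁, ?_, ?_⟩
    · rw [Category.assoc, r₁.f₁_d₀, reassoc_of% h₀, er₀, Category.comp_id]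
    · rw [Category.assoc, r₁.f₁_d₁, reassoc_of% h₁, Category.assoc, wr₀]

lemma isStableUnderRetracts_relFibrations : (relFibrations E).IsStableUnderRetracts where
  of_retract {_ _ _ _ f g} h hg := by
    rw [relFibrations_iff hE] at hg ⊢
    obtain ⟨i₀, r₀, i₁, r₁, el, er, wi, wr⟩ := exists_of_retractArrow h
    have el₀ := congrArg Hom.f₀ el
    have er₁ := congrArg Hom.f₁ er
    have wi₀ := congrArg Hom.f₀ wi
    have wr₁ := congrArg Hom.f₁ wr
    simp only [comp_f₁, comp_f₀, id_f₁, id_f₀] at el₀ er₁ wi₀ wr₁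
    intro P hP e s t hst hs
    obtain ⟨s', t', hst', h₀, h₁⟩ := hg P hP (e ≫ i₀.f₀) _ _ (hst.map i₁)
      (by rw [Category.assoc, i₁.f₁_d₁, reassoc_of% hs, Category.assoc, wi₀])
    refine ⟨_, _, hst'.map r₀, ?_, ?_⟩
    · rw [Category.assoc, r₀.f₁_d₁, reassoc_of% h₀, el₀, Category.comp_id]
    · rw [Category.assoc, wr₁, reassoc_of% h₁, er₁, Category.comp_id]

end retracts

/-! ### Binary coproducts of objects -/

/-- Every morphism into the object of objects is, up to isomorphism, the object part of a fully
faithful internal functor. -/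
lemma exists_isFF (B : InternalCat C) {X : C} (φ : X ⟶ B.obj) :
    ∃ (D : InternalCat C) (e : D.obj ≅ X) (p : D ⟶ B), IsFF p ∧ p.f₀ = e.hom ≫ φ :=
  ⟨B.pull φ, Iso.refl X, B.pullπ φ, isFF_pullπ B φ, (Category.id_comp φ).symm⟩

/-- The internal functor to the terminal internal category. -/
def toTerminal (A : InternalCat C) : A ⟶ disc (⊤_ C) :=
  Hom.ofElements (B := disc (⊤_ C)) (terminal.from _) (terminal.from _) (terminal.hom_ext _ _)
    (terminal.hom_ext _ _) (terminal.hom_ext _ _) (fun _ _ _ => terminal.hom_ext _ _)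

/-- The indiscrete internal category on an object. -/
def indisc (Z : C) : InternalCat C := (disc (⊤_ C)).pull (X := Z) (terminal.from Z)

lemma indisc_hom_ext {A : InternalCat C} {Z : C} {k l : A ⟶ indisc Z} (h : k.f₀ = l.f₀) : k = l :=
  (isFF_pullπ _ _).hom_ext h (hom_ext (terminal.hom_ext _ _) (terminal.hom_ext _ _))

lemma exists_indisc_hom (A : InternalCat C) {Z : C} (x : A.obj ⟶ (indisc Z).obj) :
    ∃ k : A ⟶ indisc Z, k.f₀ = x :=
  have ⟨k, hk, _⟩ := (isFF_pullπ _ _).exists_lift (toTerminal A) x (terminal.hom_ext _ _)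
  ⟨k, hk⟩

/-- Functors into an indiscrete category are morphisms on objects, so taking objects is a left
adjoint and sends `disc X ⨿ disc Y` to a coproduct of `X` and `Y`. The detour is needed because
colimits are assumed in `InternalCat C`, not in `C`. -/
lemma exists_coproduct [HasFiniteColimits (InternalCat C)] (X Y : C) :
    ∃ (W : C) (a : X ⟶ W) (b : Y ⟶ W),
      (∀ {Z : C} (f : X ⟶ Z) (g : Y ⟶ Z), ∃ k : W ⟶ Z, a ≫ k = f ∧ b ≫ k = g) ∧
      ∀ {Z : C} (k l : W ⟶ Z), a ≫ k = a ≫ l → b ≫ k = b ≫ l → k = l := by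
  refine ⟨(disc X ⨿ disc Y).obj, (coprod.inl : disc X ⟶ disc X ⨿ disc Y).f₀,
    (coprod.inr : disc Y ⟶ disc X ⨿ disc Y).f₀, fun {Z} f g => ?_, fun {Z} k l h₁ h₂ => ?_⟩
  · obtain ⟨f', hf⟩ := exists_indisc_hom (disc X) (Z := Z) f
    obtain ⟨g', hg⟩ := exists_indisc_hom (disc Y) (Z := Z) g
    refine ⟨(coprod.desc f' g').f₀, ?_, ?_⟩
    · exact (congrArg Hom.f₀ (coprod.inl_desc f' g')).trans hf
    · exact (congrArg Hom.f₀ (coprod.inr_desc f' g')).trans hg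
  · obtain ⟨k', rfl⟩ := exists_indisc_hom _ (Z := Z) k
    obtain ⟨l', rfl⟩ := exists_indisc_hom _ (Z := Z) l
    have : k' = l' := coprod.hom_ext (indisc_hom_ext h₁) (indisc_hom_ext h₂)
    rw [this]

/-! ### The factorizations and the lifting properties -/

section model

variable {E : MorphismProperty C} (hE : IsDetectedByProjectives E)
  (hP : HasEnoughProjectivesRel E)

/-- An internal functor lifts against a fully faithful one if it does so on objects. -/
lemma IsFF.hasLiftingProperty {A B X Y : InternalCat C} {j : A ⟶ B} {p : X ⟶ Y} (hp : IsFF p)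
    (h : ∀ (x : A.obj ⟶ X.obj) (y : B.obj ⟶ Y.obj), x ≫ p.f₀ = j.f₀ ≫ y →
      ∃ k : B.obj ⟶ X.obj, j.f₀ ≫ k = x ∧ k ≫ p.f₀ = y) : HasLiftingProperty j p where
  sq_hasLift {a b} sq := by
    have w := sq.w
    obtain ⟨k, hk₁, hk₂⟩ := h a.f₀ b.f₀ (congrArg Hom.f₀ w)
    obtain ⟨l, hl, hl'⟩ := hp.exists_lift b k hk₂
    refine ⟨⟨⟨l, hp.hom_ext ?_ ?_, hl'⟩⟩⟩
    · rw [comp_f₀, hl, hk₁]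
    · rw [Category.assoc, hl', w]

/-- An internal functor that is, on objects, the inclusion of a summand whose complement is
projective. -/
def IsProjectiveExtension (E : MorphismProperty C) {A B : InternalCat C} (j : A ⟶ B) : Prop :=
  ∃ (P : C) (b : P ⟶ B.obj), IsProjectiveRel E P ∧
    (∀ {Z : C} (f : A.obj ⟶ Z) (g : P ⟶ Z), ∃ k : B.obj ⟶ Z, j.f₀ ≫ k = f ∧ b ≫ k = g) ∧
      ∀ {Z : C} (k l : B.obj ⟶ Z), j.f₀ ≫ k = j.f₀ ≫ l → b ≫ k = b ≫ l → k = l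

include hE in
-- On the summand `A₀` the lift is prescribed, and on the projective summand it exists because `p₀`
-- is in `E`.
lemma IsProjectiveExtension.mem_llp {A B : InternalCat C} {j : A ⟶ B}
    (h : IsProjectiveExtension E j) : (relFibrations E ⊓ relEquivalences E).llp j := by
  intro X Y p hp
  rw [relFibrations_inf_relEquivalences_iff hE] at hp
  refine hp.1.hasLiftingProperty fun x y w => ?_
  obtain ⟨P, b, hb, h₁, h₂⟩ := h
  obtain ⟨z, hz⟩ := hb _ hp.2 (b ≫ y)
  obtain ⟨k, hk₁, hk₂⟩ := h₁ x z
  exact ⟨k, hk₁, h₂ _ _ (by rw [reassoc_of% hk₁, w]) (by rw [reassoc_of% hk₂, hz])⟩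

include hE hP in
-- Choose a projective `P` with `P ⟶ B₀` in `E` and take the full image of `A₀ + P ⟶ B₀`. Its
-- projection to `B` is fully faithful, and the summand `P` already makes its object part surjective
-- on projective elements.
lemma exists_cofibration_factorization [HasFiniteColimits (InternalCat C)] {A B : InternalCat C}
    (f : A ⟶ B) : ∃ (D : InternalCat C) (j : A ⟶ D) (p : D ⟶ B), IsProjectiveExtension E j ∧
      (relFibrations E ⊓ relEquivalences E) p ∧ j ≫ p = f := by
  obtain ⟨P, q, hP₁, hq⟩ := hP B.obj
  obtain ⟨W, a, b, h₁, h₂⟩ := exists_coproduct A.obj P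
  obtain ⟨φ, hφ₁, hφ₂⟩ := h₁ f.f₀ q
  obtain ⟨D, e, p, hp, hp₀⟩ := exists_isFF B φ
  obtain ⟨j, hj, hj'⟩ := hp.exists_lift f (a ≫ e.inv) (by simp [hp₀, hφ₁])
  refine ⟨D, j, p, ⟨P, b ≫ e.inv, hP₁, fun {Z} f g => ?_, fun {Z} k l hk hl => ?_⟩, ?_, hj'⟩
  · obtain ⟨k, hk, hk'⟩ := h₁ f g
    exact ⟨e.hom ≫ k, by simp [hj, hk], by simp [hk']⟩
  · rw [← cancel_epi e.inv]
    exact h₂ _ _ (by simpa [hj] using hk) (by simpa using hl)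
  · rw [relFibrations_inf_relEquivalences_iff hE]
    refine ⟨hp, hE _ fun Q hQ y => ?_⟩
    obtain ⟨x, hx⟩ := hQ _ hq y
    exact ⟨x ≫ b ≫ e.inv, by simp [hp₀, hφ₂, hx]⟩

include hE in
-- The middle category has as objects the pairs `(a, σ : b ≅ f a)` and as arrows those of `A`. The
-- first functor chooses identities; the second sends a pair to `b` and an arrow to its image under
-- `f`, conjugated by the isomorphisms `σ`.
lemma exists_path_factorization {A B : InternalCat C} (f : A ⟶ B) :
    ∃ (D : InternalCat C) (j : A ⟶ D) (p : D ⟶ B), relEquivalences E j ∧ relFibrations E p ∧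
      j ≫ p = f := by
  obtain ⟨D, e, q, hq, hq₀⟩ := exists_isFF A (pullback.fst f.f₀ B.δ₁)
  obtain ⟨σ, hσ'⟩ : ∃ σ, σ = e.hom ≫ pullback.snd f.f₀ B.δ₁ := ⟨_, rfl⟩
  have lift : ∀ {Z : C} (a : Z ⟶ A.obj) (s t : Z ⟶ B.arr), B.IsInversePair s t →
      s ≫ B.d₁ = a ≫ f.f₀ → ∃ x : Z ⟶ D.obj, x ≫ q.f₀ = a ∧ x ≫ σ ≫ B.isoι = s := by
    intro Z a s t hst w
    refine ⟨pullback.lift a (B.isoLift s t hst) ?_ ≫ e.inv, ?_, ?_⟩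
    · rw [δ₁, reassoc_of% isoLift_isoι, w]
    · simp [hq₀]
    · simp [hσ', isoLift_isoι]
  have hσ : B.IsInversePair (σ ≫ B.isoι) (σ ≫ B.isoInv) := B.isInversePair_iso.precomp σ
  have hσ₁ : (σ ≫ B.isoι) ≫ B.d₁ = (q ≫ f).f₀ := by
    rw [comp_f₀, hq₀, Category.assoc, Category.assoc, pullback.condition, hσ', Category.assoc]
    rfl
  obtain ⟨s, hs, hsσ⟩ := lift (𝟙 _) _ _ (isInversePair_id (A := B) f.f₀) (by simp [B.i_d₁])
  obtain ⟨j, hj, hj'⟩ := hq.exists_lift (𝟙 A) s hs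
  refine ⟨D, j, conj (q ≫ f) hσ hσ₁, ?_, ?_, ?_⟩
  · rw [relEquivalences_iff, isEssSurj_iff hE]
    refine ⟨hq.of_comp (hj' ▸ isFF_id A), fun P _ b => ?_⟩
    -- Every pair over `a` is isomorphic to the pair with the identity, by the lift of the identity
    -- of `a`.
    obtain ⟨s', t', hst, h₀, h₁, -⟩ := hq.exists_inverse (isInversePair_id (A := A) (b ≫ q.f₀))
      (x := b) (y := b ≫ q.f₀ ≫ s) (by simp [A.i_d₀]) (by simp [A.i_d₁, hs])
    exact ⟨b ≫ q.f₀, s', t', hst, h₀, h₁.trans (by rw [hj, Category.assoc])⟩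
  · rw [relFibrations_iff hE]
    intro P _ x s t hst hs
    have hx := hσ.precomp x
    have hs' : s ≫ B.d₁ = (x ≫ σ ≫ B.isoι) ≫ B.d₀ := by
      rw [hs, conj_f₀, Category.assoc, Category.assoc, Category.assoc]
    -- The new pair has `s ; σ` in place of `σ`. The lift of the identity of `a` from the new pair
    -- to the old one is sent to `(s ; σ) ; 1 ; σ⁻¹ = s`.
    obtain ⟨y, hy, hyσ⟩ := lift (x ≫ q.f₀) _ _ (hst.comp hx hs') (by
      rw [comp_d₁, Category.assoc, hσ₁, Category.assoc, comp_f₀])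
    obtain ⟨s', t', hst', h₀, h₁, h₂⟩ := hq.exists_inverse (isInversePair_id (A := A) (x ≫ q.f₀))
      (x := y) (y := x) (by simp [A.i_d₀, hy]) (by simp [A.i_d₁])
    refine ⟨s', t', hst', h₁, ?_⟩
    have k₁ : s' ≫ (q ≫ f).f₁ = (x ≫ σ ≫ B.isoι) ≫ B.d₁ ≫ B.i := by
      rw [comp_f₁, reassoc_of% h₂, f.i_f₁, ← Category.assoc (x ≫ σ ≫ B.isoι), Category.assoc x,
        hσ₁]
      simp
    have w : (x ≫ σ ≫ B.isoι) ≫ B.d₁ ≫ B.i = (x ≫ σ ≫ B.isoInv) ≫ B.d₀ ≫ B.i := by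
      simp only [← Category.assoc _ _ B.i, hx.w₁]
    have w' : (x ≫ σ ≫ B.isoι) ≫ B.d₁ = (x ≫ σ ≫ B.isoInv) ≫ B.d₀ := hx.w₁
    simp only [conj_f₁, precomp_comp, k₁, reassoc_of% h₀, reassoc_of% h₁, hyσ]
    simp only [w, id_comp']
    exact comp_cancel_right hx hs'
  · rw [comp_conj, conj_congr _ _ (by rw [← Category.assoc, hj', Category.id_comp])
      (by rw [hj, hsσ]) (isInversePair_id (A := B) f.f₀)]
    exact conj_id _ _ _ rfl

include hE in
-- Essential surjectivity on the projective summand provides a retraction `ρ` of `j` and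
-- isomorphisms `θ : b ≅ j (ρ b)` that are identities on `A`. The fibration lifts `v θ` to a family
-- `ε` ending at `u ρ`, and the diagonal is `u ρ` conjugated by `ε`.
lemma hasLiftingProperty_of_equivalence {A B X Y : InternalCat C} {j : A ⟶ B} {p : X ⟶ Y}
    (hj : IsProjectiveExtension E j) (hj' : relEquivalences E j) (hp : relFibrations E p) :
    HasLiftingProperty j p where
  sq_hasLift {u v} sq := by
    have w := sq.w
    rw [relFibrations_iff hE] at hp
    rw [relEquivalences_iff, isEssSurj_iff hE] at hj'
    obtain ⟨hj₁, hj₂⟩ := hj'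
    obtain ⟨P, b, hb, h₁, h₂⟩ := hj
    have ext : ∀ {Z : C} {k l : B.obj ⟶ Z}, j.f₀ ≫ k = j.f₀ ≫ l → b ≫ k = b ≫ l → k = l :=
      fun {_} {k l} => h₂ k l
    -- Mutual inverseness can be checked on the two summands of `B₀`.
    have pair : ∀ {D : InternalCat C} {θ θ' : B.obj ⟶ D.arr},
        D.IsInversePair (j.f₀ ≫ θ) (j.f₀ ≫ θ') → D.IsInversePair (b ≫ θ) (b ≫ θ') →
        D.IsInversePair θ θ' := by
      intro D θ θ' h h'
      have w₀ : θ' ≫ D.d₁ = θ ≫ D.d₀ := ext (by simpa using h.w₀) (by simpa using h'.w₀)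
      have w₁ : θ ≫ D.d₁ = θ' ≫ D.d₀ := ext (by simpa using h.w₁) (by simpa using h'.w₁)
      refine ⟨w₀, w₁, ext ?_ ?_, ext ?_ ?_⟩
      · rw [precomp_comp, h.comp_ab, Category.assoc]
      · rw [precomp_comp, h'.comp_ab, Category.assoc]
      · rw [precomp_comp, h.comp_ba, Category.assoc]
      · rw [precomp_comp, h'.comp_ba, Category.assoc]
    obtain ⟨a, s, t, hst, hs₀, hs₁⟩ := hj₂ P hb b
    obtain ⟨s', t', hst', hs₁', hs'⟩ := hp P hb (a ≫ u.f₀) _ _ (hst.map v)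
      (by rw [Category.assoc, v.f₁_d₁, reassoc_of% hs₁, Category.assoc, ← comp_f₀, ← comp_f₀, w])
    -- the retraction of `B` onto `A` on objects, and the isomorphisms to the identity
    obtain ⟨r, hr₀, hr₁⟩ := h₁ (𝟙 _) a
    obtain ⟨θ, hθ₀, hθ₁⟩ := h₁ (j.f₀ ≫ B.i) s
    obtain ⟨θ', hθ₀', hθ₁'⟩ := h₁ (j.f₀ ≫ B.i) t
    obtain ⟨ε, hε₀, hε₁⟩ := h₁ (u.f₀ ≫ X.i) s'
    obtain ⟨ε', hε₀', hε₁'⟩ := h₁ (u.f₀ ≫ X.i) t'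
    have hθ : B.IsInversePair θ θ' := pair
      (by rw [hθ₀, hθ₀']; exact isInversePair_id _) (by rwa [hθ₁, hθ₁'])
    have hε : X.IsInversePair ε ε' := pair
      (by rw [hε₀, hε₀']; exact isInversePair_id _) (by rwa [hε₁, hε₁'])
    have hθd₀ : θ ≫ B.d₀ = 𝟙 _ := ext (by simp [reassoc_of% hθ₀, B.i_d₀])
      (by simp [reassoc_of% hθ₁, hs₀])
    have hθd₁ : θ ≫ B.d₁ = r ≫ j.f₀ := ext (by simp [reassoc_of% hθ₀, B.i_d₁, reassoc_of% hr₀])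
      (by simp [reassoc_of% hθ₁, hs₁, reassoc_of% hr₁])
    have hεd₁ : ε ≫ X.d₁ = r ≫ u.f₀ := ext (by simp [reassoc_of% hε₀, X.i_d₁, reassoc_of% hr₀])
      (by simp [reassoc_of% hε₁, hs₁', reassoc_of% hr₁])
    have hεp : ε ≫ p.f₁ = θ ≫ v.f₁ := ext
      (by
        have := congrArg Hom.f₀ w
        simp only [comp_f₀] at this
        simp [reassoc_of% hε₀, reassoc_of% hθ₀, p.i_f₁, v.i_f₁, reassoc_of% this])
      (by rw [reassoc_of% hε₁, reassoc_of% hθ₁, hs'])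
    -- `c` sends `t` to `θ⁻¹ ; t ; θ`. Its object part is `r ≫ j₀`, so it factors through the fully
    -- faithful `j`.
    let c : B ⟶ B := conj (𝟙 B) hθ.symm (by rw [hθ.w₀, hθd₀, id_f₀])
    obtain ⟨ρ, hρ₀, hρ⟩ := hj₁.exists_lift c r (by rw [conj_f₀, ← hθ.w₁, hθd₁])
    have hjρ : j ≫ ρ = 𝟙 A := by
      refine hj₁.hom_ext (by rw [comp_f₀, hρ₀, hr₀, id_f₀]) ?_
      rw [Category.assoc, hρ, comp_conj, Category.id_comp]
      exact (conj_id (j ≫ 𝟙 B) _ _ (hθ₀'.trans (by simp))).trans (Category.comp_id j)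
    refine ⟨⟨⟨conj (ρ ≫ u) hε (by rw [hεd₁, comp_f₀, hρ₀]), ?_, ?_⟩⟩⟩
    · rw [comp_conj, conj_congr _ _ (by rw [← Category.assoc, hjρ, Category.id_comp]) hε₀
        (isInversePair_id (A := X) u.f₀)]
      exact conj_id _ _ _ rfl
    -- Applying `p` turns `ε` into `v θ`, and conjugating `c` by `θ` undoes its definition, leaving
    -- `v`.
    · have e : (ρ ≫ u) ≫ p = c ≫ v := by
        rw [Category.assoc, w, ← Category.assoc, hρ]
      rw [conj_comp, conj_congr _ _ e hεp (hθ.map v), ← conj_comp _ hθ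
        (by rw [conj_f₀, ← hθ.w₁])]
      simp only [c]
      rw [conj_conj_inv _ hθ.symm, Category.id_comp]

include hE hP in
/-- The model structure determined by a class of morphisms with enough projectives. -/
theorem isModelStructure [HasFiniteLimits (InternalCat C)] [HasFiniteColimits (InternalCat C)]
    (h₂ : (relEquivalences E).HasTwoOutOfThreeProperty) :
    IsModelStructure (relFibrations E) (relFibrations E ⊓ relEquivalences E).llp
      (relEquivalences E) := by
  have := isStableUnderRetracts_relEquivalences hE
  have := isStableUnderRetracts_relFibrations hE
  let i₁ : HomotopicalAlgebra.CategoryWithFibrations (InternalCat C) := ⟨relFibrations E⟩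
  let i₂ : HomotopicalAlgebra.CategoryWithCofibrations (InternalCat C) :=
    ⟨(relFibrations E ⊓ relEquivalences E).llp⟩
  let i₃ : HomotopicalAlgebra.CategoryWithWeakEquivalences (InternalCat C) :=
    ⟨relEquivalences E⟩
  have e₁ : HomotopicalAlgebra.trivialFibrations (InternalCat C) =
    relFibrations E ⊓ relEquivalences E := rfl
  have e₂ : HomotopicalAlgebra.trivialCofibrations (InternalCat C) =
    (relFibrations E ⊓ relEquivalences E).llp ⊓ relEquivalences E := rfl
  have comp : ∀ {A B D : InternalCat C} (f : A ⟶ B) (g : B ⟶ D), relFibrations E f →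
      relFibrations E g → relFibrations E (f ≫ g) := by
    intro A B D f g hf hg
    rw [relFibrations_iff hE] at hf hg ⊢
    intro P hP e s t hst hs
    obtain ⟨s₁, t₁, h₁, hs₁, hs₁'⟩ := hg P hP (e ≫ f.f₀) s t hst (by simpa using hs)
    obtain ⟨s₂, t₂, h₂, hs₂, hs₂'⟩ := hf P hP e s₁ t₁ h₁ hs₁
    exact ⟨s₂, t₂, h₂, hs₂, by rw [comp_f₁, reassoc_of% hs₂', hs₁']⟩
  -- The equivalence in the path factorization need not be a cofibration. It is factored once more,
  -- and two-out-of-three keeps the new first factor an equivalence.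
  have fac : ∀ {A B : InternalCat C} (f : A ⟶ B), ∃ (D : InternalCat C) (j : A ⟶ D) (p : D ⟶ B),
      IsProjectiveExtension E j ∧ relEquivalences E j ∧ relFibrations E p ∧ j ≫ p = f := by
    intro A B f
    obtain ⟨D, j, p, hj, hp, rfl⟩ := exists_path_factorization hE f
    obtain ⟨D', j', p', hj', hp', rfl⟩ := exists_cofibration_factorization hE hP j
    exact ⟨D', j', p' ≫ p, hj', (relEquivalences E).of_postcomp _ _ hp'.2 hj, comp _ _ hp'.1 hp,
      (Category.assoc ..).symm⟩
  have : MorphismProperty.IsWeakFactorizationSystem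
      (HomotopicalAlgebra.cofibrations (InternalCat C))
      (HomotopicalAlgebra.trivialFibrations (InternalCat C)) := by
    change MorphismProperty.IsWeakFactorizationSystem
      (relFibrations E ⊓ relEquivalences E).llp (relFibrations E ⊓ relEquivalences E)
    have : MorphismProperty.HasFactorization (relFibrations E ⊓ relEquivalences E).llp
        (relFibrations E ⊓ relEquivalences E) := ⟨fun f => by
      obtain ⟨D, j, p, hj, hp, e⟩ := exists_cofibration_factorization hE hP f
      exact ⟨⟨D, j, p, e, hj.mem_llp hE, hp⟩⟩⟩
    have : (relFibrations E ⊓ relEquivalences E).IsStableUnderRetracts :=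
      ⟨fun h hg => ⟨MorphismProperty.of_retract h hg.1, MorphismProperty.of_retract h hg.2⟩⟩
    exact .mk' _ _ fun i p hi hp => hi p hp
  have : MorphismProperty.IsWeakFactorizationSystem
      (HomotopicalAlgebra.trivialCofibrations (InternalCat C))
      (HomotopicalAlgebra.fibrations (InternalCat C)) := by
    change MorphismProperty.IsWeakFactorizationSystem
      ((relFibrations E ⊓ relEquivalences E).llp ⊓ relEquivalences E) (relFibrations E)
    have : MorphismProperty.HasFactorization
        ((relFibrations E ⊓ relEquivalences E).llp ⊓ relEquivalences E) (relFibrations E) :=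
      ⟨fun f => by
        obtain ⟨D, j, p, hj, hj', hp, e⟩ := fac f
        exact ⟨⟨D, j, p, e, ⟨hj.mem_llp hE, hj'⟩, hp⟩⟩⟩
    have : ((relFibrations E ⊓ relEquivalences E).llp ⊓
        relEquivalences E).IsStableUnderRetracts :=
      ⟨fun h hg => ⟨MorphismProperty.of_retract h hg.1, MorphismProperty.of_retract h hg.2⟩⟩
    refine .mk' _ _ fun {A B X Y} i p hi hp => ?_
    obtain ⟨D, j, q, hj, hj', hq, rfl⟩ := fac i
    -- By two-out-of-three `q` is a trivial fibration, so `j ≫ q` lifts against it and is therefore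
    -- a retract of `j`, which lifts against `p`.
    have := hi.1 q ⟨hq, (relEquivalences E).of_precomp _ _ hj' hi.2⟩
    have := hasLiftingProperty_of_equivalence hE hj hj' hp
    exact (MorphismProperty.of_retract (P := MorphismProperty.llp (.ofHoms fun _ : Unit => p))
      (RetractArrow.ofLeftLiftingProperty rfl) (by
        rintro _ _ _ ⟨_⟩
        exact this)) _ (.mk ())
  have : (HomotopicalAlgebra.weakEquivalences (InternalCat C)).HasTwoOutOfThreeProperty := h₂
  exact ⟨HomotopicalAlgebra.ModelCategory.mk' _, rfl, rfl, rfl⟩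

end model

end InternalCat

namespace InternalCat

variable {C : Type u} [Category.{v} C] [HasFiniteLimits C]

/-! ### Internal functors on categories of points -/

section points

variable {A B : InternalCat C} {Z : C}

lemma isInversePair_of_iso {x y : A.Points Z} (e : x ≅ y) :
    A.IsInversePair e.hom.1 e.inv.1 where
  w₀ := e.inv.2.2.trans e.hom.2.1.symm
  w₁ := e.hom.2.2.trans e.inv.2.1.symm
  comp_ab := by
    have := congrArg Subtype.val e.hom_inv_id
    rw [Points.comp_val, Points.id_val] at this
    exact this.trans ((congrArg (· ≫ A.i) e.hom.2.1.symm).trans (Category.assoc ..))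
  comp_ba := by
    have := congrArg Subtype.val e.inv_hom_id
    rw [Points.comp_val, Points.id_val] at this
    exact this.trans ((congrArg (· ≫ A.i) e.hom.2.2.symm).trans (Category.assoc ..))

/-- The isomorphism of points given by an invertible generalized arrow. -/
def IsInversePair.toIso {s t : Z ⟶ A.arr} (h : A.IsInversePair s t) {x y : A.Points Z}
    (h₀ : s ≫ A.d₀ = x.pt) (h₁ : s ≫ A.d₁ = y.pt) : x ≅ y where
  hom := ⟨s, h₀, h₁⟩
  inv := ⟨t, h.w₁.symm.trans h₁, h.w₀.trans h₀⟩
  hom_inv_id := Subtype.ext (h.comp_ab.trans (by rw [Points.id_val, ← h₀, Category.assoc]))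
  inv_hom_id := Subtype.ext (h.comp_ba.trans (by rw [Points.id_val, ← h₁, Category.assoc]))

end points

section onPoints

variable {A B : InternalCat C} (f : A ⟶ B) (Z : C)

/-- The action of an internal functor on points. -/
abbrev onPoints : A.Points Z ⥤ B.Points Z := Points.map f (𝟙 Z)

lemma onPoints_obj_pt (x : A.Points Z) : ((onPoints f Z).obj x).pt = x.pt ≫ f.f₀ :=
  Category.id_comp _

lemma onPoints_map_val {x y : A.Points Z} (s : x ⟶ y) :
    ((onPoints f Z).map s).1 = s.1 ≫ f.f₁ :=
  Category.id_comp _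

lemma onPoints_full_faithful_iff : (onPoints f Z).Full ∧ (onPoints f Z).Faithful ↔
    ∀ (x y : Z ⟶ A.obj) (t : Z ⟶ B.arr), t ≫ B.d₀ = x ≫ f.f₀ → t ≫ B.d₁ = y ≫ f.f₀ →
      ∃! s : Z ⟶ A.arr, s ≫ A.d₀ = x ∧ s ≫ A.d₁ = y ∧ s ≫ f.f₁ = t := by
  constructor
  · rintro ⟨h₁, h₂⟩ x y t h₀' h₁'
    let t' : (onPoints f Z).obj ⟨x⟩ ⟶ (onPoints f Z).obj ⟨y⟩ :=
      ⟨t, h₀'.trans (onPoints_obj_pt f Z ⟨x⟩).symm, h₁'.trans (onPoints_obj_pt f Z ⟨y⟩).symm⟩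
    obtain ⟨s, hs⟩ := h₁.map_surjective t'
    have hs' := congrArg Subtype.val hs
    rw [onPoints_map_val] at hs'
    refine ⟨s.1, ⟨s.2.1, s.2.2, hs'⟩, fun r ⟨r₀, r₁, hr⟩ => ?_⟩
    let r' : (⟨x⟩ : A.Points Z) ⟶ ⟨y⟩ := ⟨r, r₀, r₁⟩
    have : r' = s := h₂.map_injective (Subtype.ext (by
      rw [onPoints_map_val, onPoints_map_val, hs']
      exact hr))
    rw [← this]
  · intro h
    refine ⟨⟨fun {x y} t => ?_⟩, ⟨fun {x y} s r e => ?_⟩⟩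
    · obtain ⟨s, ⟨h₀, h₁, hs⟩, -⟩ := h x.pt y.pt t.1
        (t.2.1.trans (onPoints_obj_pt f Z x)) (t.2.2.trans (onPoints_obj_pt f Z y))
      exact ⟨⟨s, h₀, h₁⟩, Subtype.ext ((onPoints_map_val ..).trans hs)⟩
    · have e' := congrArg Subtype.val e
      rw [onPoints_map_val, onPoints_map_val] at e'
      refine Subtype.ext ((h x.pt y.pt (s.1 ≫ f.f₁) ?_ ?_).unique ⟨s.2.1, s.2.2, rfl⟩
        ⟨r.2.1, r.2.2, e'.symm⟩)
      · rw [Category.assoc, f.f₁_d₀, reassoc_of% s.2.1]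
      · rw [Category.assoc, f.f₁_d₁, reassoc_of% s.2.2]

lemma onPoints_essSurj_iff : (onPoints f Z).EssSurj ↔ ∀ b : Z ⟶ B.obj,
    ∃ (a : Z ⟶ A.obj) (s t : Z ⟶ B.arr), B.IsInversePair s t ∧ s ≫ B.d₀ = b ∧
      s ≫ B.d₁ = a ≫ f.f₀ := by
  constructor
  · intro h b
    obtain ⟨x, ⟨e⟩⟩ := h.mem_essImage ⟨b⟩
    exact ⟨x.pt, _, _, isInversePair_of_iso e.symm, e.inv.2.1,
      e.inv.2.2.trans (onPoints_obj_pt f Z x)⟩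
  · refine fun h => ⟨fun b => ?_⟩
    obtain ⟨a, s, t, hst, h₀, h₁⟩ := h b.pt
    exact ⟨⟨a⟩, ⟨(hst.toIso h₀ (h₁.trans (onPoints_obj_pt f Z ⟨a⟩).symm)).symm⟩⟩

lemma onPoints_comp {D : InternalCat C} (g : B ⟶ D) :
    onPoints (f ≫ g) Z = onPoints f Z ⋙ onPoints g Z :=
  ((Points.map_comp_map f g (𝟙 Z) (𝟙 Z)).trans
    (Points.map_congr rfl (Category.comp_id _))).symm

end onPoints

/-- If the morphisms of `E` are regular epimorphisms, `E`-equivalences are detected on points. -/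
lemma relEquivalences_iff_onPoints {E : MorphismProperty C} (hE : IsDetectedByProjectives E)
    (hP : HasEnoughProjectivesRel E) (hr : ∀ ⦃X Y : C⦄ (p : X ⟶ Y), E p → IsRegularEpi p)
    {A B : InternalCat C} (f : A ⟶ B) :
    relEquivalences E f ↔ ∀ P : C, IsProjectiveRel E P → (onPoints f P).IsEquivalence := by
  rw [relEquivalences_iff, isEssSurj_iff hE]
  constructor
  · rintro ⟨h₁, h₂⟩ P hP
    obtain ⟨_, _⟩ := (onPoints_full_faithful_iff f P).2 (fun x y t => h₁ x y t)
    have := (onPoints_essSurj_iff f P).2 (h₂ P hP)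
    exact {}
  · intro h
    refine ⟨?_, fun P hP => (onPoints_essSurj_iff f P).1 (h P hP).essSurj⟩
    have hff (P : C) (hP : IsProjectiveRel E P) := (onPoints_full_faithful_iff f P).1
      ⟨(h P hP).full, (h P hP).faithful⟩
    -- Full faithfulness says that this comparison is invertible. Projectives see it as surjective,
    -- so it is in `E` and a regular epimorphism; it is a monomorphism because equality can be
    -- tested on covers by projectives.
    let c : A.arr ⟶ B.pullArr f.f₀ := pullLift A.d₀ A.d₁ f.f₁ f.f₁_d₀ f.f₁_d₁
    have hc₀ : c ≫ B.pullSrc f.f₀ = A.d₀ := pullLift_src ..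
    have hc₁ : c ≫ B.pullTgt f.f₀ = A.d₁ := pullLift_tgt ..
    have hc : c ≫ B.pullVal f.f₀ = f.f₁ := pullLift_val ..
    have : IsRegularEpi c := hr c (hE c fun P hP y => by
      obtain ⟨s, ⟨h₀, h₁, hs⟩, -⟩ := hff P hP (y ≫ B.pullSrc _) (y ≫ B.pullTgt _)
        (y ≫ B.pullVal _) (by simp [pullVal_d₀]) (by simp [pullVal_d₁])
      exact ⟨s, pullArr_ext (by simp [hc₀, h₀]) (by simp [hc₁, h₁]) (by simp [hc, hs])⟩)
    have : Mono c := ⟨fun {Z} k l e => by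
      obtain ⟨P, p, hP, hp⟩ := hP Z
      have := hr p hp
      rw [← cancel_epi p]
      refine (hff P hP ((p ≫ k) ≫ A.d₀) ((p ≫ k) ≫ A.d₁) ((p ≫ k) ≫ f.f₁) ?_ ?_).unique
        ⟨rfl, rfl, rfl⟩ ⟨?_, ?_, ?_⟩
      · simp [f.f₁_d₀]
      · simp [f.f₁_d₁]
      · simp only [Category.assoc, ← hc₀, reassoc_of% e]
      · simp only [Category.assoc, ← hc₁, reassoc_of% e]
      · simp only [Category.assoc, ← hc, reassoc_of% e]⟩
    have : IsIso c := isIso_of_mono_of_strongEpi c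
    intro Z x y t h₀ h₁
    refine ⟨pullLift x y t h₀ h₁ ≫ inv c, ⟨?_, ?_, ?_⟩, fun s ⟨hs₀, hs₁, hs⟩ => ?_⟩
    · rw [← hc₀]; simp
    · rw [← hc₁]; simp
    · rw [← hc]; simp
    · rw [IsIso.eq_comp_inv]
      exact pullArr_ext (by simp [hc₀, hs₀]) (by simp [hc₁, hs₁]) (by simp [hc, hs])

/-- Detection on projective points reduces the claim to equivalences of ordinary categories. -/
lemma hasTwoOutOfThreeProperty_relEquivalences {E : MorphismProperty C}
    (hE : IsDetectedByProjectives E) (hP : HasEnoughProjectivesRel E)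
    (hr : ∀ ⦃X Y : C⦄ (p : X ⟶ Y), E p → IsRegularEpi p) :
    (relEquivalences E).HasTwoOutOfThreeProperty where
  comp_mem f g hf hg := by
    rw [relEquivalences_iff_onPoints hE hP hr] at hf hg ⊢
    intro P hP
    have := hf P hP
    have := hg P hP
    rw [onPoints_comp]
    infer_instance
  of_postcomp f g hg hfg := by
    rw [relEquivalences_iff_onPoints hE hP hr] at hg hfg ⊢
    intro P hP
    have := hg P hP
    have := hfg P hP
    rw [onPoints_comp] at this
    exact Functor.isEquivalence_of_comp_right _ (onPoints g P)
  of_precomp f g hf hfg := by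
    rw [relEquivalences_iff_onPoints hE hP hr] at hf hfg ⊢
    intro P hP
    have := hf P hP
    have := hfg P hP
    rw [onPoints_comp] at this
    exact Functor.isEquivalence_of_comp_left (onPoints f P) _

end InternalCat

/-! ### Epimorphisms relative to a topology -/

section Topology

variable {C : Type u} [Category.{v} C]

/-- Epimorphisms of sheaves are the locally surjective morphisms. A section `y` of the representable
presheaf of `Y` lifts exactly over the pullback along `y` of the sieve generated by `p`; the
identity of `Y` is the universal section. -/
lemma tEpi_iff (T : GrothendieckTopology C) {X Y : C} (p : X ⟶ Y) :
    tEpi T p ↔ Sieve.generate (Presieve.singleton p) ∈ T Y := by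
  rw [tEpi, ← Sheaf.isLocallySurjective_iff_epi,
    Presheaf.isLocallySurjective_presheafToSheaf_map_iff, Sieve.generateSingleton_eq]
  have key {U : C} (y : (uliftYoneda.{u}.obj Y).obj (op U)) :
      Presheaf.imageSieve (uliftYoneda.{u}.map p) y =
      (Sieve.generateSingleton p).pullback y.down := by
    ext V i
    constructor
    · rintro ⟨t, ht⟩
      exact ⟨t.down, congrArg ULift.down ht⟩
    · rintro ⟨t, ht⟩
      exact ⟨⟨t⟩, congrArg ULift.up ht⟩
  constructor
  · intro h
    exact (congrArg (· ∈ T Y) ((key (ULift.up (𝟙 Y))).trans Sieve.pullback_id)).mp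
      (h.imageSieve_mem (U := Y) (ULift.up (𝟙 Y)))
  · refine fun h => ⟨fun {U} y => ?_⟩
    rw [key]
    exact T.pullback_stable _ h

/-- A morphism `P ⟶ Y` of the class with `P` projective factors through `f`, so its covering sieve
is contained in the one generated by `f`. -/
lemma isDetectedByProjectives_tEpi [HasFiniteLimits C] (T : GrothendieckTopology C)
    (hP : HasEnoughProjectivesRel (tEpi T)) :
    InternalCat.IsDetectedByProjectives (tEpi T) := by
  intro X Y f h
  obtain ⟨P, p, hP, hp⟩ := hP Y
  obtain ⟨x, rfl⟩ := h P hP p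
  rw [tEpi_iff] at hp ⊢
  refine T.superset_covering ?_ hp
  rw [Sieve.generate_le_iff]
  rintro Z _ ⟨⟩
  exact ⟨_, x, f, ⟨⟩, rfl⟩

lemma isModelStructure_of_tEpi [HasFiniteLimits C] [HasFiniteLimits (InternalCat C)]
    [HasFiniteColimits (InternalCat C)] (T : GrothendieckTopology C)
    (h₂ : (tEquivalences T).HasTwoOutOfThreeProperty)
    (hP : HasEnoughProjectivesRel (tEpi T)) :
    IsModelStructure (tFibrations T) (tCofibrations T) (tEquivalences T) :=
  InternalCat.isModelStructure (isDetectedByProjectives_tEpi T hP) hP h₂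

/-! ### The regular epimorphism topology -/

/-- The pullback of the sieve generated by `p` is generated by the pullback of `p`, and all
representables are sheaves for a sieve on one generator exactly when that generator is an effective
epimorphism. -/
lemma stableRegularEpi_iff [HasPullbacks C] {X Y : C} (p : X ⟶ Y) :
    stableRegularEpi C p ↔
      Sieve.generate (Presieve.singleton p) ∈ Sheaf.canonicalTopology C Y := by
  constructor
  · intro hp
    refine Sheaf.mem_finestTopology_of_forall_isSheafFor ?_
    rintro _ ⟨W, rfl⟩ Z f
    have h : IsRegularEpi (pullback.snd p f) := hp _ _ _ (IsPullback.of_hasPullback p f).flip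
    have := (Presieve.EffectiveEpimorphic.iff_forall_isSheafFor_yoneda _).1
      ((Sieve.effectiveEpimorphic_singleton (pullback.snd p f)).2 inferInstance) W
    rw [Presieve.isSheafFor_iff_generate] at this
    convert this using 1
    rw [Sieve.generateSingleton_eq, Sieve.generateSingleton_eq]
    congr 1
    ext V g
    constructor
    · rintro ⟨e, he⟩
      exact ⟨pullback.lift e g he, pullback.lift_snd ..⟩
    · rintro ⟨e, rfl⟩
      exact ⟨e ≫ pullback.fst _ _, by rw [Category.assoc, Category.assoc, pullback.condition]⟩
  · intro hp X' Y' q p' g h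
    have hp' := (Sheaf.canonicalTopology C).pullback_stable p' hp
    have e : (Sieve.generate (Presieve.singleton p)).pullback p' =
        Sieve.generate (Presieve.singleton g) := by
      rw [Sieve.generateSingleton_eq, Sieve.generateSingleton_eq]
      ext V k
      constructor
      · rintro ⟨e, he⟩
        exact ⟨h.lift k e he.symm, h.lift_fst ..⟩
      · rintro ⟨e, rfl⟩
        exact ⟨e ≫ q, by rw [Category.assoc, Category.assoc, h.w]⟩
    rw [e] at hp'
    have : EffectiveEpi g := by
      rw [← Sieve.effectiveEpimorphic_singleton,
        Presieve.EffectiveEpimorphic.iff_forall_isSheafFor_yoneda]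
      intro W
      rw [Presieve.isSheafFor_iff_generate]
      exact Sheaf.isSheaf_yoneda_obj W _ hp'
    exact inferInstanceAs (IsRegularEpi g)

/-- By `stableRegularEpi_iff` the canonical topology belongs to the family whose infimum is taken,
so it bounds the generated topology and no further single covers appear. -/
lemma tEpi_regularEpiTopology [HasPullbacks C] :
    tEpi (regularEpiTopology C) = stableRegularEpi C := by
  ext X Y p
  rw [tEpi_iff]
  constructor
  · intro h
    rw [stableRegularEpi_iff]
    exact h _ ⟨⟨_, _, fun X Y q hq => (stableRegularEpi_iff q).1 hq, rfl⟩, rfl⟩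
  · rintro hp _ ⟨⟨_, J, hJ, rfl⟩, rfl⟩
    exact hJ p hp

lemma isRegularEpi_of_stableRegularEpi {X Y : C} {p : X ⟶ Y} (h : stableRegularEpi C p) :
    IsRegularEpi p :=
  MorphismProperty.universally_le _ _ h

theorem regularEpiTopology_isModelStructure [HasFiniteLimits C] [HasFiniteLimits (InternalCat C)]
    [HasFiniteColimits (InternalCat C)] (hP : HasEnoughProjectivesRel (stableRegularEpi C)) :
    IsModelStructure (tFibrations (regularEpiTopology C)) (tCofibrations (regularEpiTopology C))
      (bungePareEquivalences C) := by
  have e : bungePareEquivalences C = tEquivalences (regularEpiTopology C) := by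
    rw [tEquivalences, tEpi_regularEpiTopology, bungePareEquivalences]
  rw [e]
  rw [← tEpi_regularEpiTopology] at hP
  refine isModelStructure_of_tEpi _ ?_ hP
  refine InternalCat.hasTwoOutOfThreeProperty_relEquivalences
    (isDetectedByProjectives_tEpi _ hP) hP fun X Y p hp => ?_
  rw [tEpi_regularEpiTopology] at hp
  exact isRegularEpi_of_stableRegularEpi hp

end Topology

/-! ### The trivial topology -/

section TrivialTopology

variable {C : Type u} [Category.{v} C]

lemma tEpi_bot_iff {X Y : C} (p : X ⟶ Y) : tEpi ⊥ p ↔ ∃ s : Y ⟶ X, s ≫ p = 𝟙 Y := by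
  rw [tEpi_iff, GrothendieckTopology.bot_covering, ← Sieve.id_mem_iff_eq_top]
  constructor
  · rintro ⟨Z, s, _, ⟨⟩, e⟩
    exact ⟨s, e⟩
  · rintro ⟨s, e⟩
    exact ⟨X, s, p, ⟨⟩, e⟩

lemma isProjectiveRel_tEpi_bot (P : C) : IsProjectiveRel (tEpi ⊥) P := by
  intro X Y p hp f
  obtain ⟨s, hs⟩ := (tEpi_bot_iff p).1 hp
  exact ⟨f ≫ s, by rw [Category.assoc, hs, Category.comp_id]⟩

lemma hasEnoughProjectivesRel_tEpi_bot : HasEnoughProjectivesRel (tEpi (⊥ : GrothendieckTopology C)) :=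
  fun X => ⟨X, 𝟙 X, isProjectiveRel_tEpi_bot X, (tEpi_bot_iff _).2 ⟨𝟙 X, Category.comp_id _⟩⟩

lemma isRegularEpi_of_tEpi_bot {X Y : C} (p : X ⟶ Y) (hp : tEpi ⊥ p) : IsRegularEpi p := by
  obtain ⟨s, hs⟩ := (tEpi_bot_iff p).1 hp
  have : IsSplitEpi p := ⟨⟨s, hs⟩⟩
  infer_instance

variable [HasFiniteLimits C]

lemma hasTwoOutOfThreeProperty_tEquivalences_bot :
    (tEquivalences (⊥ : GrothendieckTopology C)).HasTwoOutOfThreeProperty :=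
  InternalCat.hasTwoOutOfThreeProperty_relEquivalences
    (isDetectedByProjectives_tEpi _ hasEnoughProjectivesRel_tEpi_bot)
    hasEnoughProjectivesRel_tEpi_bot (fun _ _ => isRegularEpi_of_tEpi_bot)

end TrivialTopology

/-! ### Internal categories in the category of sets -/

namespace InternalCat

lemma ext_of_points {X Y : Type w} {f g : X ⟶ Y} (h : ∀ p : PUnit.{w + 1} ⟶ X, p ≫ f = p ≫ g) :
    f = g := by
  ext x
  exact ConcreteCategory.congr_hom (h (↾fun _ => x)) PUnit.unit

lemma exists_hom_of_points {X Y : Type w} (φ : (PUnit.{w + 1} ⟶ X) → (PUnit.{w + 1} ⟶ Y)) :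
    ∃ f : X ⟶ Y, ∀ p, p ≫ f = φ p :=
  ⟨↾fun x => φ (↾fun _ => x) PUnit.unit, fun p => by
    ext
    rfl⟩

lemma isInversePair_of_points {A : InternalCat (Type w)} {Z : Type w} {s t : Z ⟶ A.arr}
    (h : ∀ p : PUnit.{w + 1} ⟶ Z, A.IsInversePair (p ≫ s) (p ≫ t)) : A.IsInversePair s t where
  w₀ := ext_of_points fun p => by simpa only [Category.assoc] using (h p).w₀
  w₁ := ext_of_points fun p => by simpa only [Category.assoc] using (h p).w₁
  comp_ab := ext_of_points fun p => by
    simpa only [precomp_comp, Category.assoc] using (h p).comp_ab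
  comp_ba := ext_of_points fun p => by
    simpa only [precomp_comp, Category.assoc] using (h p).comp_ba

section underlyingCat

variable {A B : InternalCat (Type w)}

lemma underlyingCat_map_injective {f g : A ⟶ B}
    (h : onPoints f PUnit.{w + 1} = onPoints g PUnit.{w + 1}) : f = g := by
  have h₀ (x : A.Points PUnit.{w + 1}) : x.pt ≫ f.f₀ = x.pt ≫ g.f₀ := by
    rw [← onPoints_obj_pt, ← onPoints_obj_pt, h]
  have h₁ {x y : A.Points PUnit.{w + 1}} (a : x ⟶ y) : a.1 ≫ f.f₁ = a.1 ≫ g.f₁ := by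
    have := Functor.congr_hom h a
    rw [← onPoints_map_val, ← onPoints_map_val, this, Points.eqToHom_val]
  exact hom_ext (ext_of_points fun p => h₀ ⟨p⟩)
    (ext_of_points fun p => h₁ (x := ⟨p ≫ A.d₀⟩) (y := ⟨p ≫ A.d₁⟩) ⟨p, rfl, rfl⟩)

/-- A function on one-point elements is a morphism of sets. The axioms of an internal functor are
checked on points, where they express functoriality of `F`. -/
lemma exists_onPoints_eq (F : A.Points PUnit.{w + 1} ⥤ B.Points PUnit.{w + 1}) :
    ∃ f : A ⟶ B, onPoints f PUnit.{w + 1} = F := by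
  let a (p : PUnit.{w + 1} ⟶ A.arr) : (⟨p ≫ A.d₀⟩ : A.Points PUnit.{w + 1}) ⟶ ⟨p ≫ A.d₁⟩ :=
    ⟨p, rfl, rfl⟩
  obtain ⟨f₀, h₀⟩ := exists_hom_of_points fun p => (F.obj ⟨p⟩).pt
  obtain ⟨f₁, h₁'⟩ := exists_hom_of_points fun p => (F.map (a p)).1
  have h₁ {x y : A.Points PUnit.{w + 1}} (b : x ⟶ y) : b.1 ≫ f₁ = (F.map b).1 := by
    obtain ⟨b, hx, hy⟩ := b
    obtain rfl := Points.ext' (x := ⟨b ≫ A.d₀⟩) hx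
    obtain rfl := Points.ext' (x := ⟨b ≫ A.d₁⟩) hy
    exact h₁' b
  let f : A ⟶ B := Hom.ofElements f₀ f₁
    (ext_of_points fun p => by
      rw [← Category.assoc, ← Category.assoc, h₁', h₀]
      exact (F.map (a p)).2.1)
    (ext_of_points fun p => by
      rw [← Category.assoc, ← Category.assoc, h₁', h₀]
      exact (F.map (a p)).2.2)
    (ext_of_points fun p => by
      rw [← Category.assoc, ← Category.assoc, h₀]
      refine (h₁ (𝟙 (⟨p⟩ : A.Points PUnit.{w + 1}))).trans ?_
      rw [F.map_id]
      rfl)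
    (fun {X} s t h => ext_of_points fun p => by
      let b : (⟨(p ≫ s) ≫ A.d₁⟩ : A.Points PUnit.{w + 1}) ⟶ ⟨(p ≫ t) ≫ A.d₁⟩ :=
        ⟨p ≫ t, by rw [Category.assoc, Category.assoc, h], rfl⟩
      have e := h₁ (a (p ≫ s) ≫ b)
      rw [F.map_comp] at e
      simp only [Points.comp_val, ← h₁] at e
      rw [precomp_comp, ← Category.assoc, precomp_comp]
      exact e.trans (comp_congr _ (Category.assoc ..) (Category.assoc ..) _))
  exact ⟨f, Points.functor_ext (fun x => (onPoints_obj_pt ..).trans (h₀ _))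
    (fun x y b => (onPoints_map_val ..).trans (h₁ b))⟩

/-- The composition of composable arrows in the type of all arrows of a category. -/
def compArrows {D : Type w} [Category.{w} D] (a b : Σ x y : D, x ⟶ y) (h : a.2.1 = b.1) :
    Σ x y : D, x ⟶ y :=
  ⟨a.1, b.2.1, a.2.2 ≫ eqToHom h ≫ b.2.2⟩

lemma compArrows_mk {D : Type w} [Category.{w} D] {x y z : D} (a : x ⟶ y) (b : y ⟶ z) :
    compArrows ⟨x, y, a⟩ ⟨y, z, b⟩ rfl = ⟨x, z, a ≫ b⟩ := by
  simp [compArrows]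

lemma id_compArrows {D : Type w} [Category.{w} D] (a : Σ x y : D, x ⟶ y) :
    compArrows ⟨a.1, a.1, 𝟙 a.1⟩ a rfl = a := by
  simp [compArrows]

lemma compArrows_id {D : Type w} [Category.{w} D] (a : Σ x y : D, x ⟶ y) :
    compArrows a ⟨a.2.1, a.2.1, 𝟙 a.2.1⟩ rfl = a := by
  simp [compArrows]

/-- The internal category in sets given by a small category. -/
def ofCat (D : Type w) [Category.{w} D] : InternalCat (Type w) :=
  ofElements (C := Type w) (obj := D) (arr := Σ x y : D, x ⟶ y) (↾fun a => a.1) (↾fun a => a.2.1)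
    (↾fun x => ⟨x, x, 𝟙 x⟩) rfl rfl
    (fun f g h => ↾fun z => compArrows (f z) (g z) (by exact ConcreteCategory.congr_hom h z))
    (fun _ _ _ _ => rfl) (fun _ _ _ => rfl) (fun _ _ _ => rfl)
    (fun f => by
      refine ConcreteCategory.hom_ext _ _ fun z => ?_
      exact id_compArrows (f z))
    (fun f => by
      refine ConcreteCategory.hom_ext _ _ fun z => ?_
      exact compArrows_id (f z))
    (fun f g h hfg hgh => by
      refine ConcreteCategory.hom_ext _ _ fun z => ?_
      have key (a b c : Σ x y : D, x ⟶ y) (h : a.2.1 = b.1) (h' : b.2.1 = c.1) :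
          compArrows (compArrows a b h) c h' = compArrows a (compArrows b c h') h := by
        simp [compArrows]
      exact key (f z) (g z) (h z) (by exact ConcreteCategory.congr_hom hfg z)
        (by exact ConcreteCategory.congr_hom hgh z))

/-- The comparison of a small category with the points of the associated internal category. -/
def toPointsOfCat (D : Type w) [Category.{w} D] : D ⥤ (ofCat D).Points PUnit.{w + 1} where
  obj x := ⟨↾fun _ => x⟩
  map {x y} a := ⟨↾fun _ => ⟨x, y, a⟩, rfl, rfl⟩
  map_id _ := rfl
  map_comp {x y z} a b := by
    refine Subtype.ext (Eq.trans ?_ (ofElements_comp (C := Type w) ..).symm)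
    ext
    exact (compArrows_mk a b).symm

instance (D : Type w) [Category.{w} D] : (toPointsOfCat D).Full where
  map_surjective {x y} p := by
    obtain ⟨p, h₀, h₁⟩ := p
    obtain ⟨q, rfl⟩ : ∃ q, p = ↾fun _ => q := ⟨p PUnit.unit, rfl⟩
    obtain ⟨x', y', a⟩ := q
    obtain rfl : x' = x := ConcreteCategory.congr_hom h₀ PUnit.unit
    obtain rfl : y' = y := ConcreteCategory.congr_hom h₁ PUnit.unit
    exact ⟨a, rfl⟩

instance (D : Type w) [Category.{w} D] : (toPointsOfCat D).Faithful where
  map_injective {x y} a b h := by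
    have := ConcreteCategory.congr_hom (congrArg Subtype.val h) PUnit.unit
    exact eq_of_heq (Sigma.mk.inj (eq_of_heq (Sigma.mk.inj this).2)).2

/-- The object given by a point of the internal category associated with a small category. -/
def ofPoint {D : Type w} [Category.{w} D] (x : (ofCat D).Points PUnit.{w + 1}) : D :=
  x.pt PUnit.unit

lemma exists_ofPoint_hom {D : Type w} [Category.{w} D] {x y : (ofCat D).Points PUnit.{w + 1}}
    (a : x ⟶ y) : ∃ b : ofPoint x ⟶ ofPoint y, (toPointsOfCat D).map b = a :=
  (toPointsOfCat D).map_surjective (X := ofPoint x) (Y := ofPoint y) a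

/-- The inverse of `toPointsOfCat`. -/
def ofPointsOfCat (D : Type w) [Category.{w} D] : (ofCat D).Points PUnit.{w + 1} ⥤ D where
  obj x := ofPoint x
  map a := (exists_ofPoint_hom a).choose
  map_id x := (toPointsOfCat D).map_injective
    ((exists_ofPoint_hom (𝟙 x)).choose_spec.trans ((toPointsOfCat D).map_id (ofPoint x)).symm)
  map_comp a b := (toPointsOfCat D).map_injective
    ((exists_ofPoint_hom (a ≫ b)).choose_spec.trans (((toPointsOfCat D).map_comp _ _).trans
      (congrArg₂ (· ≫ ·) (exists_ofPoint_hom a).choose_spec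
        (exists_ofPoint_hom b).choose_spec)).symm)

lemma ofPointsOfCat_comp (D : Type w) [Category.{w} D] :
    ofPointsOfCat D ⋙ toPointsOfCat D = 𝟭 _ :=
  Points.functor_ext (fun _ => rfl) (fun _ _ a =>
    congrArg Subtype.val (exists_ofPoint_hom a).choose_spec)

lemma toPointsOfCat_comp (D : Type w) [Category.{w} D] :
    toPointsOfCat D ⋙ ofPointsOfCat D = 𝟭 _ :=
  CategoryTheory.Functor.ext (fun _ => rfl) (fun x y a => by
    refine Eq.trans ?_ ((Category.id_comp _).trans (Category.comp_id a)).symm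
    exact (toPointsOfCat D).map_injective
      (exists_ofPoint_hom ((toPointsOfCat D).map a)).choose_spec)

/-- A small category is isomorphic to the category of points of the associated internal
category. -/
def underlyingCatOfCat (D : Cat.{w, w}) : underlyingCat.obj (ofCat D) ≅ D where
  hom := (ofPointsOfCat D).toCatHom
  inv := (toPointsOfCat D).toCatHom
  hom_inv_id := Cat.Hom.ext (ofPointsOfCat_comp D)
  inv_hom_id := Cat.Hom.ext (toPointsOfCat_comp D)

instance : underlyingCat.{w}.Faithful where
  map_injective h := underlyingCat_map_injective (congrArg Cat.Hom.toFunctor h)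

instance : underlyingCat.{w}.Full where
  map_surjective F := by
    obtain ⟨f, hf⟩ := exists_onPoints_eq F.toFunctor
    exact ⟨f, Cat.Hom.ext hf⟩

instance : underlyingCat.{w}.EssSurj where
  mem_essImage D := ⟨_, ⟨underlyingCatOfCat D⟩⟩

instance : underlyingCat.{w}.IsEquivalence where

instance : HasFiniteLimits (InternalCat (Type w)) :=
  have := Adjunction.has_limits_of_equivalence.{w, w} underlyingCat.{w}
  inferInstance

instance : HasFiniteColimits (InternalCat (Type w)) :=
  have := Adjunction.has_colimits_of_equivalence.{w, w} underlyingCat.{w}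
  inferInstance

end underlyingCat

/-! ### The folk model structure -/

variable {A B : InternalCat (Type w)} (f : A ⟶ B)

lemma isDetectedByProjectives_tEpi_bot :
    IsDetectedByProjectives (tEpi (⊥ : GrothendieckTopology (Type w))) :=
  isDetectedByProjectives_tEpi _ hasEnoughProjectivesRel_tEpi_bot

/-- Every set is projective for the trivial topology, so points over all `Z` count. A `Z`-point is a
family of one-point elements, and choice assembles preimages found pointwise. -/
lemma tEquivalences_bot_iff :
    tEquivalences ⊥ f ↔ (onPoints f PUnit.{w + 1}).IsEquivalence := by
  refine (relEquivalences_iff_onPoints isDetectedByProjectives_tEpi_bot.{w}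
    hasEnoughProjectivesRel_tEpi_bot (fun _ _ => isRegularEpi_of_tEpi_bot) f).trans
    ⟨fun h => h _ (isProjectiveRel_tEpi_bot _), fun h Z _ => ?_⟩
  have hff := (onPoints_full_faithful_iff f PUnit.{w + 1}).1 ⟨h.full, h.faithful⟩
  have hes := (onPoints_essSurj_iff f PUnit.{w + 1}).1 h.essSurj
  obtain ⟨_, _⟩ := (onPoints_full_faithful_iff f Z).2 fun x y t h₀ h₁ => by
    have hp (p : PUnit.{w + 1} ⟶ Z) := hff (p ≫ x) (p ≫ y) (p ≫ t)
      (by simp only [Category.assoc, h₀]) (by simp only [Category.assoc, h₁])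
    choose φ hφ using fun p => (hp p).exists
    obtain ⟨s, hs⟩ := exists_hom_of_points φ
    refine ⟨s, ⟨?_, ?_, ?_⟩, fun r ⟨h₀, h₁, h⟩ => ?_⟩
    · exact ext_of_points fun p => by rw [← Category.assoc, hs, (hφ p).1]
    · exact ext_of_points fun p => by rw [← Category.assoc, hs, (hφ p).2.1]
    · exact ext_of_points fun p => by rw [← Category.assoc, hs, (hφ p).2.2]
    · refine ext_of_points fun p => (hp p).unique ?_ (by rw [hs]; exact hφ p)
      simp only [Category.assoc, h₀, h₁, h, and_self]
  have := (onPoints_essSurj_iff f Z).2 fun b => by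
    choose a s t hst h₀ h₁ using fun p : PUnit.{w + 1} ⟶ Z => hes (p ≫ b)
    obtain ⟨a', ha⟩ := exists_hom_of_points a
    obtain ⟨s', hs⟩ := exists_hom_of_points s
    obtain ⟨t', ht⟩ := exists_hom_of_points t
    refine ⟨a', s', t', isInversePair_of_points fun p => by rw [hs, ht]; exact hst p,
      ext_of_points fun p => ?_, ext_of_points fun p => ?_⟩
    · rw [← Category.assoc, hs, h₀]
    · rw [← Category.assoc, ← Category.assoc, hs, h₁, ha]
  exact {}

lemma tFibrations_bot_iff : tFibrations ⊥ f ↔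
    ∀ (e : A.Points PUnit.{w + 1}) (b : B.Points PUnit.{w + 1})
      (β : b ≅ (onPoints f PUnit.{w + 1}).obj e),
      ∃ (e' : A.Points PUnit.{w + 1}) (ε : e' ≅ e) (h : (onPoints f PUnit.{w + 1}).obj e' = b),
        (onPoints f PUnit.{w + 1}).map ε.hom = eqToHom h ≫ β.hom := by
  refine (relFibrations_iff isDetectedByProjectives_tEpi_bot.{w}).trans ⟨fun h e b β => ?_,
    fun h Z _ e s t hst hs => ?_⟩
  · obtain ⟨s, t, hst, hs, hsf⟩ := h _ (isProjectiveRel_tEpi_bot _) e.pt β.hom.1 β.inv.1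
      (isInversePair_of_iso β) (β.hom.2.2.trans (onPoints_obj_pt ..))
    refine ⟨⟨s ≫ A.d₀⟩, hst.toIso rfl hs, Points.ext' ?_, Subtype.ext ?_⟩
    · rw [onPoints_obj_pt, Category.assoc, ← f.f₁_d₀, reassoc_of% hsf, β.hom.2.1]
    · refine (onPoints_map_val ..).trans (hsf.trans ?_)
      -- Composition with `eqToHom` does not change the underlying arrow, so the required equation
      -- is `hsf`.
      have := Points.eqToHom_val (A := B) (x := (onPoints f PUnit.{w + 1}).obj ⟨s ≫ A.d₀⟩)
        (x' := b) (Points.ext' (by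
          rw [onPoints_obj_pt, Category.assoc, ← f.f₁_d₀, reassoc_of% hsf, β.hom.2.1])) β.hom rfl
      rw [eqToHom_refl, Category.comp_id] at this
      exact this.symm
  · have hp (p : PUnit.{w + 1} ⟶ Z) : ∃ s' t' : PUnit.{w + 1} ⟶ A.arr, A.IsInversePair s' t' ∧
        s' ≫ A.d₁ = p ≫ e ∧ s' ≫ f.f₁ = p ≫ s := by
      have w : (p ≫ s) ≫ B.d₁ = (p ≫ e) ≫ f.f₀ := by rw [Category.assoc, hs, Category.assoc]
      obtain ⟨e', ε, he, h⟩ := h ⟨p ≫ e⟩ ⟨(p ≫ s) ≫ B.d₀⟩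
        ((hst.precomp p).toIso rfl (w.trans (onPoints_obj_pt ..).symm))
      refine ⟨_, _, isInversePair_of_iso ε, ε.hom.2.2, ?_⟩
      rw [← onPoints_map_val, h]
      have := Points.eqToHom_val he ((hst.precomp p).toIso rfl
        (w.trans (onPoints_obj_pt f PUnit.{w + 1} ⟨p ≫ e⟩).symm)).hom rfl
      rw [eqToHom_refl, Category.comp_id] at this
      exact this
    choose σ τ h₁ h₂ h₃ using hp
    obtain ⟨s', hs'⟩ := exists_hom_of_points σ
    obtain ⟨t', ht'⟩ := exists_hom_of_points τ
    refine ⟨s', t', isInversePair_of_points fun p => by rw [hs', ht']; exact h₁ p,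
      ext_of_points fun p => ?_, ext_of_points fun p => ?_⟩
    · rw [← Category.assoc, hs', h₂]
    · rw [← Category.assoc, hs', h₃]

/-- Once `A` has an object, the indiscrete category on `A₀` is trivially fibrant; extending the
canonical functor from `A` to it along `f` splits `f₀`. Conversely, a section of `p₀` defines the
lift off the image of `f₀`. -/
lemma tCofibrations_bot_iff_injective : tCofibrations ⊥ f ↔ Function.Injective f.f₀ := by
  constructor
  · intro h a a' e
    obtain ⟨k, hk⟩ := exists_indisc_hom A (Z := A.obj) (𝟙 _)
    have hp : (tFibrations ⊥ ⊓ tEquivalences ⊥) ((disc (⊤_ (Type w))).pullπ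
        (X := A.obj) (terminal.from A.obj)) :=
      (relFibrations_inf_relEquivalences_iff isDetectedByProjectives_tEpi_bot.{w}).2
        ⟨isFF_pullπ _ _, (tEpi_bot_iff _).2 ⟨↾fun _ => a, terminal.hom_ext _ _⟩⟩
    have sq : CommSq k f ((disc (⊤_ (Type w))).pullπ (X := A.obj) (terminal.from A.obj))
        (toTerminal B) := ⟨hom_ext (terminal.hom_ext _ _) (terminal.hom_ext _ _)⟩
    have : sq.HasLift := (h _ hp).sq_hasLift sq
    have hl : f.f₀ ≫ sq.lift.f₀ = 𝟙 A.obj := (congrArg Hom.f₀ sq.fac_left).trans hk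
    have hla (a : A.obj) : sq.lift.f₀ (f.f₀ a) = a := ConcreteCategory.congr_hom hl a
    rw [← hla a, ← hla a', e]
  · intro h X Y p hp
    obtain ⟨hp, hp₀⟩ :=
      (relFibrations_inf_relEquivalences_iff isDetectedByProjectives_tEpi_bot.{w}).1 hp
    obtain ⟨σ, hσ⟩ := (tEpi_bot_iff _).1 hp₀
    refine hp.hasLiftingProperty fun x y e => ?_
    classical
    have hx (a : A.obj) : Function.extend f.f₀ x (fun b => σ (y b)) (f.f₀ a) = x a :=
      h.extend_apply _ _ a
    refine ⟨↾Function.extend f.f₀ x (fun b => σ (y b)), ?_, ?_⟩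
    · ext a
      exact hx a
    · ext b
      by_cases hb : ∃ a, f.f₀ a = b
      · obtain ⟨a, rfl⟩ := hb
        exact (congrArg p.f₀ (hx a)).trans (ConcreteCategory.congr_hom e a)
      · exact (congrArg p.f₀ (Function.extend_apply' x (fun b => σ (y b)) b hb)).trans
          (ConcreteCategory.congr_hom hσ (y b))

lemma tCofibrations_bot_iff :
    tCofibrations ⊥ f ↔ Function.Injective (onPoints f PUnit.{w + 1}).obj := by
  rw [tCofibrations_bot_iff_injective]
  constructor
  · intro h x y e
    have e' := congrArg Points.pt e
    rw [onPoints_obj_pt, onPoints_obj_pt] at e'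
    refine Points.ext' ?_
    ext z
    exact h (ConcreteCategory.congr_hom e' z)
  · intro h a a' e
    have := @h ⟨↾fun _ => a⟩ ⟨↾fun _ => a'⟩ (Points.ext' (by
      rw [onPoints_obj_pt, onPoints_obj_pt]
      ext
      exact e))
    exact ConcreteCategory.congr_hom (congrArg Points.pt this) PUnit.unit

end InternalCat

theorem isModelStructure_tEpi_bot :
    IsModelStructure (tFibrations (⊥ : GrothendieckTopology (Type w)))
      (tCofibrations (⊥ : GrothendieckTopology (Type w)))
      (tEquivalences (⊥ : GrothendieckTopology (Type w))) :=
  isModelStructure_of_tEpi _ hasTwoOutOfThreeProperty_tEquivalences_bot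
    hasEnoughProjectivesRel_tEpi_bot

/-! ### Generalized elements of the nerve -/

namespace InternalCat

variable {C : Type u} [Category.{v} C] [HasFiniteLimits C]

/-- The isomorphism expressing that the nerve represents the presheaves of strings of arrows. -/
def nerIso (A : InternalCat C) (n : SimplexCategoryᵒᵖ) :
    yoneda.obj ((ner.obj A).obj n) ≅ (nervePresheaf.obj A).obj n :=
  (Functor.essImage.liftFunctorCompIso (Functor.uncurry.obj (nervePresheaf (C := C))) yoneda
    (fun x => nervePresheaf_mem_essImage x.1 x.2)).app (A, n)

/-- `ner` is the currying of a lift through Yoneda, so naturality in the degree is naturality in two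
variables at the pair `(𝟙 A, θ)`. -/
lemma nerIso_naturality_map (A : InternalCat C) {n m : SimplexCategoryᵒᵖ} (θ : n ⟶ m) :
    yoneda.map ((ner.obj A).map θ) ≫ (nerIso A m).hom =
      (nerIso A n).hom ≫ (nervePresheaf.obj A).map θ := by
  refine ((Functor.essImage.liftFunctorCompIso (Functor.uncurry.obj (nervePresheaf (C := C))) yoneda
    (fun x => nervePresheaf_mem_essImage x.1 x.2)).hom.naturality
      (X := (A, n)) (Y := (A, m)) (𝟙 A, θ)).trans ?_
  refine congrArg ((nerIso A n).hom ≫ ·) ?_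
  change (nervePresheaf.map (𝟙 A)).app n ≫ (nervePresheaf.obj A).map θ = _
  rw [CategoryTheory.Functor.map_id, NatTrans.id_app, Category.id_comp]

lemma nerIso_naturality_app {A B : InternalCat C} (f : A ⟶ B) (n : SimplexCategoryᵒᵖ) :
    yoneda.map ((ner.map f).app n) ≫ (nerIso B n).hom =
      (nerIso A n).hom ≫ (nervePresheaf.map f).app n := by
  refine ((Functor.essImage.liftFunctorCompIso (Functor.uncurry.obj (nervePresheaf (C := C))) yoneda
    (fun x => nervePresheaf_mem_essImage x.1 x.2)).hom.naturality
      (X := (A, n)) (Y := (B, n)) (f, 𝟙 n)).trans ?_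
  refine congrArg ((nerIso A n).hom ≫ ·) ?_
  change (nervePresheaf.map f).app n ≫ (nervePresheaf.obj B).map (𝟙 n) = _
  rw [CategoryTheory.Functor.map_id, Category.comp_id]

variable {A B : InternalCat C} {n m : SimplexCategoryᵒᵖ} {X Y : C}

/-- The string of arrows given by a generalized element of the nerve. -/
def toString (x : X ⟶ (ner.obj A).obj n) : ComposableArrows (A.Points X) n.unop.len :=
  (nerIso A n).hom.app (op X) x

lemma toString_bijective :
    Function.Bijective (toString : (X ⟶ (ner.obj A).obj n) → _) :=
  (((nerIso A n).app (op X)).toEquiv).bijective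

lemma toString_precomp (k : Y ⟶ X) (x : X ⟶ (ner.obj A).obj n) :
    toString (k ≫ x) = toString x ⋙ Points.map (𝟙 A) k :=
  ConcreteCategory.congr_hom ((nerIso A n).hom.naturality k.op) x

lemma toString_map (x : X ⟶ (ner.obj A).obj n) (θ : n ⟶ m) :
    toString (x ≫ (ner.obj A).map θ) =
      (SimplexCategory.toCat.map θ.unop).toFunctor ⋙ toString x :=
  ConcreteCategory.congr_hom (NatTrans.congr_app (nerIso_naturality_map A θ) (op X)) x

lemma toString_app (x : X ⟶ (ner.obj A).obj n) (f : A ⟶ B) :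
    toString (x ≫ (ner.map f).app n) = toString x ⋙ onPoints f X :=
  ConcreteCategory.congr_hom (NatTrans.congr_app (nerIso_naturality_app f n) (op X)) x

/-- The objects of the string given by a generalized element of the nerve. -/
def vertex (x : X ⟶ (ner.obj A).obj n) (i : Fin (n.unop.len + 1)) : X ⟶ A.obj :=
  ((toString x).obj i).pt

/-- The arrows of the string given by a generalized element of the nerve. -/
def edge (x : X ⟶ (ner.obj A).obj n) {i j : Fin (n.unop.len + 1)} (h : i ≤ j) : X ⟶ A.arr :=
  ((toString x).map (homOfLE h)).1

lemma edge_d₀ (x : X ⟶ (ner.obj A).obj n) {i j : Fin (n.unop.len + 1)} (h : i ≤ j) :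
    edge x h ≫ A.d₀ = vertex x i :=
  ((toString x).map (homOfLE h)).2.1

lemma edge_d₁ (x : X ⟶ (ner.obj A).obj n) {i j : Fin (n.unop.len + 1)} (h : i ≤ j) :
    edge x h ≫ A.d₁ = vertex x j :=
  ((toString x).map (homOfLE h)).2.2

lemma edge_comp (x : X ⟶ (ner.obj A).obj n) {i j k : Fin (n.unop.len + 1)} (h : i ≤ j)
    (h' : j ≤ k) : edge x (h.trans h') =
      A.comp (edge x h) (edge x h') (by rw [edge_d₀, edge_d₁]) :=
  congrArg Subtype.val ((toString x).map_comp (homOfLE h) (homOfLE h'))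

lemma vertex_precomp (k : Y ⟶ X) (x : X ⟶ (ner.obj A).obj n) (i : Fin (n.unop.len + 1)) :
    vertex (k ≫ x) i = k ≫ vertex x i := by
  rw [vertex, toString_precomp]
  exact congrArg (k ≫ ·) (Category.comp_id _)

lemma edge_precomp (k : Y ⟶ X) (x : X ⟶ (ner.obj A).obj n) {i j : Fin (n.unop.len + 1)}
    (h : i ≤ j) : edge (k ≫ x) h = k ≫ edge x h := by
  have := Functor.congr_hom (toString_precomp k x) (homOfLE h)
  rw [edge, this, Points.eqToHom_val]
  exact congrArg (k ≫ ·) (Category.comp_id _)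

lemma vertex_app (x : X ⟶ (ner.obj A).obj n) (f : A ⟶ B) (i : Fin (n.unop.len + 1)) :
    vertex (x ≫ (ner.map f).app n) i = vertex x i ≫ f.f₀ := by
  rw [vertex, toString_app]
  exact onPoints_obj_pt ..

lemma edge_app (x : X ⟶ (ner.obj A).obj n) (f : A ⟶ B) {i j : Fin (n.unop.len + 1)}
    (h : i ≤ j) : edge (x ≫ (ner.map f).app n) h = edge x h ≫ f.f₁ := by
  have := Functor.congr_hom (toString_app x f) (homOfLE h)
  rw [edge, this, Points.eqToHom_val]
  exact onPoints_map_val ..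

lemma vertex_δ {n : ℕ} (x : X ⟶ (ner.obj A).obj (op (.mk (n + 1)))) (k : Fin (n + 2))
    (i : Fin (n + 1)) :
    vertex (x ≫ (ner.obj A).δ k) i = vertex x (k.succAbove i) := by
  rw [vertex, SimplicialObject.δ_def, toString_map]
  rfl

lemma edge_δ {n : ℕ} (x : X ⟶ (ner.obj A).obj (op (.mk (n + 1)))) (k : Fin (n + 2))
    {i j : Fin (n + 1)} (h : i ≤ j) :
    edge (x ≫ (ner.obj A).δ k) (n := op (.mk n)) h =
      edge x (n := op (.mk (n + 1))) ((Fin.strictMono_succAbove k).monotone h) := by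
  have := Functor.congr_hom (toString_map x (SimplexCategory.δ k).op) (homOfLE h)
  rw [edge, SimplicialObject.δ_def, this, Points.eqToHom_val]
  rfl

lemma ner_hom_ext {x y : X ⟶ (ner.obj A).obj n}
    (h₀ : ∀ i, vertex x i = vertex y i)
    (h : ∀ (i j : Fin (n.unop.len + 1)) (h : i ≤ j), edge x h = edge y h) : x = y :=
  toString_bijective.1 (Points.functor_ext h₀ fun i j a => h i j a.le)

lemma vertex_zero_bijective :
    Function.Bijective fun x : X ⟶ (ner.obj A).obj (op (.mk 0)) => vertex x 0 := by
  constructor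
  · intro x y h
    have h' (i : Fin 1) : vertex x i = vertex y i := by
      obtain rfl := Subsingleton.elim i 0
      exact h
    refine ner_hom_ext h' fun i j hij => ?_
    obtain rfl := Subsingleton.elim (α := Fin 1) i j
    have key (z : X ⟶ (ner.obj A).obj (op (.mk 0))) : edge z hij = vertex z i ≫ A.i :=
      congrArg Subtype.val ((toString z).map_id i)
    rw [key, key, h']
  · intro a
    obtain ⟨x, hx⟩ := (toString_bijective (n := op (.mk 0))).2 (ComposableArrows.mk₀ (⟨a⟩ : A.Points X))
    exact ⟨x, (congrArg (fun F => (F.obj 0).pt) hx :)⟩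

lemma edge_zero_one_bijective :
    Function.Bijective fun x : X ⟶ (ner.obj A).obj (op (.mk 1)) =>
      edge x (n := op (.mk 1)) (zero_le_one : (0 : Fin 2) ≤ 1) := by
  constructor
  · intro x y h
    change edge x (n := op (.mk 1)) (zero_le_one : (0 : Fin 2) ≤ 1) = edge y _ at h
    have h₀ : vertex x (0 : Fin 2) = vertex y (0 : Fin 2) := by
      have := congrArg (· ≫ A.d₀) h
      simp only [edge_d₀] at this
      exact this
    have h₁ : vertex x (1 : Fin 2) = vertex y (1 : Fin 2) := by
      have := congrArg (· ≫ A.d₁) h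
      simp only [edge_d₁] at this
      exact this
    refine toString_bijective.1 (ComposableArrows.ext₁ (Points.ext' h₀) (Points.ext' h₁)
      (Subtype.ext ?_))
    rw [Points.eqToHom_val]
    exact h
  · intro a
    obtain ⟨x, hx⟩ := (toString_bijective (n := op (.mk 1))).2 (ComposableArrows.mk₁
      (show (⟨a ≫ A.d₀⟩ : A.Points X) ⟶ ⟨a ≫ A.d₁⟩ from ⟨a, rfl, rfl⟩))
    refine ⟨x, ?_⟩
    have := Functor.congr_hom hx (homOfLE (zero_le_one : (0 : Fin 2) ≤ 1))
    change ((toString x).map (homOfLE (zero_le_one : (0 : Fin 2) ≤ 1))).1 = _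
    rw [this, Points.eqToHom_val]
    rfl

/-! ### Strings of arrows in a category with zero morphisms -/

section zero

variable [HasZeroMorphisms C]

@[simp]
lemma vertex_zero (i : Fin (n.unop.len + 1)) :
    vertex (0 : X ⟶ (ner.obj A).obj n) i = 0 := by
  rw [← zero_comp (X := X) (f := (0 : X ⟶ (ner.obj A).obj n)), vertex_precomp, zero_comp]

@[simp]
lemma edge_zero {i j : Fin (n.unop.len + 1)} (h : i ≤ j) :
    edge (0 : X ⟶ (ner.obj A).obj n) h = 0 := by
  rw [← zero_comp (X := X) (f := (0 : X ⟶ (ner.obj A).obj n)), edge_precomp, zero_comp]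

/-- The zero arrow is the identity of the zero element of the objects. -/
lemma comp_zero' (a : X ⟶ A.arr) (h : a ≫ A.d₁ = (0 : X ⟶ A.arr) ≫ A.d₀) :
    A.comp a 0 h = a := by
  have h' : a ≫ A.d₁ = 0 := h.trans zero_comp
  refine (A.comp_congr rfl ?_ h).trans (A.comp_id' a)
  rw [reassoc_of% h', zero_comp]

/-- A string of at least two arrows whose first two faces are zero is zero. -/
lemma eq_zero_of_comp_δ {n : ℕ} (x : X ⟶ (ner.obj A).obj (op (.mk (n + 2))))
    (h₀ : x ≫ (ner.obj A).δ 0 = 0) (h₁ : x ≫ (ner.obj A).δ 1 = 0) : x = 0 := by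
  -- An edge that avoids the vertex `k` is an edge of the `k`-th face.
  have key (k : Fin (n + 3)) (hk : x ≫ (ner.obj A).δ k = 0) {i j : Fin (n + 3)} (hi : i ≠ k)
      (hj : j ≠ k) (h : i ≤ j) : edge x (n := op (.mk (n + 2))) h = 0 := by
    obtain ⟨i, rfl⟩ := Fin.exists_succAbove_eq hi
    obtain ⟨j, rfl⟩ := Fin.exists_succAbove_eq hj
    have h' : i ≤ j := (Fin.strictMono_succAbove k).le_iff_le.1 h
    have := edge_δ x k h'
    rw [hk] at this
    exact this.symm.trans (edge_zero (n := op (.mk (n + 1))) h')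
  have hv : 2 % (n + 3) = 2 := Nat.mod_eq_of_lt (by lia)
  have h₂ : (2 : Fin (n + 3)) ≠ 0 := by simp [Fin.ext_iff, hv]
  have h₃ : (2 : Fin (n + 3)) ≠ 1 := by simp [Fin.ext_iff, hv]
  have h₁₂ : (1 : Fin (n + 3)) ≤ 2 := by simp [Fin.le_def, hv]
  -- Only the edge from `0` to `1` lies in neither of the two faces. Its composite with the edge
  -- from `1` to `2`, which is zero, is the edge from `0` to `2`, also zero; hence it is zero
  -- itself.
  have e {i j : Fin (n + 3)} (h : i ≤ j) : edge x (n := op (.mk (n + 2))) h = 0 := by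
    by_cases hi : i = 0
    · subst hi
      by_cases hj : j = 1
      · subst hj
        have := edge_comp x (n := op (.mk (n + 2))) h h₁₂
        rw [key 1 h₁ Fin.zero_ne_one h₃] at this
        simp only [key 0 h₀ Fin.zero_ne_one.symm h₂ h₁₂] at this
        rw [comp_zero'] at this
        exact this.symm
      · exact key 1 h₁ Fin.zero_ne_one hj h
    · exact key 0 h₀ hi (fun hj => hi (Fin.le_zero_iff.1 (hj ▸ h))) h
  refine ner_hom_ext (fun i => ?_) (fun i j h => (e h).trans (edge_zero h).symm)
  rw [← edge_d₀ x le_rfl, e, vertex_zero, zero_comp]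

end zero

end InternalCat

/-! ### Left homology of short complexes with a vanishing morphism -/

section LeftHomology

variable {C : Type u} [Category.{v} C] [HasZeroMorphisms C] {S₁ S₂ : ShortComplex C}

lemma leftHomologyMapData_isIso_iff [S₁.HasLeftHomology] [S₂.HasLeftHomology] {φ : S₁ ⟶ S₂}
    {h₁ : S₁.LeftHomologyData} {h₂ : S₂.LeftHomologyData}
    (γ : ShortComplex.LeftHomologyMapData φ h₁ h₂) :
    IsIso (ShortComplex.leftHomologyMap φ) ↔ IsIso γ.φH := by
  rw [γ.leftHomologyMap_eq, isIso_comp_left_iff, isIso_comp_right_iff]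

lemma hasLeftHomology_of_f_eq_zero [HasKernels C] (hf : S₁.f = 0) : S₁.HasLeftHomology :=
  .mk' (.ofIsLimitKernelFork S₁ hf _ (kernelIsKernel S₁.g))

lemma isIso_kernel_map_iff [HasKernels C] {X Y X' Y' : C} {g : X ⟶ Y} {g' : X' ⟶ Y'} {a : X ⟶ X'}
    {k : kernel g ⟶ kernel g'} (hk : k ≫ kernel.ι g' = kernel.ι g ≫ a) :
    IsIso k ↔ ∀ ⦃Z : C⦄ (y : Z ⟶ X'), y ≫ g' = 0 → ∃! x : Z ⟶ X, x ≫ g = 0 ∧ x ≫ a = y := by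
  rw [isIso_iff_yoneda_map_bijective]
  refine forall_congr' fun Z => ⟨fun h y hy => ?_, fun h => ⟨fun a b (e : a ≫ k = b ≫ k) => ?_,
    fun b => ?_⟩⟩
  · obtain ⟨x, hx : x ≫ k = kernel.lift g' y hy⟩ := h.2 (kernel.lift g' y hy)
    refine ⟨x ≫ kernel.ι g, ⟨by simp, ?_⟩, fun x' ⟨h₀, h₁⟩ => ?_⟩
    · rw [Category.assoc, ← hk, reassoc_of% hx, kernel.lift_ι]
    · have : kernel.lift g x' h₀ = x := h.1 (by
        change _ ≫ k = x ≫ k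
        rw [hx, ← cancel_mono (kernel.ι g'), Category.assoc, hk, kernel.lift_ι_assoc, h₁,
          kernel.lift_ι])
      rw [← this, kernel.lift_ι]
  · refine (cancel_mono (kernel.ι g)).1 ((h (a ≫ k ≫ kernel.ι g') (by simp)).unique
      ⟨by simp, ?_⟩ ⟨by simp, ?_⟩)
    · rw [Category.assoc, hk]
    · rw [Category.assoc, ← hk, reassoc_of% e]
  · obtain ⟨x, ⟨h₀, h₁⟩, -⟩ := h (b ≫ kernel.ι g') (by simp)
    refine ⟨kernel.lift g x h₀, ?_⟩
    change _ ≫ k = b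
    rw [← cancel_mono (kernel.ι g'), Category.assoc, hk, kernel.lift_ι_assoc, h₁]

/-- When `f` vanishes, the left homology is the kernel of `g`, and Yoneda describes isomorphisms of
kernels by elements. -/
lemma isIso_leftHomologyMap_iff_of_f_eq_zero [HasKernels C] [S₁.HasLeftHomology]
    [S₂.HasLeftHomology] (φ : S₁ ⟶ S₂) (hf₁ : S₁.f = 0) (hf₂ : S₂.f = 0) :
    IsIso (ShortComplex.leftHomologyMap φ) ↔
      ∀ ⦃Z : C⦄ (y : Z ⟶ S₂.X₂), y ≫ S₂.g = 0 →
        ∃! x : Z ⟶ S₁.X₂, x ≫ S₁.g = 0 ∧ x ≫ φ.τ₂ = y := by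
  have hk : kernel.map S₁.g S₂.g φ.τ₂ φ.τ₃ φ.comm₂₃.symm ≫ kernel.ι S₂.g =
    kernel.ι S₁.g ≫ φ.τ₂ := kernel.lift_ι ..
  exact (leftHomologyMapData_isIso_iff (.ofIsLimitKernelFork φ hf₁ _ (kernelIsKernel S₁.g) hf₂ _
    (kernelIsKernel S₂.g) _ hk.symm)).trans (isIso_kernel_map_iff hk)

end LeftHomology

/-! ### The Moore complex of the nerve -/

namespace InternalCat

variable {C : Type u} [Category.{v} C] [HasFiniteLimits C] [HasZeroMorphisms C]
  {A B : InternalCat C} (f : A ⟶ B)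

section Complex

variable (A) (n : ℕ)

/-- The source of the differential is indexed by the predecessor of `n` in the complex shape.
Stating only the vanishing of a composite lets `key` generalize this index and substitute `n + 1`,
without transport between objects. -/
lemma homologyShortComplex_f_comp_eq_zero_iff {T : C} (t : mooreObj (ner.obj A) n ⟶ T) :
    ((homologyShortComplex n).obj A).f ≫ t = 0 ↔ mooreD (ner.obj A) n ≫ t = 0 := by
  have key (j : ℕ) (hj : j = n + 1) :
      (mooreComplex.obj (ner.obj A)).d j n ≫ t = 0 ↔ mooreD (ner.obj A) n ≫ t = 0 := by
    subst hj
    exact Eq.congr (congrArg (· ≫ t) (ChainComplex.of_d _ _ _)) rfl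
  exact key _ (ChainComplex.prev _ _)

lemma homologyShortComplex_zero_g : ((homologyShortComplex 0).obj A).g = 0 :=
  have key (j : ℕ) (hj : j = 0) : (mooreComplex.obj (ner.obj A)).d 0 j = 0 := by
    subst hj
    exact HomologicalComplex.shape _ _ _ (Nat.succ_ne_zero 0)
  key _ ChainComplex.next_nat_zero

lemma comp_homologyShortComplex_succ_g_eq_zero_iff {T : C}
    (t : T ⟶ mooreObj (ner.obj A) (n + 1)) :
    t ≫ ((homologyShortComplex (n + 1)).obj A).g = 0 ↔ t ≫ mooreD (ner.obj A) n = 0 := by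
  have key (j : ℕ) (hj : j = n) : t ≫ (mooreComplex.obj (ner.obj A)).d (n + 1) j = 0 ↔
      t ≫ mooreD (ner.obj A) n = 0 := by
    subst hj
    exact Eq.congr (congrArg (t ≫ ·) (ChainComplex.of_d _ _ _)) rfl
  exact key _ (ChainComplex.next_nat_succ _)

end Complex

/-- From degree two on, the Moore object is killed by both `∂₀` and `∂₁`, so `eq_zero_of_comp_δ`
applies: the Moore complex of a nerve lives in degrees zero and one. -/
lemma eq_zero_of_mooreObj {Z : C} {n : ℕ} (x : Z ⟶ mooreObj (ner.obj A) (n + 2)) : x = 0 := by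
  rw [← cancel_mono (mooreι (ner.obj A) (n + 2)), zero_comp]
  refine eq_zero_of_comp_δ _ ?_ ?_
  · rw [Category.assoc]
    exact (congrArg (x ≫ ·) (mooreι_δ (ner.obj A) (n + 1) 0)).trans comp_zero
  · rw [Category.assoc]
    exact (congrArg (x ≫ ·) (mooreι_δ (ner.obj A) (n + 1) 1)).trans comp_zero

lemma homologyShortComplex_succ_f (n : ℕ) : ((homologyShortComplex (n + 1)).obj A).f = 0 := by
  have := (homologyShortComplex_f_comp_eq_zero_iff A (n + 1) (𝟙 _)).2
    ((Category.comp_id (mooreD (ner.obj A) (n + 1))).trans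
      (((Category.id_comp _).symm.trans
        (congrArg (· ≫ mooreD (ner.obj A) (n + 1)) (eq_zero_of_mooreObj (𝟙 _)))).trans zero_comp))
  exact (Category.comp_id _).symm.trans this

/-- The arrow given by a generalized element of the first Moore object. -/
def mooreArrow {Z : C} (x : Z ⟶ mooreObj (ner.obj A) 1) : Z ⟶ A.arr :=
  edge (x ≫ mooreι (ner.obj A) 1) (n := op (.mk 1)) (zero_le_one : (0 : Fin 2) ≤ 1)

/-- The face `∂₀` of an arrow omits the domain and keeps the codomain, so the first Moore object is
the kernel of `d₁`. -/
lemma mooreArrow_d₁ {Z : C} (x : Z ⟶ mooreObj (ner.obj A) 1) : mooreArrow x ≫ A.d₁ = 0 := by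
  have h : (x ≫ mooreι (ner.obj A) 1) ≫ (ner.obj A).δ 0 = 0 := by
    rw [Category.assoc]
    exact (congrArg (x ≫ ·) (mooreι_δ (ner.obj A) 0 0)).trans comp_zero
  have := vertex_δ (x ≫ mooreι (ner.obj A) 1) 0 0
  rw [h] at this
  exact (edge_d₁ ..).trans (this.symm.trans (vertex_zero (n := op (.mk 0)) _))

lemma mooreArrow_injective {Z : C} {x y : Z ⟶ mooreObj (ner.obj A) 1}
    (h : mooreArrow x = mooreArrow y) : x = y :=
  (cancel_mono (mooreι (ner.obj A) 1)).1 (edge_zero_one_bijective.1 h)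

lemma exists_mooreArrow_eq {Z : C} (a : Z ⟶ A.arr) (ha : a ≫ A.d₁ = 0) :
    ∃ x : Z ⟶ mooreObj (ner.obj A) 1, mooreArrow x = a := by
  obtain ⟨y, rfl⟩ := edge_zero_one_bijective.2 a
  obtain ⟨x, rfl⟩ := exists_mooreLift (ner.obj A) y fun i => by
    obtain rfl := Subsingleton.elim (α := Fin 1) i 0
    refine vertex_zero_bijective.1 ?_
    exact (vertex_δ y 0 0).trans (((edge_d₁ y _).symm.trans ha).trans
      (vertex_zero (n := op (.mk 0)) _).symm)
  exact ⟨x, rfl⟩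

lemma mooreArrow_mooreMap {Z : C} (x : Z ⟶ mooreObj (ner.obj A) 1) :
    mooreArrow (x ≫ mooreMap (ner.map f) 1) = mooreArrow x ≫ f.f₁ := by
  rw [mooreArrow, Category.assoc, mooreMap_ι, ← Category.assoc]
  exact edge_app ..

variable (A) in
/-- The isomorphism of the zeroth Moore object of the nerve with the object of objects. -/
def nerObjIso : mooreObj (ner.obj A) 0 ≅ A.obj :=
  have : IsIso (vertex (n := op (.mk 0)) (𝟙 (mooreObj (ner.obj A) 0)) 0) :=
    isIso_of_yoneda_map_bijective _ fun X => by
      have e : (fun x : X ⟶ mooreObj (ner.obj A) 0 =>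
          x ≫ vertex (n := op (.mk 0)) (𝟙 (mooreObj (ner.obj A) 0)) 0) =
          fun x => vertex (n := op (.mk 0)) x 0 := funext fun x =>
        (vertex_precomp (n := op (.mk 0)) x (𝟙 _) 0).symm.trans
          (congrArg (vertex (n := op (.mk 0)) · 0) (Category.comp_id x))
      rw [e]
      exact vertex_zero_bijective
  asIso (vertex (n := op (.mk 0)) (𝟙 (mooreObj (ner.obj A) 0)) 0)

lemma comp_nerObjIso_hom {X : C} (x : X ⟶ mooreObj (ner.obj A) 0) :
    x ≫ (nerObjIso A).hom = vertex (n := op (.mk 0)) x 0 :=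
  (vertex_precomp (n := op (.mk 0)) x (𝟙 _) 0).symm.trans
    (congrArg (vertex (n := op (.mk 0)) · 0) (Category.comp_id x))

lemma nerObjIso_hom_f₀ :
    (nerObjIso A).hom ≫ f.f₀ = mooreMap (ner.map f) 0 ≫ (nerObjIso B).hom := by
  have h : mooreMap (ner.map f) 0 = 𝟙 (mooreObj (ner.obj A) 0) ≫ (ner.map f).app (op (.mk 0)) :=
    (Category.comp_id _).symm.trans (mooreMap_ι (ner.map f) 0)
  rw [comp_nerObjIso_hom, h]
  exact (vertex_app (n := op (.mk 0)) (𝟙 (mooreObj (ner.obj A) 0)) f 0).symm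

/-- The boundary is induced by `∂₁`, which omits the codomain and keeps the domain. -/
lemma comp_mooreD_nerObjIso_hom {Z : C} (x : Z ⟶ mooreObj (ner.obj A) 1) :
    x ≫ mooreD (ner.obj A) 0 ≫ (nerObjIso A).hom = mooreArrow x ≫ A.d₀ := by
  have h : mooreD (ner.obj A) 0 = mooreι (ner.obj A) 1 ≫ (ner.obj A).δ 1 :=
    (Category.comp_id _).symm.trans (mooreD_ι (ner.obj A) 0)
  rw [← Category.assoc, comp_nerObjIso_hom, h]
  refine (congrArg (vertex (n := op (.mk 0)) · 0) (Category.assoc ..).symm).trans ?_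
  exact (vertex_δ _ 1 0).trans (edge_d₀ ..).symm

lemma comp_mooreD_zero_eq_zero_iff {Z : C} (x : Z ⟶ mooreObj (ner.obj A) 1) :
    x ≫ mooreD (ner.obj A) 0 = 0 ↔ mooreArrow x ≫ A.d₀ = 0 := by
  rw [← comp_mooreD_nerObjIso_hom, ← Category.assoc, ← cancel_mono (nerObjIso A).hom, zero_comp]

/-! ### The homology of an internal category -/

lemma hasLeftHomology_succ (A : InternalCat C) (n : ℕ) :
    ((homologyShortComplex (n + 1)).obj A).HasLeftHomology :=
  hasLeftHomology_of_f_eq_zero (homologyShortComplex_succ_f n)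

/-- The boundary into degree one vanishes, so `H₁` is the kernel of `d₀` on the kernel of `d₁`: the
object of arrows from zero to zero. -/
lemma isIso_leftHomologyMap_one_iff [((homologyShortComplex 1).obj A).HasLeftHomology]
    [((homologyShortComplex 1).obj B).HasLeftHomology] :
    IsIso (ShortComplex.leftHomologyMap ((homologyShortComplex 1).map f)) ↔
      ∀ ⦃Z : C⦄ (t : Z ⟶ B.arr), t ≫ B.d₀ = 0 → t ≫ B.d₁ = 0 →
        ∃! s : Z ⟶ A.arr, s ≫ A.d₀ = 0 ∧ s ≫ A.d₁ = 0 ∧ s ≫ f.f₁ = t := by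
  rw [isIso_leftHomologyMap_iff_of_f_eq_zero _ (homologyShortComplex_succ_f 0)
    (homologyShortComplex_succ_f 0)]
  refine forall_congr' fun Z => ⟨fun h t h₀ h₁ => ?_, fun h y hy => ?_⟩
  · obtain ⟨y, rfl⟩ := exists_mooreArrow_eq t h₁
    obtain ⟨x, ⟨hx₀, hx⟩, hu⟩ := h y ((comp_homologyShortComplex_succ_g_eq_zero_iff B 0 y).2
      ((comp_mooreD_zero_eq_zero_iff y).2 h₀))
    refine ⟨mooreArrow x, ⟨(comp_mooreD_zero_eq_zero_iff x).1
      ((comp_homologyShortComplex_succ_g_eq_zero_iff A 0 x).1 hx₀), mooreArrow_d₁ x,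
      (mooreArrow_mooreMap f x).symm.trans (congrArg mooreArrow hx)⟩, fun s ⟨hs₀, hs₁, hs⟩ => ?_⟩
    obtain ⟨x', rfl⟩ := exists_mooreArrow_eq s hs₁
    exact congrArg mooreArrow (hu x' ⟨(comp_homologyShortComplex_succ_g_eq_zero_iff A 0 x').2
      ((comp_mooreD_zero_eq_zero_iff x').2 hs₀),
      mooreArrow_injective ((mooreArrow_mooreMap f x').trans hs)⟩)
  · obtain ⟨s, ⟨hs₀, hs₁, hs⟩, hu⟩ := h (mooreArrow y) ((comp_mooreD_zero_eq_zero_iff y).1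
      ((comp_homologyShortComplex_succ_g_eq_zero_iff B 0 y).1 hy)) (mooreArrow_d₁ y)
    obtain ⟨x, rfl⟩ := exists_mooreArrow_eq s hs₁
    refine ⟨x, ⟨(comp_homologyShortComplex_succ_g_eq_zero_iff A 0 x).2
      ((comp_mooreD_zero_eq_zero_iff x).2 hs₀),
      mooreArrow_injective ((mooreArrow_mooreMap f x).trans hs)⟩, fun x' ⟨h₀, hx'⟩ => ?_⟩
    exact mooreArrow_injective (hu _ ⟨(comp_mooreD_zero_eq_zero_iff x').1
      ((comp_homologyShortComplex_succ_g_eq_zero_iff A 0 x').1 h₀), mooreArrow_d₁ x',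
      (mooreArrow_mooreMap f x').symm.trans (congrArg mooreArrow hx')⟩)

lemma isIso_leftHomologyMap_add_two (n : ℕ)
    [((homologyShortComplex (n + 2)).obj A).HasLeftHomology]
    [((homologyShortComplex (n + 2)).obj B).HasLeftHomology] :
    IsIso (ShortComplex.leftHomologyMap ((homologyShortComplex (n + 2)).map f)) := by
  rw [isIso_leftHomologyMap_iff_of_f_eq_zero _ (homologyShortComplex_succ_f (n + 1))
    (homologyShortComplex_succ_f (n + 1))]
  exact fun Z y _ => ⟨0, ⟨zero_comp, zero_comp.trans (eq_zero_of_mooreObj y).symm⟩,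
    fun x _ => eq_zero_of_mooreObj x⟩

/-- `q` is a cokernel of the restriction of `d₀` to the kernel of `d₁`. -/
structure IsComponents (A : InternalCat C) {Q : C} (q : A.obj ⟶ Q) : Prop where
  condition : ∀ ⦃Z : C⦄ (a : Z ⟶ A.arr), a ≫ A.d₁ = 0 → a ≫ A.d₀ ≫ q = 0
  existsUnique : ∀ ⦃T : C⦄ (t : A.obj ⟶ T),
    (∀ ⦃Z : C⦄ (a : Z ⟶ A.arr), a ≫ A.d₁ = 0 → a ≫ A.d₀ ≫ t = 0) → ∃! s : Q ⟶ T, q ≫ s = t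

/-! ### Homology in degree zero as a cokernel -/

section Components

/-- The arrow of the identity of the first Moore object is the universal arrow with zero codomain.
-/
lemma mooreD_comp_eq_zero_iff {T : C} (t : A.obj ⟶ T) :
    mooreD (ner.obj A) 0 ≫ (nerObjIso A).hom ≫ t = 0 ↔
      ∀ ⦃Z : C⦄ (a : Z ⟶ A.arr), a ≫ A.d₁ = 0 → a ≫ A.d₀ ≫ t = 0 := by
  constructor
  · intro h Z a ha
    obtain ⟨x, rfl⟩ := exists_mooreArrow_eq a ha
    rw [← Category.assoc, ← comp_mooreD_nerObjIso_hom]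
    rw [Category.assoc, Category.assoc, h, comp_zero]
  · intro h
    have := h (mooreArrow (𝟙 _)) (mooreArrow_d₁ _)
    rw [← Category.assoc, ← comp_mooreD_nerObjIso_hom] at this
    simpa only [Category.id_comp, Category.assoc] using this

variable {Q Q' : C} {q : A.obj ⟶ Q} {q' : B.obj ⟶ Q'}

lemma IsComponents.f_comp (hq : IsComponents A q) :
    ((homologyShortComplex 0).obj A).f ≫ (nerObjIso A).hom ≫ q = 0 :=
  (homologyShortComplex_f_comp_eq_zero_iff A 0 _).2 ((mooreD_comp_eq_zero_iff q).2 hq.condition)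

/-- The cokernel cofork of the first morphism of the zeroth homology complex. -/
def IsComponents.cofork (hq : IsComponents A q) :
    CokernelCofork ((homologyShortComplex 0).obj A).f :=
  CokernelCofork.ofπ (Z := Q) ((nerObjIso A).hom ≫ q) hq.f_comp

/-- The cokernel cofork of `q` is a colimit. -/
def IsComponents.isColimit (hq : IsComponents A q) : IsColimit hq.cofork := by
  have h {T : C} (t : mooreObj (ner.obj A) 0 ⟶ T)
      (ht : ((homologyShortComplex 0).obj A).f ≫ t = 0) :
      ∃! s : Q ⟶ T, q ≫ s = (nerObjIso A).inv ≫ t := hq.existsUnique _ (by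
    rw [← mooreD_comp_eq_zero_iff, Iso.hom_inv_id_assoc]
    exact (homologyShortComplex_f_comp_eq_zero_iff A 0 t).1 ht)
  exact CokernelCofork.IsColimit.ofπ _ hq.f_comp (fun {T} t ht => (h t ht).choose)
    (fun {T} t ht => (Category.assoc ..).trans
      ((congrArg ((nerObjIso A).hom ≫ ·) (h t ht).choose_spec.1).trans
        ((nerObjIso A).hom_inv_id_assoc t)))
    (fun {T} t ht s hs => (h t ht).choose_spec.2 s
      ((Iso.eq_inv_comp (nerObjIso A)).2 ((Category.assoc ..).symm.trans hs)))

lemma IsComponents.hasLeftHomology (hq : IsComponents A q) :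
    ((homologyShortComplex 0).obj A).HasLeftHomology :=
  .mk' (.ofIsColimitCokernelCofork _ (homologyShortComplex_zero_g A) _ hq.isColimit)

lemma IsComponents.isIso_leftHomologyMap_iff [((homologyShortComplex 0).obj A).HasLeftHomology]
    [((homologyShortComplex 0).obj B).HasLeftHomology] (hq : IsComponents A q)
    (hq' : IsComponents B q') {k : Q ⟶ Q'} (hk : q ≫ k = f.f₀ ≫ q') :
    IsIso (ShortComplex.leftHomologyMap ((homologyShortComplex 0).map f)) ↔ IsIso k := by
  refine leftHomologyMapData_isIso_iff (.ofIsColimitCokernelCofork _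
    (homologyShortComplex_zero_g A) _ hq.isColimit (homologyShortComplex_zero_g B) _
    hq'.isColimit k ?_)
  refine (Category.assoc ..).symm.trans ((congrArg (· ≫ q') (nerObjIso_hom_f₀ f).symm).trans ?_)
  rw [Category.assoc, ← hk]
  exact (Category.assoc ..).symm

end Components

end InternalCat

/-! ### Covers in regular categories -/

section Regular

variable {C : Type u} [Category.{v} C] [Regular C]

lemma exists_cover_lift {X Y Z : C} (p : X ⟶ Y) [IsRegularEpi p] (y : Z ⟶ Y) :
    ∃ (Z' : C) (c : Z' ⟶ Z) (x : Z' ⟶ X), IsRegularEpi c ∧ x ≫ p = c ≫ y :=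
  ⟨_, pullback.snd p y, pullback.fst p y, inferInstance, pullback.condition⟩

lemma isRegularEpi_comp {X Y Z : C} (p : X ⟶ Y) (q : Y ⟶ Z) [IsRegularEpi p] [IsRegularEpi q] :
    IsRegularEpi (p ≫ q) :=
  have := strongEpi_comp p q
  inferInstance

/-- Regular and strong epimorphisms agree in a regular category, and the second factor of a strong
epimorphism is strong. -/
lemma isRegularEpi_of_cover {X Y Z : C} (p : X ⟶ Y) (c : Z ⟶ Y) (x : Z ⟶ X) [hc : IsRegularEpi c]
    (h : x ≫ p = c) : IsRegularEpi p := by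
  rw [← h] at hc
  have := strongEpi_of_strongEpi x p
  infer_instance

lemma stableRegularEpi_iff_isRegularEpi {X Y : C} (p : X ⟶ Y) :
    stableRegularEpi C p ↔ IsRegularEpi p :=
  ⟨isRegularEpi_of_stableRegularEpi, fun h _ _ _ _ _ sq =>
    Regular.regularEpiIsStableUnderBaseChange.of_isPullback sq.flip h⟩

end Regular

/-! ### Protomodular categories -/

namespace IsSemiAbelian

variable {C : Type u} [Category.{v} C] [HasFiniteLimits C] [HasZeroMorphisms C]
  (hC : IsSemiAbelian C)

include hC

/-- The hypothesis makes the kernel of `p` also a kernel of `p'`. Kernels are pullbacks along a zero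
object, so protomodularity turns the square from `b` to the identity of `Y` into a pullback, and `b`
is invertible. -/
lemma isIso_of_kernel {X X' Y : C} (p : X ⟶ Y) (p' : X' ⟶ Y) (b : X ⟶ X') (hb : b ≫ p' = p)
    [IsSplitEpi p]
    (h : ∀ ⦃Z : C⦄ (x' : Z ⟶ X'), x' ≫ p' = 0 → ∃! x : Z ⟶ X, x ≫ p = 0 ∧ x ≫ b = x') :
    IsIso b := by
  have key {K X Y O : C} (hO : IsZero O) (k : K ⟶ X) (a : K ⟶ O) (p : X ⟶ Y) (c : O ⟶ Y)
      (hk : k ≫ p = 0) (h : ∀ ⦃Z : C⦄ (x : Z ⟶ X), x ≫ p = 0 → ∃! y : Z ⟶ K, y ≫ k = x) :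
      IsPullback k a p c := by
    have e : k ≫ p = a ≫ c := by rw [hk, hO.eq_of_src c 0, comp_zero]
    have hs (s : PullbackCone p c) : s.fst ≫ p = 0 :=
      s.condition.trans ((congrArg (s.snd ≫ ·) (hO.eq_of_src c 0)).trans comp_zero)
    exact ⟨⟨e⟩, ⟨PullbackCone.IsLimit.mk e (fun s => (h s.fst (hs s)).choose)
      (fun s => (h s.fst (hs s)).choose_spec.1) (fun s => hO.eq_of_tgt _ _)
      (fun s m hm _ => (h s.fst (hs s)).choose_spec.2 m hm)⟩⟩
  obtain ⟨O, hO⟩ := hC.hasZeroObject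
  have sq := hC.protomodular (kernel.ι p) b (0 : O ⟶ Y) (𝟙 Y) 0 p p' inferInstance
    (by rw [hb, Category.comp_id])
    (key hO _ _ _ _ (kernel.condition p) fun Z x hx => ⟨kernel.lift p x hx, kernel.lift_ι _ _ _,
      fun y hy => by rw [← cancel_mono (kernel.ι p), hy, kernel.lift_ι]⟩)
    (key hO _ _ _ _ (by rw [Category.assoc, hb, kernel.condition]) fun Z x' hx' => by
      obtain ⟨x, ⟨hx₀, hx⟩, hu⟩ := h x' hx'
      refine ⟨kernel.lift p x hx₀, by simp [hx], fun y hy => ?_⟩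
      rw [← cancel_mono (kernel.ι p), kernel.lift_ι]
      exact hu _ ⟨by simp, by simpa using hy⟩)
  refine ⟨sq.lift (𝟙 X') p' (by simp), sq.hom_ext ?_ ?_, sq.lift_fst _ _ _⟩
  · rw [Category.assoc, sq.lift_fst, Category.comp_id, Category.id_comp]
  · rw [Category.assoc, sq.lift_snd, hb, Category.id_comp]

/-- The kernel of a split epimorphism and a section of it are jointly epimorphic. -/
lemma hom_ext_of_kernel {X Y W : C} (p : X ⟶ Y) (s : Y ⟶ X) (hs : s ≫ p = 𝟙 Y) {k l : X ⟶ W}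
    (h : ∀ ⦃Z : C⦄ (x : Z ⟶ X), x ≫ p = 0 → x ≫ k = x ≫ l) (h' : s ≫ k = s ≫ l) : k = l := by
  -- The equalizer contains the section and the kernel, so its inclusion is an isomorphism.
  have : IsSplitEpi (equalizer.ι k l ≫ p) := ⟨⟨equalizer.lift s h', by simp [hs]⟩⟩
  have := hC.isIso_of_kernel (equalizer.ι k l ≫ p) p (equalizer.ι k l) rfl fun Z x hx =>
    ⟨equalizer.lift x (h x hx), by simp [hx], fun y hy => by
      rw [← cancel_mono (equalizer.ι k l), hy.2, equalizer.lift_ι]⟩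
  exact eq_of_epi_equalizer

/-- `g` need not split, but its base change along itself does, by the diagonal. After this base
change `c` still induces a bijection on kernels, so it becomes invertible; `a` makes `z` an element
of the base change. -/
lemma existsUnique_of_kernel {P Q G Z : C} {g : P ⟶ G} {g' : Q ⟶ G} {c : P ⟶ Q} (hc : c ≫ g' = g)
    (h : ∀ ⦃Z : C⦄ (z : Z ⟶ Q), z ≫ g' = 0 → ∃! s : Z ⟶ P, s ≫ g = 0 ∧ s ≫ c = z)
    (a : Z ⟶ P) (z : Z ⟶ Q) (haz : a ≫ g = z ≫ g') : ∃! s : Z ⟶ P, s ≫ c = z := by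
  let b : pullback g g ⟶ pullback g g' := pullback.lift (pullback.fst g g) (pullback.snd g g ≫ c)
    (by rw [Category.assoc, hc, pullback.condition])
  have hb₀ : b ≫ pullback.fst g g' = pullback.fst g g := pullback.lift_fst ..
  have hb₁ : b ≫ pullback.snd g g' = pullback.snd g g ≫ c := pullback.lift_snd ..
  have : IsSplitEpi (pullback.fst g g) :=
    ⟨⟨pullback.lift (𝟙 P) (𝟙 P) rfl, pullback.lift_fst ..⟩⟩
  have : IsIso b := hC.isIso_of_kernel (pullback.fst g g) (pullback.fst g g') b hb₀ fun Z x hx => by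
    have hx' : (x ≫ pullback.snd g g') ≫ g' = 0 := by
      rw [Category.assoc, ← pullback.condition, reassoc_of% hx, zero_comp]
    obtain ⟨s, ⟨hs₀, hs⟩, hu⟩ := h (x ≫ pullback.snd g g') hx'
    refine ⟨pullback.lift 0 s (by rw [zero_comp, hs₀]), ⟨pullback.lift_fst .., ?_⟩,
      fun y ⟨hy₀, hy⟩ => ?_⟩
    · refine pullback.hom_ext ?_ ?_
      · rw [Category.assoc, hb₀, pullback.lift_fst, hx]
      · rw [Category.assoc, hb₁, pullback.lift_snd_assoc, hs]
    · refine pullback.hom_ext ?_ ?_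
      · rw [pullback.lift_fst, hy₀]
      · rw [pullback.lift_snd]
        refine hu _ ⟨?_, ?_⟩
        · rw [Category.assoc, ← pullback.condition, reassoc_of% hy₀, zero_comp]
        · rw [Category.assoc, ← hb₁, reassoc_of% hy]
  refine ⟨pullback.lift a z haz ≫ inv b ≫ pullback.snd g g, ?_, fun s hs => ?_⟩
  · simp only [Category.assoc, ← hb₁, IsIso.inv_hom_id_assoc, pullback.lift_snd]
  · have hs' : a ≫ g = s ≫ g := by rw [haz, ← hs, Category.assoc, hc]
    have : pullback.lift a s hs' ≫ b = pullback.lift a z haz := by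
      refine pullback.hom_ext ?_ ?_
      · rw [Category.assoc, hb₀, pullback.lift_fst, pullback.lift_fst]
      · rw [Category.assoc, hb₁, pullback.lift_snd_assoc, pullback.lift_snd, hs]
    rw [← this, Category.assoc, IsIso.hom_inv_id_assoc, pullback.lift_snd]

end IsSemiAbelian

/-! ### Internal categories in semi-abelian categories -/

namespace InternalCat

variable {C : Type u} [Category.{v} C] [HasFiniteLimits C] [HasZeroMorphisms C]

lemma zero_comp' {A : InternalCat C} {X : C} (a : X ⟶ A.arr)
    (h : (0 : X ⟶ A.arr) ≫ A.d₁ = a ≫ A.d₀) : A.comp 0 a h = a := by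
  have h' : a ≫ A.d₀ = 0 := h.symm.trans zero_comp
  refine (A.comp_congr ?_ rfl h).trans (A.id_comp' a)
  rw [reassoc_of% h', zero_comp]

variable (hC : IsSemiAbelian C)

include hC

/-- The shear map `(f, g) ↦ (f, f ; g)` commutes with the projections to `f`, and over `f = 0` it
does not change `g`. By `isIso_of_kernel` it is invertible, and the preimage of `(a, 1)` is `(a,
b)`. -/
lemma exists_left_inverse (A : InternalCat C) {X : C} (a : X ⟶ A.arr) :
    ∃ (b : X ⟶ A.arr) (h : a ≫ A.d₁ = b ≫ A.d₀), A.comp a b h = a ≫ A.d₀ ≫ A.i := by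
  let φ : pullback A.d₁ A.d₀ ⟶ pullback A.d₀ A.d₀ :=
    pullback.lift (pullback.fst _ _) A.m A.m_d₀.symm
  have hφ₀ : φ ≫ pullback.fst A.d₀ A.d₀ = pullback.fst A.d₁ A.d₀ := pullback.lift_fst ..
  have hφ₁ : φ ≫ pullback.snd A.d₀ A.d₀ = A.m := pullback.lift_snd ..
  have hm {Z : C} (x : Z ⟶ pullback A.d₁ A.d₀) : x ≫ A.m =
      A.comp (x ≫ pullback.fst A.d₁ A.d₀) (x ≫ pullback.snd A.d₁ A.d₀)
        (by rw [Category.assoc, Category.assoc, pullback.condition]) := by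
    rw [comp]
    congr 1
    refine pullback.hom_ext ?_ ?_
    · rw [pullback.lift_fst]
    · rw [pullback.lift_snd]
  have : IsSplitEpi (pullback.fst A.d₁ A.d₀) := ⟨⟨pullback.lift (𝟙 _) (A.d₁ ≫ A.i) (by
    rw [Category.assoc, A.i_d₀, Category.comp_id, Category.id_comp]), pullback.lift_fst ..⟩⟩
  have : IsIso φ := hC.isIso_of_kernel (pullback.fst A.d₁ A.d₀) (pullback.fst A.d₀ A.d₀) φ hφ₀
    fun Z x hx => by
      have w : (0 : Z ⟶ A.arr) ≫ A.d₁ = (x ≫ pullback.snd A.d₀ A.d₀) ≫ A.d₀ := by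
        rw [Category.assoc, ← pullback.condition, reassoc_of% hx, zero_comp, zero_comp]
      refine ⟨pullback.lift 0 _ w, ⟨pullback.lift_fst .., pullback.hom_ext ?_ ?_⟩,
        fun y ⟨hy₀, hy⟩ => pullback.hom_ext ?_ ?_⟩
      · rw [Category.assoc, hφ₀, pullback.lift_fst, hx]
      · rw [Category.assoc, hφ₁]
        exact zero_comp' _ w
      · rw [hy₀, pullback.lift_fst]
      · rw [pullback.lift_snd, ← hy, Category.assoc, hφ₁, hm]
        simp only [hy₀]
        exact (zero_comp' _ _).symm
  let x : X ⟶ pullback A.d₁ A.d₀ := pullback.lift a (a ≫ A.d₀ ≫ A.i) (by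
    rw [Category.assoc, Category.assoc, A.i_d₀, Category.comp_id]) ≫ inv φ
  have hx₀ : x ≫ pullback.fst A.d₁ A.d₀ = a := by
    simp only [x, Category.assoc, ← hφ₀, IsIso.inv_hom_id_assoc, pullback.lift_fst]
  have hx₁ : x ≫ A.m = a ≫ A.d₀ ≫ A.i := by
    simp only [x, Category.assoc, ← hφ₁, IsIso.inv_hom_id_assoc, pullback.lift_snd]
  refine ⟨x ≫ pullback.snd A.d₁ A.d₀, ?_, ?_⟩
  · rw [Category.assoc, ← pullback.condition, reassoc_of% hx₀]
  · rw [← hx₁, hm]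
    simp only [hx₀]

/-- Internal categories in semi-abelian categories are groupoids. -/
lemma exists_isInversePair (A : InternalCat C) {X : C} (a : X ⟶ A.arr) :
    ∃ b : X ⟶ A.arr, A.IsInversePair a b := by
  obtain ⟨b, h, hab⟩ := exists_left_inverse hC A a
  obtain ⟨c, h', hbc⟩ := exists_left_inverse hC A b
  have hb : b ≫ A.d₁ = a ≫ A.d₀ := by
    have := congrArg (· ≫ A.d₁) hab
    simpa only [comp_d₁, Category.assoc, A.i_d₁, Category.comp_id] using this
  -- `c = (a ; b) ; c = a ; (b ; c) = a`.
  have e : a = c := by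
    have := A.comp_assoc a b c h h'
    simp only [hab, hbc] at this
    have h₁ := A.comp_id' a
    have h₂ := A.id_comp' c
    simp only [reassoc_of% h] at h₁
    simp only [← reassoc_of% h', reassoc_of% hb] at h₂
    exact h₁.symm.trans (this.symm.trans h₂)
  subst e
  exact ⟨b, hb, h, hab, hbc.trans (by rw [reassoc_of% h])⟩

/-- `q` is a regular epimorphism whose kernel pair is the image of the arrows. -/
structure IsQuotient (A : InternalCat C) {Q : C} (q : A.obj ⟶ Q) : Prop where
  isRegularEpi : IsRegularEpi q
  w : A.d₀ ≫ q = A.d₁ ≫ q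
  exists_arrow : ∀ ⦃Z : C⦄ (x y : Z ⟶ A.obj), x ≫ q = y ≫ q →
    ∃ (Z' : C) (c : Z' ⟶ Z) (a : Z' ⟶ A.arr), IsRegularEpi c ∧ a ≫ A.d₀ = c ≫ x ∧
      a ≫ A.d₁ = c ≫ y

/-- The image `R` of `(d₀, d₁)` is an equivalence relation because `A` is a groupoid. Exactness
makes it the kernel pair of some `f`, and the regular epimorphism in the image factorization of `f`
has the same kernel pair. Elements of `R` come from arrows only after a cover. -/
lemma exists_isQuotient (A : InternalCat C) : ∃ (Q : C) (q : A.obj ⟶ Q), IsQuotient A q := by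
  have := hC.regular
  let F := Regular.strongEpiMonoFactorisation (prod.lift A.d₀ A.d₁)
  have hF : IsRegularEpi F.e := inferInstance
  have hm : Mono F.m := F.m_mono
  obtain ⟨R, e, m, he⟩ : ∃ (R : C) (e : A.arr ⟶ R) (m : R ⟶ A.obj ⨯ A.obj), IsRegularEpi e ∧
    Mono m ∧ e ≫ m = prod.lift A.d₀ A.d₁ := ⟨F.I, F.e, F.m, hF, hm, F.fac⟩
  obtain ⟨he, hm, hem⟩ := he
  have he₀ : e ≫ m ≫ prod.fst = A.d₀ := by rw [reassoc_of% hem, prod.lift_fst]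
  have he₁ : e ≫ m ≫ prod.snd = A.d₁ := by rw [reassoc_of% hem, prod.lift_snd]
  -- Membership in `R` may be checked on a cover, by diagonal fill-in against the monomorphism `m`.
  have hR {Z Z' : C} (x y : Z ⟶ A.obj) (c : Z' ⟶ Z) (a : Z' ⟶ A.arr) (hc : IsRegularEpi c)
      (h₀ : a ≫ A.d₀ = c ≫ x) (h₁ : a ≫ A.d₁ = c ≫ y) :
      ∃ r : Z ⟶ R, r ≫ m ≫ prod.fst = x ∧ r ≫ m ≫ prod.snd = y := by
    have sq : CommSq (a ≫ e) c m (prod.lift x y) := ⟨by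
      apply prod.hom_ext
      · simp only [Category.assoc, he₀, h₀, prod.lift_fst]
      · simp only [Category.assoc, he₁, h₁, prod.lift_snd]⟩
    refine ⟨sq.lift, ?_, ?_⟩
    · rw [sq.fac_right_assoc, prod.lift_fst]
    · rw [sq.fac_right_assoc, prod.lift_snd]
  obtain ⟨r, hr₀, hr₁⟩ := hR (𝟙 A.obj) (𝟙 A.obj) (𝟙 A.obj) A.i inferInstance
    (by rw [A.i_d₀, Category.comp_id]) (by rw [A.i_d₁, Category.comp_id])
  obtain ⟨s, hs₀, hs₁⟩ : ∃ s : R ⟶ R, s ≫ m ≫ prod.fst = m ≫ prod.snd ∧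
      s ≫ m ≫ prod.snd = m ≫ prod.fst := by
    obtain ⟨b, hb⟩ := exists_isInversePair hC A (𝟙 A.arr)
    refine hR _ _ e b he ?_ ?_
    · rw [← hb.w₁, he₁, Category.id_comp]
    · rw [hb.w₀, he₀, Category.id_comp]
  -- Transitivity: two successive covers lift a composable pair in `R` to composable arrows.
  obtain ⟨t, ht₀, ht₁⟩ : ∃ t : pullback (m ≫ prod.snd) (m ≫ prod.fst) ⟶ R,
      t ≫ m ≫ prod.fst = pullback.fst (m ≫ prod.snd) (m ≫ prod.fst) ≫ m ≫ prod.fst ∧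
      t ≫ m ≫ prod.snd = pullback.snd (m ≫ prod.snd) (m ≫ prod.fst) ≫ m ≫ prod.snd := by
    obtain ⟨Z, c, a, hc, ha⟩ := exists_cover_lift e (pullback.fst (m ≫ prod.snd) (m ≫ prod.fst))
    obtain ⟨Z', c', b, hc', hb⟩ :=
      exists_cover_lift e (c ≫ pullback.snd (m ≫ prod.snd) (m ≫ prod.fst))
    have hab : (c' ≫ a) ≫ A.d₁ = b ≫ A.d₀ := by
      simp only [Category.assoc, ← he₀, ← he₁, reassoc_of% ha, reassoc_of% hb,
        pullback.condition]
    refine hR _ _ (c' ≫ c) (A.comp _ _ hab) (isRegularEpi_comp c' c) ?_ ?_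
    · rw [comp_d₀, Category.assoc, ← he₀, reassoc_of% ha, Category.assoc]
    · rw [comp_d₁, ← he₁, reassoc_of% hb, Category.assoc]
  obtain ⟨Y, f, hf⟩ := hC.exact (m ≫ prod.fst) (m ≫ prod.snd) ⟨⟨{
    right_cancellation := fun Z x y h₀ h₁ => by
      rw [← cancel_mono m]
      apply prod.hom_ext <;> simpa only [Category.assoc]
    r := r
    reflexivity₁ := hr₀
    reflexivity₂ := hr₁
    s := s
    symmetry₁ := hs₀
    symmetry₂ := hs₁
    c := _
    isLimit := pullbackIsPullback _ _
    t := t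
    transitivity₁ := ht₀
    transitivity₂ := ht₁ }⟩⟩
  let G := Regular.strongEpiMonoFactorisation f
  have hG : IsRegularEpi G.e := inferInstance
  refine ⟨G.I, G.e, hG, ?_, fun Z x y h => ?_⟩
  · have hGm : Mono G.m := G.m_mono
    rw [← cancel_mono G.m, Category.assoc, Category.assoc, G.fac, ← he₀, ← he₁]
    simpa only [Category.assoc] using congrArg (e ≫ ·) hf.w
  · have h' : x ≫ f = y ≫ f := by rw [← G.fac, reassoc_of% h]
    obtain ⟨Z', c, a, hc, ha⟩ := exists_cover_lift e (hf.lift x y h')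
    refine ⟨Z', c, a, hc, ?_, ?_⟩
    · rw [← he₀, reassoc_of% ha, hf.lift_fst]
    · rw [← he₁, reassoc_of% ha, hf.lift_snd]

/-- The kernel of `d₁` and the identities are jointly epimorphic, so a `t` vanishing on `d₀` of that
kernel already satisfies `d₀ ≫ t = d₁ ≫ t`, and hence factors through `q`. -/
lemma IsQuotient.isComponents {A : InternalCat C} {Q : C} {q : A.obj ⟶ Q} (hq : IsQuotient A q) :
    IsComponents A q where
  condition Z a ha := by rw [hq.w, reassoc_of% ha, zero_comp]
  existsUnique T t ht := by
    have := hq.isRegularEpi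
    have e : A.d₀ ≫ t = A.d₁ ≫ t := hC.hom_ext_of_kernel A.d₁ A.i A.i_d₁
      (fun Z a ha => by rw [ht a ha, reassoc_of% ha, zero_comp])
      (by rw [← Category.assoc, ← Category.assoc, A.i_d₀, A.i_d₁])
    have e' : IsRegularEpi.left q ≫ t = IsRegularEpi.right q ≫ t := by
      obtain ⟨Z', c, a, hc, h₀, h₁⟩ := hq.exists_arrow _ _ (IsRegularEpi.w q)
      rw [← cancel_epi c, ← Category.assoc, ← h₀, ← Category.assoc, ← h₁, Category.assoc, e,
        Category.assoc]
    refine ⟨IsRegularEpi.desc q t e', IsRegularEpi.fac q t e', fun s hs => ?_⟩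
    rw [← cancel_epi q, hs, IsRegularEpi.fac]

/-! ### Comparison of the quotients of two internal categories -/

section

variable {A B : InternalCat C} {f : A ⟶ B} {Q Q' : C} {q : A.obj ⟶ Q} {q' : B.obj ⟶ Q'}
  (hq : IsQuotient A q) (hq' : IsQuotient B q') {k : Q ⟶ Q'} (hk : q ≫ k = f.f₀ ≫ q')

include hq hq' hk

omit [HasZeroMorphisms C] in
-- Elements identified by `k` are represented, after covers, by objects of `A` whose images are
-- joined by an arrow of `B`; fullness lifts this arrow to `A`.
lemma IsQuotient.mono_of_isFF (hf : IsFF f) : Mono k where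
  right_cancellation {Z} x y h := by
    have := hC.regular
    have := hq.isRegularEpi
    obtain ⟨Z₁, c₁, x', hc₁, hx⟩ := exists_cover_lift q x
    obtain ⟨Z₂, c₂, y', hc₂, hy⟩ := exists_cover_lift q (c₁ ≫ y)
    obtain ⟨Z₃, c₃, b, hc₃, hb₀, hb₁⟩ := hq'.exists_arrow ((c₂ ≫ x') ≫ f.f₀) (y' ≫ f.f₀) (by
      simp only [Category.assoc, ← hk, reassoc_of% hx, reassoc_of% hy, h])
    obtain ⟨a, ⟨ha₀, ha₁, -⟩, -⟩ := hf (c₃ ≫ c₂ ≫ x') (c₃ ≫ y') b (by simpa using hb₀)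
      (by simpa using hb₁)
    have e := congrArg (a ≫ ·) hq.w
    simp only [reassoc_of% ha₀, reassoc_of% ha₁, hx, hy] at e
    simpa only [cancel_epi] using e

omit [HasZeroMorphisms C] in
-- `q'` agrees at both ends of an arrow, so the cover of `Q'` obtained from essential surjectivity
-- factors through `k`.
lemma IsQuotient.isIso_of_isFF (hf : IsFF f) (hf' : IsEssSurj (stableRegularEpi C) f) :
    IsIso k := by
  have := hC.regular
  have := hq.mono_of_isFF hC hq' hk hf
  have := hq'.isRegularEpi
  have hp : IsRegularEpi (pullback.snd f.f₀ B.δ₁ ≫ B.δ₀) :=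
    (stableRegularEpi_iff_isRegularEpi _).1 hf'
  have := isRegularEpi_comp (pullback.snd f.f₀ B.δ₁ ≫ B.δ₀) q'
  have : IsRegularEpi k := isRegularEpi_of_cover k ((pullback.snd f.f₀ B.δ₁ ≫ B.δ₀) ≫ q')
    (pullback.fst f.f₀ B.δ₁ ≫ q) (by
      have : B.δ₀ ≫ q' = B.δ₁ ≫ q' := by
        rw [δ₀, δ₁, Category.assoc, Category.assoc, hq'.w]
      rw [Category.assoc, Category.assoc, hk, this, pullback.condition_assoc])
  exact isIso_of_mono_of_strongEpi k

/-- Locally, each object of `B` has the same class as the image of an object of `A`. After a further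
cover an arrow joins them, and it is invertible because `B` is a groupoid. -/
lemma IsQuotient.isEssSurj [IsIso k] : IsEssSurj (stableRegularEpi C) f := by
  have := hC.regular
  have := hq.isRegularEpi
  obtain ⟨Z, c, a, hc, ha⟩ := exists_cover_lift q (q' ≫ inv k)
  obtain ⟨Z', c', β, hc', h₀, h₁⟩ := hq'.exists_arrow c (a ≫ f.f₀) (by
    rw [Category.assoc, ← hk, reassoc_of% ha, IsIso.inv_hom_id, Category.comp_id])
  obtain ⟨β', hβ⟩ := exists_isInversePair hC B β
  have hι : B.isoLift β β' hβ ≫ B.isoι = β := isoLift_isoι ..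
  refine (stableRegularEpi_iff_isRegularEpi _).2 ?_
  have := isRegularEpi_comp c' c
  refine isRegularEpi_of_cover _ (c' ≫ c) (pullback.lift (c' ≫ a) (B.isoLift β β' hβ) ?_) ?_
  · rw [δ₁, reassoc_of% hι, h₁, Category.assoc]
  · rw [pullback.lift_snd_assoc, δ₀, reassoc_of% hι, h₀]

/-- The comparison `c` lies over `A₀ × A₀`, and `h` is its bijectivity on kernels. So an element of
the target lifts uniquely once some arrow of `A` has the same endpoints; injectivity of `k` supplies
that arrow after a cover. -/
lemma IsQuotient.isFF [Mono k] (h : ∀ ⦃Z : C⦄ (t : Z ⟶ B.arr), t ≫ B.d₀ = 0 → t ≫ B.d₁ = 0 →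
    ∃! s : Z ⟶ A.arr, s ≫ A.d₀ = 0 ∧ s ≫ A.d₁ = 0 ∧ s ≫ f.f₁ = t) : IsFF f := by
  have := hC.regular
  let c : A.arr ⟶ B.pullArr f.f₀ := pullLift A.d₀ A.d₁ f.f₁ f.f₁_d₀ f.f₁_d₁
  have hc₀ : c ≫ B.pullSrc f.f₀ = A.d₀ := pullLift_src ..
  have hc₁ : c ≫ B.pullTgt f.f₀ = A.d₁ := pullLift_tgt ..
  have hc : c ≫ B.pullVal f.f₀ = f.f₁ := pullLift_val ..
  have key {Z : C} (a : Z ⟶ A.arr) (z : Z ⟶ B.pullArr f.f₀) (h₀ : a ≫ A.d₀ = z ≫ B.pullSrc f.f₀)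
      (h₁ : a ≫ A.d₁ = z ≫ B.pullTgt f.f₀) : ∃! s : Z ⟶ A.arr, s ≫ c = z := by
    refine hC.existsUnique_of_kernel (g := prod.lift A.d₀ A.d₁)
      (g' := prod.lift (B.pullSrc f.f₀) (B.pullTgt f.f₀)) ?_ (fun Z z hz => ?_) a z ?_
    · rw [prod.comp_lift, hc₀, hc₁]
    · have hz₀ : z ≫ B.pullSrc f.f₀ = 0 := by
        have := congrArg (· ≫ prod.fst) hz
        simpa only [Category.assoc, prod.lift_fst, zero_comp] using this
      have hz₁ : z ≫ B.pullTgt f.f₀ = 0 := by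
        have := congrArg (· ≫ prod.snd) hz
        simpa only [Category.assoc, prod.lift_snd, zero_comp] using this
      obtain ⟨s, ⟨hs₀, hs₁, hs⟩, hu⟩ := h (z ≫ B.pullVal f.f₀)
        (by rw [Category.assoc, pullVal_d₀, reassoc_of% hz₀, zero_comp])
        (by rw [Category.assoc, pullVal_d₁, reassoc_of% hz₁, zero_comp])
      refine ⟨s, ⟨?_, pullArr_ext ?_ ?_ ?_⟩, fun s' ⟨hs', hsc⟩ => hu s' ⟨?_, ?_, ?_⟩⟩
      · rw [prod.comp_lift, hs₀, hs₁]
        apply prod.hom_ext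
        · rw [prod.lift_fst, zero_comp]
        · rw [prod.lift_snd, zero_comp]
      · rw [Category.assoc, hc₀, hs₀, hz₀]
      · rw [Category.assoc, hc₁, hs₁, hz₁]
      · rw [Category.assoc, hc, hs]
      · rw [← hc₀, reassoc_of% hsc, hz₀]
      · rw [← hc₁, reassoc_of% hsc, hz₁]
      · rw [← hc, reassoc_of% hsc]
    · rw [prod.comp_lift, prod.comp_lift, h₀, h₁]
  have : Mono c := ⟨fun {Z} s s' e => (key s (s' ≫ c)
    (by rw [← hc₀, reassoc_of% e, Category.assoc])
    (by rw [← hc₁, reassoc_of% e, Category.assoc])).unique e rfl⟩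
  have : IsRegularEpi c := by
    -- The images of the two endpoints are joined in `B`, so they agree in `Q'` and, `k` being mono,
    -- the endpoints agree in `Q`.
    obtain ⟨Z, d, a, hd, h₀, h₁⟩ := hq.exists_arrow (B.pullSrc f.f₀) (B.pullTgt f.f₀) (by
      rw [← cancel_mono k, Category.assoc, Category.assoc, hk, ← Category.assoc, ← Category.assoc,
        ← pullVal_d₀, ← pullVal_d₁, Category.assoc, Category.assoc, hq'.w])
    obtain ⟨s, hs, -⟩ := key a d h₀ h₁
    exact isRegularEpi_of_cover c d s hs
  have : IsIso c := isIso_of_mono_of_strongEpi c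
  intro Z x y t h₀ h₁
  refine ⟨pullLift x y t h₀ h₁ ≫ inv c, ⟨?_, ?_, ?_⟩, fun s ⟨hs₀, hs₁, hs⟩ => ?_⟩
  · rw [← hc₀]; simp
  · rw [← hc₁]; simp
  · rw [← hc]; simp
  · rw [IsIso.eq_comp_inv]
    exact pullArr_ext (by simp [hc₀, hs₀]) (by simp [hc₁, hs₁]) (by simp [hc, hs])

end

lemma hasLeftHomology (A : InternalCat C) (n : ℕ) :
    ((homologyShortComplex n).obj A).HasLeftHomology := by
  obtain _ | n := n
  · obtain ⟨Q, q, hq⟩ := exists_isQuotient hC A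
    exact (hq.isComponents hC).hasLeftHomology
  · exact hasLeftHomology_succ A n

/-- The comparison `k` of quotients represents `H₀ f`, the bijection on arrows from zero to zero is
`H₁ f`, and the higher homology vanishes. -/
lemma bungePareEquivalences_iff_isIso_leftHomologyMap
    [∀ (A : InternalCat C) (n : ℕ), ((homologyShortComplex n).obj A).HasLeftHomology]
    {A B : InternalCat C} (f : A ⟶ B) : bungePareEquivalences C f ↔
      ∀ n : ℕ, IsIso (ShortComplex.leftHomologyMap ((homologyShortComplex n).map f)) := by
  obtain ⟨Q, q, hq⟩ := exists_isQuotient hC A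
  obtain ⟨Q', q', hq'⟩ := exists_isQuotient hC B
  obtain ⟨k, hk, -⟩ := (hq.isComponents hC).existsUnique (f.f₀ ≫ q') fun Z a ha => by
    rw [← reassoc_of% f.f₁_d₀, hq'.w, reassoc_of% f.f₁_d₁, reassoc_of% ha, zero_comp]
  have h0 := (hq.isComponents hC).isIso_leftHomologyMap_iff f (hq'.isComponents hC) hk
  rw [bungePareEquivalences, relEquivalences_iff]
  constructor
  · rintro ⟨hf, hf'⟩ n
    obtain _ | _ | n := n
    · exact h0.2 (hq.isIso_of_isFF hC hq' hk hf hf')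
    · rw [isIso_leftHomologyMap_one_iff]
      exact fun Z t h₀ h₁ => hf 0 0 t (h₀.trans zero_comp.symm) (h₁.trans zero_comp.symm)
    · exact isIso_leftHomologyMap_add_two f n
  · intro h
    have := h0.1 (h 0)
    exact ⟨hq.isFF hC hq' hk ((isIso_leftHomologyMap_one_iff f).1 (h 1)),
      hq.isEssSurj hC hq' hk⟩

end InternalCat

end

theorem mainTheorem11 :
    -- the general theorem
    (∀ (C : Type u) [Category.{v} C] [HasFiniteLimits C] [HasFiniteLimits (InternalCat C)]
      [HasFiniteColimits (InternalCat C)] (T : GrothendieckTopology C),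
      (tEquivalences T).HasTwoOutOfThreeProperty → HasEnoughProjectivesRel (tEpi T) →
      IsModelStructure (tFibrations T) (tCofibrations T) (tEquivalences T)) ∧
    -- the regular epimorphism topology
    (∀ (C : Type u) [Category.{v} C] [HasFiniteLimits C],
      tEpi (regularEpiTopology C) = stableRegularEpi C ∧
      tEquivalences (regularEpiTopology C) = bungePareEquivalences C ∧
      (HasFiniteLimits (InternalCat C) → HasFiniteColimits (InternalCat C) →
        HasEnoughProjectivesRel (stableRegularEpi C) →
        IsModelStructure (tFibrations (regularEpiTopology C)) (tCofibrations (regularEpiTopology C))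
          (bungePareEquivalences C))) ∧
    -- homology isomorphisms in the semi-abelian case
    (∀ (C : Type u) [Category.{v} C] [HasFiniteLimits C] [HasZeroMorphisms C],
      IsSemiAbelian C →
      ∃ _ : ∀ (A : InternalCat C) (n : ℕ), ((homologyShortComplex n).obj A).HasLeftHomology,
        ∀ ⦃A B : InternalCat C⦄ (f : A ⟶ B), bungePareEquivalences C f ↔
          ∀ n : ℕ, IsIso (ShortComplex.leftHomologyMap ((homologyShortComplex n).map f))) ∧
    -- the folk structure: the trivial topology on the category of sets
    (underlyingCat.{w}.IsEquivalence ∧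
      IsModelStructure (tFibrations (⊥ : GrothendieckTopology (Type w)))
        (tCofibrations (⊥ : GrothendieckTopology (Type w)))
        (tEquivalences (⊥ : GrothendieckTopology (Type w))) ∧
      ∀ ⦃A B : InternalCat (Type w)⦄ (f : A ⟶ B),
        (tEquivalences ⊥ f ↔ (underlyingCat.map f).toFunctor.IsEquivalence) ∧
        (tCofibrations ⊥ f ↔ Function.Injective (underlyingCat.map f).toFunctor.obj) ∧
        (tFibrations ⊥ f ↔
          ∀ (e : underlyingCat.obj A) (b : underlyingCat.obj B)
            (β : b ≅ (underlyingCat.map f).toFunctor.obj e),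
            ∃ (e' : underlyingCat.obj A) (ε : e' ≅ e)
              (h : (underlyingCat.map f).toFunctor.obj e' = b),
              (underlyingCat.map f).toFunctor.map ε.hom = eqToHom h ≫ β.hom)) := by
  refine ⟨fun C _ _ _ _ T h₂ hP => isModelStructure_of_tEpi T h₂ hP,
    fun C _ _ => ⟨tEpi_regularEpiTopology, ?_, fun _ _ hP => regularEpiTopology_isModelStructure hP⟩,
    fun C _ _ _ hC => ?_, inferInstance, isModelStructure_tEpi_bot, fun A B f =>
      ⟨InternalCat.tEquivalences_bot_iff f, InternalCat.tCofibrations_bot_iff f,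
        InternalCat.tFibrations_bot_iff f⟩⟩
  · rw [tEquivalences, tEpi_regularEpiTopology, bungePareEquivalences]
  · have := InternalCat.hasLeftHomology hC
    exact ⟨this, fun A B f => InternalCat.bungePareEquivalences_iff_isIso_leftHomologyMap hC f⟩
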